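/- Let $W_1,\dots,W_s$ be finite-dimensional complex vector spaces with dimension vector $n=(n_1,\dots,n_s)$, $n_i=\dim W_i\ge 0$, $n\neq 0$, and let $V_{ij}$ ($1\le i,j\le s$) be finite-dimensional complex vector spaces with non-degenerate pairings $\omega_{ij}:V_{ij}\otimes V_{ji}\to\mathbb C$ such that $\omega_{ij}(e,e')=-\omega_{ji}(e',e)$. Put $d_{ij}=\dim V_{ij}$, $D=(d_{ij})$ and $a=\min_{i,j}(d_{ij}-2\delta_{ij})$. Let $$U(n)=\bigoplus_{i,j}\operatorname{Hom}(W_i,W_j)\otimes V_{ij},$$ with the symplectic form pairing $\operatorname{Hom}(W_i,W_j)\otimes V_{ij}$ with $\operatorname{Hom}(W_j,W_i)\otimes V_{ji}$ by $(A\otimes e,A'\otimes e')\mapsto \operatorname{tr}(A'A)\,\omega_{ij}(e,e')$, and with the conjugation action of $PG(n)=\big(\prod_i\operatorname{Aut}(W_i)\big)/\mathbb C^*$. Let $$\mu:U(n)\to\mathfrak{pg}(n)^*\cong\ker\Big(\bigoplus_j\mathfrak{gl}(W_j)\xrightarrow{\operatorname{tr}}\mathbb C\Big),\qquad \sum_{i,j,k}A_{ij}^{(k)}\otimes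 v_{ij}^{(k)}\mapsto\sum_{k,\ell}\sum_{i,j}\omega_{ij}\big(v_{ij}^{(k)},v_{ji}^{(\ell)}\big)\,A_{ij}^{(k)}A_{ji}^{(\ell)}$$ be the momentum map, and let $F(n)=\mu^{-1}(0)\subset U(n)$ be its scheme-theoretic null-fibre, i.e. the closed subscheme defined by the ideal generated by the components of $\mu$. Assume that $a\ge 2$. Then $F(n)$ is an irreducible normal complete intersection in $U(n)$, of dimension $n^t(D-I)n+1$. Moreover, $F(n)$ is regular in codimension $\le 3$ (its local rings of dimension $\le 3$ are regular), with the possible exception of the following two cases, where vertices $i$ with $n_i=0$ are disregarded: (1) $n=(1,1)$ and $d_{12}=2$, that is, there are $i\ne j$ with $n_i=n_j=1$, all other $n_k=0$, and $d_{ij}=2$; (2) $n=(2)$ and $d_{11}=4$, that is, there is $i$ with $n_i=2$, all other $n_k=0$, and $d_{ii}=4$. -/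

import Mathlib

open scoped TensorProduct

noncomputable section

namespace QuiverMoment

/-! ### Commutative algebra -/

/-- The ring `ℂ[U]` of polynomial functions on a complex vector space `U`: the algebra of functions
generated by the linear forms. -/
def polyFun (U : Type*) [AddCommGroup U] [Module ℂ U] : Subalgebra ℂ (U → ℂ) :=
  Algebra.adjoin ℂ (Set.range fun φ : Module.Dual ℂ U => (φ : U → ℂ))

/-- A ring is normal if all its localizations at primes are integrally closed domains. -/
def IsNormalRing (R : Type*) [CommRing R] : Prop :=
  ∀ (p : Ideal R) [p.IsPrime],
    IsDomain (Localization.AtPrime p) ∧ IsIntegrallyClosed (Localization.AtPrime p)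

/-- `R` is regular in codimension `≤ k` (Serre's condition `R_k`): the localizations at all primes
of height `≤ k` are regular local rings. -/
def IsRegularInCodim (R : Type*) [CommRing R] (k : ℕ) : Prop :=
  ∀ (p : Ideal R) [p.IsPrime], p.height ≤ k → IsRegularLocalRing (Localization.AtPrime p)

/-- The closed subscheme of the affine space `U` defined by the ideal `J ⊆ ℂ[U]` is a complete
intersection: it is non-empty of some codimension `c` and `J` is generated by `c` elements.
(For `J = ⊤` the Krull dimension is `⊥`, so that the condition fails.) -/
def IsCompleteIntersection (U : Type*) [AddCommGroup U] [Module ℂ U]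
    (J : Ideal (polyFun U)) : Prop :=
  ∃ (c : ℕ) (f : Fin c → polyFun U), Ideal.span (Set.range f) = J ∧
    ringKrullDim (polyFun U ⧸ J) + (c : WithBot ℕ∞) = (Module.finrank ℂ U : WithBot ℕ∞)

/-- Homogeneous quadratic functions are polynomial functions. -/
theorem quadratic_mem_polyFun {U : Type*} [AddCommGroup U] [Module ℂ U] [FiniteDimensional ℂ U]
    (B : U →ₗ[ℂ] U →ₗ[ℂ] ℂ) : (fun x => B x x) ∈ polyFun U := by
  classical
  let b := Module.finBasis ℂ U
  have h : (fun x => B x x) = ∑ i, ∑ j, B (b i) (b j) • ((b.coord i : U → ℂ) * (b.coord j)) := by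
    funext x
    conv_lhs => rw [← b.sum_repr x]
    simp only [map_sum, map_smul, LinearMap.sum_apply, LinearMap.smul_apply, Finset.sum_apply,
      Pi.smul_apply, Pi.mul_apply, Module.Basis.coord_apply, smul_eq_mul, Finset.mul_sum]
    rw [Finset.sum_comm]
    refine Finset.sum_congr rfl fun i _ => Finset.sum_congr rfl fun j _ => ?_
    ring
  rw [h]
  have hc : ∀ φ : Module.Dual ℂ U, (φ : U → ℂ) ∈ polyFun U :=
    fun φ => Algebra.subset_adjoin ⟨φ, rfl⟩
  exact Subalgebra.sum_mem _ fun i _ => Subalgebra.sum_mem _ fun j _ =>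
    Subalgebra.smul_mem _ (Subalgebra.mul_mem _ (hc (b.coord i)) (hc (b.coord j))) _

/-! ### The symplectic representation -/

/-- Non-degenerate pairings `V i j ⊗ V j i → ℂ` with `ω_{ij}(e, e') = - ω_{ji}(e', e)`. -/
structure SkewPairing {ι : Type*} (V : ι → ι → Type*) [∀ i j, AddCommGroup (V i j)]
    [∀ i j, Module ℂ (V i j)] where
  form : ∀ i j, V i j →ₗ[ℂ] V j i →ₗ[ℂ] ℂ
  nondegenerate : ∀ i j, (form i j).Nondegenerate
  skew : ∀ i j (e : V i j) (e' : V j i), form i j e e' = - form j i e' e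

section

variable {ι : Type*} (W : ι → Type*) [∀ i, AddCommGroup (W i)] [∀ i, Module ℂ (W i)]
  (V : ι → ι → Type*) [∀ i j, AddCommGroup (V i j)] [∀ i j, Module ℂ (V i j)]

/-- The vector space `U = ⨁_{i,j} Hom(W_i, W_j) ⊗ V_{ij}`. -/
abbrev Rep : Type _ := ∀ i j, (W i →ₗ[ℂ] W j) ⊗[ℂ] V i j

/-- The Lie algebra `𝔤 = ⨁_i 𝔤𝔩(W_i)` of `G = ∏_i Aut(W_i)`. -/
abbrev LieG : Type _ := ∀ i, W i →ₗ[ℂ] W i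

/-- The total trace `⨁_i 𝔤𝔩(W_i) → ℂ`. -/
def totalTrace [Fintype ι] : LieG W →ₗ[ℂ] ℂ :=
  ∑ i, LinearMap.trace ℂ (W i) ∘ₗ LinearMap.proj i

/-- The kernel of the total trace. Through the trace pairing `(A, B) ↦ ∑_i tr(A_i B_i)` on `𝔤`, it
is the dual of the Lie algebra `𝔤 / ℂ` of `PG = G / ℂ*`. -/
abbrev traceZero [Fintype ι] : Submodule ℂ (LieG W) := LinearMap.ker (totalTrace W)

variable {W V}

/-- The bilinear map `(A ⊗ e, A' ⊗ e') ↦ ω_{ij}(e, e') A A'`, for `A : W_i → W_j` and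
`A' : W_j → W_i`. -/
def contract (ω : SkewPairing V) (i j : ι) : ((W i →ₗ[ℂ] W j) ⊗[ℂ] V i j) →ₗ[ℂ]
    ((W j →ₗ[ℂ] W i) ⊗[ℂ] V j i) →ₗ[ℂ] (W j →ₗ[ℂ] W j) :=
  (TensorProduct.map₂ (LinearMap.llcomp ℂ (W j) (W i) (W j)) (ω.form i j)).compr₂
    (TensorProduct.rid ℂ (W j →ₗ[ℂ] W j)).toLinearMap

@[simp] theorem contract_tmul (ω : SkewPairing V) (i j : ι) (A : W i →ₗ[ℂ] W j) (e : V i j)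
    (A' : W j →ₗ[ℂ] W i) (e' : V j i) :
    contract ω i j (A ⊗ₜ e) (A' ⊗ₜ e') = ω.form i j e e' • (A ∘ₗ A') := by
  simp [contract, LinearMap.llcomp_apply']

theorem trace_contract [∀ i, FiniteDimensional ℂ (W i)] (ω : SkewPairing V) (i j : ι)
    (u : (W i →ₗ[ℂ] W j) ⊗[ℂ] V i j) (v : (W j →ₗ[ℂ] W i) ⊗[ℂ] V j i) :
    LinearMap.trace ℂ (W j) (contract ω i j u v)
      = - LinearMap.trace ℂ (W i) (contract ω j i v u) := by
  induction u with
  | zero => simp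
  | add u u' hu hu' => simp only [map_add, LinearMap.add_apply, hu, hu']; ring
  | tmul A e =>
    induction v with
    | zero => simp
    | add v v' hv hv' => simp only [map_add, LinearMap.add_apply, hv, hv']; ring
    | tmul A' e' =>
      simp only [contract_tmul, map_smul, smul_eq_mul]
      rw [ω.skew i j e e', LinearMap.trace_comp_comm']
      ring

/-- The action of `g ∈ G = ∏_i Aut(W_i)` on `U` by conjugation on the factors `Hom(W_i, W_j)`. -/
def act (g : ∀ i, W i ≃ₗ[ℂ] W i) : Rep W V →ₗ[ℂ] Rep W V :=
  LinearMap.pi fun i => LinearMap.pi fun j =>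
    (TensorProduct.map (((g i).arrowCongr (g j)).toLinearMap) LinearMap.id) ∘ₗ
      LinearMap.proj j ∘ₗ LinearMap.proj i

/-- The infinitesimal action of `a ∈ 𝔤` on `U`, `A ⊗ e ↦ (a_j A - A a_i) ⊗ e` for
`A : W_i → W_j`. -/
def infAct (a : LieG W) : Rep W V →ₗ[ℂ] Rep W V :=
  LinearMap.pi fun i => LinearMap.pi fun j =>
    (TensorProduct.map (LinearMap.llcomp ℂ (W i) (W j) (W j) (a j) -
        LinearMap.lcomp ℂ (W j) (a i)) LinearMap.id) ∘ₗ
      LinearMap.proj j ∘ₗ LinearMap.proj i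

theorem contract_equivariant (ω : SkewPairing V) (g : ∀ i, W i ≃ₗ[ℂ] W i) (i j : ι)
    (u : (W i →ₗ[ℂ] W j) ⊗[ℂ] V i j) (v : (W j →ₗ[ℂ] W i) ⊗[ℂ] V j i) :
    contract ω i j
        (TensorProduct.map (((g i).arrowCongr (g j)).toLinearMap) LinearMap.id u)
        (TensorProduct.map (((g j).arrowCongr (g i)).toLinearMap) LinearMap.id v)
      = (g j).conj (contract ω i j u v) := by
  induction u with
  | zero => simp
  | add u u' hu hu' => simp only [map_add, LinearMap.add_apply, hu, hu']
  | tmul A e =>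
    induction v with
    | zero => simp
    | add v v' hv hv' => simp only [map_add, hv, hv']
    | tmul A' e' =>
      ext w
      simp [LinearEquiv.conj_apply]

theorem trace_contract_infAct [∀ i, FiniteDimensional ℂ (W i)] (ω : SkewPairing V) (a : LieG W)
    (i j : ι) (u : (W i →ₗ[ℂ] W j) ⊗[ℂ] V i j) (v : (W j →ₗ[ℂ] W i) ⊗[ℂ] V j i) :
    LinearMap.trace ℂ (W j) (contract ω i j
        (TensorProduct.map (LinearMap.llcomp ℂ (W i) (W j) (W j) (a j) -
          LinearMap.lcomp ℂ (W j) (a i)) LinearMap.id u) v)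
      = LinearMap.trace ℂ (W j) (a j ∘ₗ contract ω i j u v)
        + LinearMap.trace ℂ (W i) (a i ∘ₗ contract ω j i v u) := by
  induction u with
  | zero => simp
  | add u u' hu hu' =>
    simp only [map_add, LinearMap.add_apply, LinearMap.comp_add, hu, hu']; ring
  | tmul A e =>
    induction v with
    | zero => simp
    | add v v' hv hv' =>
      simp only [map_add, LinearMap.add_apply, LinearMap.comp_add, hv, hv']; ring
    | tmul A' e' =>
      simp only [TensorProduct.map_tmul, LinearMap.sub_apply, TensorProduct.sub_tmul, map_sub,
        LinearMap.llcomp_apply', LinearMap.lcomp_apply', LinearMap.id_coe, id_eq, contract_tmul,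
        LinearMap.comp_smul, map_smul, smul_eq_mul]
      rw [ω.skew j i e' e, LinearMap.comp_assoc, LinearMap.comp_assoc,
        ← LinearMap.trace_comp_comm' A (a i ∘ₗ A'), LinearMap.comp_assoc]
      ring

variable [Fintype ι]

/-- The bilinear map `U × U → 𝔤` whose quadratic form is the momentum map. -/
def momentBilin (ω : SkewPairing V) : Rep W V →ₗ[ℂ] Rep W V →ₗ[ℂ] LieG W :=
  LinearMap.mk₂ ℂ (fun x y j => ∑ i, contract ω i j (x i j) (y j i))
    (fun x x' y => by funext j; simp [Finset.sum_add_distrib])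
    (fun c x y => by funext j; simp [Finset.smul_sum])
    (fun x y y' => by funext j; simp [Finset.sum_add_distrib])
    (fun c x y => by funext j; simp [Finset.smul_sum])

theorem momentBilin_apply (ω : SkewPairing V) (x y : Rep W V) (j : ι) :
    momentBilin ω x y j = ∑ i, contract ω i j (x i j) (y j i) := rfl

/-- The symplectic form on `U`: it pairs `Hom(W_i, W_j) ⊗ V_{ij}` with `Hom(W_j, W_i) ⊗ V_{ji}` by
`(A ⊗ e, A' ⊗ e') ↦ tr(A' A) ω_{ij}(e, e')`. -/
def sympForm (ω : SkewPairing V) (x y : Rep W V) : ℂ :=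
  totalTrace W (momentBilin ω x y)

theorem totalTrace_momentBilin [∀ i, FiniteDimensional ℂ (W i)] (ω : SkewPairing V)
    (x y : Rep W V) :
    totalTrace W (momentBilin ω x y) = - totalTrace W (momentBilin ω y x) := by
  simp only [totalTrace, LinearMap.sum_apply, LinearMap.comp_apply, LinearMap.proj_apply,
    momentBilin_apply, map_sum]
  rw [Finset.sum_comm, ← Finset.sum_neg_distrib]
  refine Finset.sum_congr rfl fun i _ => ?_
  rw [← Finset.sum_neg_distrib]
  exact Finset.sum_congr rfl fun j _ => trace_contract ω i j _ _

theorem momentBilin_self_mem [∀ i, FiniteDimensional ℂ (W i)] (ω : SkewPairing V)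
    (x : Rep W V) : momentBilin ω x x ∈ traceZero W := by
  rw [LinearMap.mem_ker]
  exact self_eq_neg.mp (totalTrace_momentBilin ω x x)

/-- The momentum map `μ : U → 𝔭𝔤* ≃ ker(tr : ⨁_j 𝔤𝔩(W_j) → ℂ)`,
`∑ A_{ij}^{(k)} ⊗ v_{ij}^{(k)} ↦ ∑ ω_{ij}(v_{ij}^{(k)}, v_{ji}^{(ℓ)}) A_{ij}^{(k)} A_{ji}^{(ℓ)}`. -/
def moment [∀ i, FiniteDimensional ℂ (W i)] (ω : SkewPairing V) (x : Rep W V) : traceZero W :=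
  ⟨momentBilin ω x x, momentBilin_self_mem ω x⟩

/-- `μ` is `G`-equivariant. -/
theorem moment_act [∀ i, FiniteDimensional ℂ (W i)] (ω : SkewPairing V)
    (g : ∀ i, W i ≃ₗ[ℂ] W i) (x : Rep W V) (j : ι) :
    (moment ω (act g x) : LieG W) j = (g j).conj ((moment ω x : LieG W) j) := by
  simp only [moment, momentBilin_apply, map_sum]
  exact Finset.sum_congr rfl fun i _ => contract_equivariant ω g i j _ _

/-- The defining property of a momentum map, `⟨dμ_x(ξ), a⟩ = ω(a·x, ξ)`, the derivative of the
quadratic map `μ` at `x` in the direction `ξ` being its polarization. -/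
theorem moment_deriv [∀ i, FiniteDimensional ℂ (W i)] (ω : SkewPairing V) (a : LieG W)
    (x ξ : Rep W V) :
    ∑ j, LinearMap.trace ℂ (W j) (a j ∘ₗ (momentBilin ω x ξ j + momentBilin ω ξ x j))
      = sympForm ω (infAct a x) ξ := by
  simp only [sympForm, totalTrace, LinearMap.sum_apply, LinearMap.comp_apply,
    LinearMap.proj_apply, momentBilin_apply, map_sum, infAct, LinearMap.pi_apply]
  have hs : ∀ (j : ι) (f : ι → W j →ₗ[ℂ] W j), LinearMap.trace ℂ (W j) (a j ∘ₗ ∑ i, f i)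
      = ∑ i, LinearMap.trace ℂ (W j) (a j ∘ₗ f i) := fun j f => by
    have h := map_sum (LinearMap.trace ℂ (W j) ∘ₗ LinearMap.llcomp ℂ (W j) (W j) (W j) (a j))
      f Finset.univ
    simpa only [LinearMap.comp_apply, LinearMap.llcomp_apply'] using h
  simp only [trace_contract_infAct, LinearMap.comp_add, map_add, Finset.sum_add_distrib, hs]
  congr 1
  exact Finset.sum_comm

variable [∀ i, FiniteDimensional ℂ (W i)] [∀ i j, FiniteDimensional ℂ (V i j)]

theorem moment_mem_polyFun (ω : SkewPairing V) (φ : Module.Dual ℂ (traceZero W)) :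
    (fun x : Rep W V => φ (moment ω x)) ∈ polyFun (Rep W V) := by
  obtain ⟨ψ, hψ⟩ := LinearMap.exists_extend φ
  have h := quadratic_mem_polyFun ((momentBilin (W := W) ω).compr₂ ψ)
  convert h using 2 with x
  rw [← hψ]
  rfl

/-- The ideal of the scheme-theoretic null-fibre `F = μ⁻¹(0)`, generated by the components of
`μ`. -/
def nullIdeal (W : ι → Type*) [∀ i, AddCommGroup (W i)] [∀ i, Module ℂ (W i)]
    [∀ i, FiniteDimensional ℂ (W i)] (ω : SkewPairing V) : Ideal (polyFun (Rep W V)) :=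
  Ideal.span (Set.range fun φ : Module.Dual ℂ (traceZero W) =>
    (⟨fun x => φ (moment ω x), moment_mem_polyFun ω φ⟩ : polyFun (Rep W V)))

/-- The coordinate ring of the affine scheme `F = μ⁻¹(0)`. -/
abbrev NullFibreRing (W : ι → Type*) [∀ i, AddCommGroup (W i)] [∀ i, Module ℂ (W i)]
    [∀ i, FiniteDimensional ℂ (W i)] (ω : SkewPairing V) : Type _ :=
  polyFun (Rep W V) ⧸ nullIdeal W ω

end

end QuiverMoment

end

namespace QuiverMoment

/-! ### Linear algebra: adjoint maps, semicontinuity of the rank, centralizers -/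

section LinearAlgebra

variable {K : Type*} [Field K]

/-! In bases adapted to the pairings, U is the representation space of a doubled quiver: arrows come
in pairs β, τβ, a point is a tuple u of square matrices of size m = Σ n_i, each supported on one
block, and μ(u) is a signed sum of the products u_β u_{τβ}. Its trace vanishes, so one diagonal
entry is redundant and c = dim g - 1 quadrics remain, where g is the algebra of block diagonal
matrices.

Everything rests on one estimate, `JacobianBound`. Let p be a prime containing these quadrics, K its
residue field, u the tautological K-point and T the tangent space of p at u. By the trace form, a
relation between the rows of the Jacobian matrix at u is a non-scalar matrix in the stabilizer of u
in g. The claim is that T then has codimension at least c + e + 1, with e = 2 always and e = 3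
outside the exceptional cases.

Derivations replace a stratification by orbit types, because every vector of T is Du for a
derivation D of K. Choose a in stab(u) with ad a of maximal rank, and let C be its centralizer in
all matrices. Differentiating [a,u] = 0 gives [a,Du] = [u,Da]. Differentiating [a,w] = 0 for w in C
shows that ad(Da) maps C into the image of ad a, so Da is orthogonal to [C,C]. By maximality every
element of stab(u) is orthogonal to [C,C] as well. Counting the pairs (Du, Da) gives
`exists_mem_stab_estimate`: dim T + dim stab + dim(g ∩ C) + dim [C,C] ≤ dim g + dim C + Σ_β dim(C ∩
block of β). The other inputs are dim C - dim [C,C] ≤ m, strict if dim C > m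
(`finrank_centralizer_le`), codim C ≥ 2m - 2, and d_ij ≥ 2 + 2δ_ij. For m ≤ 3 the estimate is
applied to all arrows. For m ≥ 4 it is applied to the positive arrows only, and the linearized
equation μ = 0 bounds the remaining directions so that dim stab cancels. The arithmetic is in
`finrank_tangent_add_le`.

The geometry follows from the bound. Where the Jacobian matrix has full rank, the equations are part
of a regular system of parameters. Elsewhere the prime has height at least c + e + 1. Hence F has
codimension c and is regular in codimension e. Polynomial rings are Cohen-Macaulay, so primes
associated to 0, respectively to a nonzerodivisor, lie over primes of height at most c, respectively
c + 1, where the quotient is regular. Serre's argument then gives normality, and the grading makes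
the spectrum connected, so the coordinate ring is a domain. -/

theorem finrank_range_le_of_adjoint {X X' Y Y' : Type*} [AddCommGroup X] [AddCommGroup X']
    [AddCommGroup Y] [AddCommGroup Y'] [Module K X] [Module K X'] [Module K Y] [Module K Y']
    [FiniteDimensional K Y] [FiniteDimensional K Y']
    (f : X →ₗ[K] Y) (g : Y' →ₗ[K] X') (B : X →ₗ[K] X' →ₗ[K] K) (B' : Y →ₗ[K] Y' →ₗ[K] K)
    (h : ∀ x y', B x (g y') = B' (f x) y') (hB : ∀ x', (∀ x, B x x' = 0) → x' = 0) :
    Module.finrank K (LinearMap.range g) ≤ Module.finrank K (LinearMap.range f) := by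
  let r : Y' →ₗ[K] Module.Dual K (LinearMap.range f) :=
    LinearMap.lcomp K K (LinearMap.range f).subtype ∘ₗ B'.flip
  -- If y' is orthogonal to the range of `f`, adjointness makes `g y'` orthogonal to all of X. So
  -- the rank of `g` is at most that of `r`, whose values lie in the dual of the range of `f`.
  have hr : LinearMap.ker r ≤ LinearMap.ker g := by
    intro y' hy'
    rw [LinearMap.mem_ker] at hy' ⊢
    refine hB _ fun x => ?_
    rw [h]
    exact LinearMap.congr_fun hy' ⟨f x, x, rfl⟩
  have h1 := LinearMap.finrank_range_add_finrank_ker r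
  have h2 := LinearMap.finrank_range_add_finrank_ker g
  have h3 := Submodule.finrank_mono hr
  have h4 : Module.finrank K (LinearMap.range r) ≤ Module.finrank K (LinearMap.range f) := by
    rw [← Subspace.dual_finrank_eq (K := K) (V := LinearMap.range f)]
    exact Submodule.finrank_le _
  omega

/-- First order semicontinuity of the rank: if the rank of `F + t Z` never exceeds that of `F`,
then `Z` maps the kernel of `F` into its range. -/
theorem apply_mem_range_of_finrank_range_le [Infinite K] {V V' : Type*} [AddCommGroup V]
    [AddCommGroup V'] [Module K V] [Module K V'] [FiniteDimensional K V] [FiniteDimensional K V']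
    (F Z : V →ₗ[K] V')
    (h : ∀ t : K, Module.finrank K (LinearMap.range (F + t • Z))
      ≤ Module.finrank K (LinearMap.range F))
    {w : V} (hw : F w = 0) : Z w ∈ LinearMap.range F := by
  set P := LinearMap.range F with hP
  by_contra hZ
  obtain ⟨φ, hφ, hφF⟩ := Submodule.exists_dual_map_eq_bot_of_notMem hZ inferInstance
  obtain ⟨s, hs⟩ : ∃ s : P →ₗ[K] V, F.rangeRestrict ∘ₗ s = LinearMap.id :=
    F.rangeRestrict.exists_rightInverse_of_surjective F.range_rangeRestrict
  obtain ⟨ρ, hρ⟩ := P.subtype.exists_leftInverse_of_injective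
    (Submodule.ker_subtype _)
  have hFs : ∀ y : P, F (s y) = y := fun y => congrArg Subtype.val (LinearMap.congr_fun hs y)
  have hρP : ∀ y : P, ρ y = y := fun y => LinearMap.congr_fun hρ y
  have hφP : ∀ y : P, φ y = 0 := fun y => by
    have : φ y ∈ P.map φ := Submodule.mem_map_of_mem y.2
    rwa [hφF, Submodule.mem_bot] at this
  -- For t ≠ 0 the vector `Z w` equals t⁻¹ (F + t Z) w, so it lies in the range of F + t Z. `G t`
  -- joins it to the images of lifts of a basis of `P`. It is injective at t = 0 because `φ`
  -- separates `Z w` from `P`. Injectivity for some t ≠ 0 would force rank at least rank F + 1.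
  let π : V' →ₗ[K] P × K := ρ.prod φ
  let G (t : K) : P × K →ₗ[K] V' :=
    ((F + t • Z) ∘ₗ s).coprod (LinearMap.toSpanSingleton K V' (Z w))
  let N : P × K →ₗ[K] P × K := π ∘ₗ (Z ∘ₗ s) ∘ₗ LinearMap.fst K P K
  let G0 : P × K →ₗ[K] P × K := π ∘ₗ G 0
  have hG0 : Function.Injective G0 := by
    rw [← LinearMap.ker_eq_bot, LinearMap.ker_eq_bot']
    rintro ⟨y, c⟩ hy
    have h1 : F (s y) + c • Z w = y + c • Z w := by rw [hFs]
    have h2 : π (F (s y) + c • Z w) = 0 := by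
      simpa [G0, G] using hy
    rw [h1] at h2
    have h3 : c * φ (Z w) = 0 := by
      have := congrArg Prod.snd h2
      simpa [π, hφP] using this
    have hc : c = 0 := by simpa [hφ] using h3
    subst hc
    have := congrArg Prod.fst h2
    simp [π, hρP] at this
    simp [this]
  let e := LinearEquiv.ofInjectiveEndo G0 hG0
  -- `G0 + t N` is singular only if -t⁻¹ is an eigenvalue of G0⁻¹ N. There are finitely many
  -- eigenvalues and K is infinite, so a good t ≠ 0 exists.
  let M : Module.End K (P × K) := e.symm.toLinearMap ∘ₗ N
  have hfin := (M.finite_hasEigenvalue.image fun μ => -μ⁻¹).union (Set.finite_singleton (0 : K))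
  obtain ⟨t, ht⟩ := hfin.exists_notMem
  have ht0 : t ≠ 0 := fun h0 => ht (Or.inr h0)
  have htM : ¬ M.HasEigenvalue (-t⁻¹) := fun h1 => ht (Or.inl ⟨-t⁻¹, h1, by simp⟩)
  have hGt : Function.Injective (G t) := by
    rw [← LinearMap.ker_eq_bot, LinearMap.ker_eq_bot']
    intro z hz
    by_contra hz0
    refine htM (Module.End.hasEigenvalue_of_hasEigenvector
      (x := z) ⟨Module.End.mem_eigenspace_iff.mpr ?_, hz0⟩)
    have h1 : G0 z + t • N z = 0 := by
      have : π (G t z) = G0 z + t • N z := by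
        simp only [G, G0, N, LinearMap.comp_apply, ← map_smul, ← map_add]
        congr 1
        simp [LinearMap.coprod_apply]
        abel
      rw [← this, hz, map_zero]
    have h2 : N z = - t⁻¹ • G0 z := by
      have h3 : t • N z = - G0 z := by rw [eq_neg_iff_add_eq_zero, add_comm]; exact h1
      rw [← inv_smul_smul₀ ht0 (N z), h3]; simp
    change e.symm (N z) = _
    rw [h2, map_smul]
    congr 1
    rw [LinearEquiv.symm_apply_eq]; rfl
  have hle : LinearMap.range (G t) ≤ LinearMap.range (F + t • Z) := by
    rintro _ ⟨⟨y, c⟩, rfl⟩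
    refine ⟨s y + (c * t⁻¹) • w, ?_⟩
    simp [G, hw, smul_smul, mul_left_comm t, ht0, add_assoc]
  have h1 := LinearMap.finrank_range_of_inj hGt
  have h2 := Submodule.finrank_mono hle
  have h3 := h t
  rw [Module.finrank_prod, Module.finrank_self] at h1
  omega

/-- The commutator map `x ↦ a x - x a`. -/
def adL {E : Type*} [Ring E] [Algebra K E] (a : E) : E →ₗ[K] E :=
  LinearMap.mulLeft K a - LinearMap.mulRight K a

@[simp] theorem adL_apply {E : Type*} [Ring E] [Algebra K E] (a x : E) :
    adL (K := K) a x = a * x - x * a := rfl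

/-- The orbit of a non-scalar endomorphism has dimension at least `2 (m - 1)`. -/
theorem two_mul_finrank_le_finrank_range_adL {W : Type*} [AddCommGroup W] [Module K W]
    [FiniteDimensional K W] (a : Module.End K W) (ha : ∀ c : K, a ≠ algebraMap K _ c) :
    2 * Module.finrank K W ≤ Module.finrank K (LinearMap.range (adL (K := K) a)) + 2 := by
  obtain ⟨v, hv⟩ : ∃ v, LinearIndependent K ![v, a v] := by
    by_contra hcon
    push Not at hcon
    obtain ⟨c, hc⟩ := (LinearMap.exists_eq_smul_id_of_forall_notLinearIndependent (f := a) hcon)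
    exact ha c (by rw [hc]; rfl)
  have hv0 : v ≠ 0 := by simpa using hv.ne_zero 0
  have hav : a v ∉ Submodule.span K {v} := by
    rw [Submodule.mem_span_singleton]
    rintro ⟨c, hc⟩
    exact ((LinearIndependent.pair_iff' hv0).mp hv) c hc
  obtain ⟨ξ', hξ1, hξ2⟩ := Submodule.exists_dual_map_eq_bot_of_notMem hav inferInstance
  obtain ⟨ξ, hξv, hξav⟩ : ∃ ξ : Module.Dual K W, ξ v = 0 ∧ ξ (a v) = 1 := by
    refine ⟨(ξ' (a v))⁻¹ • ξ', ?_, by simp [hξ1]⟩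
    have : ξ' v ∈ (Submodule.span K {v}).map ξ' :=
      Submodule.mem_map_of_mem (Submodule.mem_span_singleton_self v)
    rw [hξ2, Submodule.mem_bot] at this
    simp [this]
  -- A 2m-dimensional family of pairs (w, η), giving the endomorphisms ξ ⊗ w + η ⊗ v. If one
  -- commutes with a and η vanishes at v and a v, evaluating at v gives w = 0, then applying ξ gives
  -- η = 0. So ad a composed with the family has kernel of dimension at most 2.
  let X : W × Module.Dual K W →ₗ[K] Module.End K W :=
    (LinearMap.smulRightₗ ξ).coprod
      ((LinearMap.smulRightₗ (R := K) (M := W) (M₂ := W)).flip v)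
  have hX : ∀ w η u, X (w, η) u = ξ u • w + η u • v := fun w η u => by simp [X]
  let ev : W × Module.Dual K W →ₗ[K] K × K :=
    ((LinearMap.applyₗ v).prod (LinearMap.applyₗ (a v))) ∘ₗ LinearMap.snd K W (Module.Dual K W)
  have hker : LinearMap.ker (adL (K := K) a ∘ₗ X) ⊓ LinearMap.ker ev = ⊥ := by
    rw [eq_bot_iff]
    rintro ⟨w, η⟩ ⟨h1, h2⟩
    change adL (K := K) a (X (w, η)) = 0 at h1
    change ev (w, η) = 0 at h2
    have h3 : η v = 0 ∧ η (a v) = 0 := by simpa [ev] using h2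
    have h4 : ∀ u, a (X (w, η) u) = X (w, η) (a u) := fun u => by
      have := LinearMap.congr_fun h1 u
      simpa [sub_eq_zero] using this
    have hw : w = 0 := by
      have := h4 v
      simpa [hX, hξv, hξav, h3] using this.symm
    subst hw
    have hη : η = 0 := by
      ext u
      have := congrArg ξ (h4 u)
      simpa [hX, hξv, hξav] using this
    simp [hη]
  have h1 := LinearMap.finrank_range_add_finrank_ker (adL (K := K) a ∘ₗ X)
  have h2 : Module.finrank K (LinearMap.ker (adL (K := K) a ∘ₗ X)) ≤ 2 := by
    have hinj : Function.Injective (ev.domRestrict (LinearMap.ker (adL (K := K) a ∘ₗ X))) := by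
      refine (injective_iff_map_eq_zero _).mpr fun z hz => ?_
      have : (z : W × Module.Dual K W) ∈ LinearMap.ker (adL (K := K) a ∘ₗ X) ⊓ LinearMap.ker ev :=
        ⟨z.2, hz⟩
      rw [hker, Submodule.mem_bot] at this
      exact Subtype.ext this
    simpa using LinearMap.finrank_le_finrank_of_injective hinj
  have h3 : Module.finrank K (LinearMap.range (adL (K := K) a ∘ₗ X))
      ≤ Module.finrank K (LinearMap.range (adL (K := K) a)) :=
    Submodule.finrank_mono (LinearMap.range_comp_le_range _ _)
  rw [Module.finrank_prod, Subspace.dual_finrank_eq] at h1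
  omega

end LinearAlgebra

end QuiverMoment

noncomputable section

namespace QuiverMoment

/-! ### Abelianization of the centralizer of an endomorphism. -/

section Centralizer

open Polynomial

variable {K : Type*} [Field K]

/-- The span of the commutators of elements of `C`. -/
def commSpan {E : Type*} [Ring E] [Algebra K E] (C : Submodule K E) : Submodule K E :=
  Submodule.span K {z | ∃ w ∈ C, ∃ w' ∈ C, z = w * w' - w' * w}

theorem map_commSpan_top {E E' : Type*} [Ring E] [Algebra K E] [Ring E'] [Algebra K E']
    (f : E →ₗ[K] E') (hf : ∀ x y, f (x * y) = f x * f y) :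
    (commSpan (⊤ : Submodule K E)).map f ≤ commSpan (LinearMap.range f) := by
  rw [commSpan, Submodule.map_span_le]
  rintro _ ⟨w, -, w', -, rfl⟩
  refine Submodule.subset_span ⟨f w, ⟨w, rfl⟩, f w', ⟨w', rfl⟩, ?_⟩
  rw [map_sub, hf, hf]

variable {J : Type*} (S : J → Type*) [∀ i, CommRing (S i)] [∀ i, Algebra K (S i)]
  [∀ i, Algebra K[X] (S i)] [∀ i, IsScalarTower K K[X] (S i)]

/-- Multiplication operators on a product of algebras. -/
def cyclicMul : (∀ i, S i) →ₗ[K] Module.End K[X] (∀ i, S i) :=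
  (Algebra.lmul K[X] (∀ i, S i)).toLinearMap.restrictScalars K

theorem cyclicMul_apply (m x : ∀ i, S i) : cyclicMul (K := K) S m x = m * x := rfl

theorem cyclicMul_injective : Function.Injective (cyclicMul (K := K) S) := fun m m' h => by
  simpa [cyclicMul_apply] using LinearMap.congr_fun h 1

theorem cyclicMul_mul (m m' : ∀ i, S i) :
    cyclicMul (K := K) S (m * m') = cyclicMul S m * cyclicMul S m' := by
  refine LinearMap.ext fun x => ?_
  rw [Module.End.mul_apply]
  simp only [cyclicMul_apply, mul_assoc]

variable [DecidableEq J]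

variable (K) in
/-- The projection to a factor. -/
abbrev cyclicProj (i : J) : Module.End K[X] (∀ i, S i) :=
  cyclicMul (K := K) S (Pi.single i 1)

theorem cyclicProj_apply (i : J) (x : ∀ i, S i) :
    cyclicProj K S i x = Pi.single i (x i) := by
  rw [cyclicMul_apply]
  ext j
  by_cases h : j = i
  · subst h; simp
  · simp [h]

theorem sum_cyclicProj [Fintype J] : ∑ i, cyclicProj K S i = 1 := by
  refine LinearMap.ext fun x => ?_
  rw [LinearMap.sum_apply]
  simp only [cyclicProj_apply]
  exact Finset.univ_sum_single x

variable {S}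

/-- An endomorphism of a cyclic module over a commutative ring is multiplication by the image of 1.
-/
theorem cyclicProj_mul_mul_cyclicProj_self (hS : ∀ i, Function.Surjective (algebraMap K[X] (S i)))
    (i : J) (φ : Module.End K[X] (∀ i, S i)) :
    cyclicProj K S i * φ * cyclicProj K S i ∈ LinearMap.range (cyclicMul (K := K) S) := by
  refine ⟨Pi.single i (φ (Pi.single i 1) i), LinearMap.ext fun x => ?_⟩
  obtain ⟨p, hp⟩ := hS i (x i)
  have hp' : x i = p • (1 : S i) := by rw [Algebra.smul_def, mul_one, hp]
  rw [Module.End.mul_apply, Module.End.mul_apply, cyclicProj_apply, cyclicProj_apply,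
    cyclicMul_apply, hp', Pi.single_smul, map_smul]
  ext j
  by_cases h : j = i
  · subst h; simp [hp']
  · simp [h]

/-- With idempotents e_i, e_j and e_j e_i = 0, the off-diagonal component e_i φ e_j equals its own
commutator with e_i. Hence modulo commutators only multiplication operators survive. -/
theorem cyclicProj_mul_mul_cyclicProj_mem (i j : J) (hij : i ≠ j)
    (φ : Module.End K[X] (∀ i, S i)) :
    cyclicProj K S i * φ * cyclicProj K S j
      ∈ commSpan (K := K) (⊤ : Submodule K (Module.End K[X] (∀ i, S i))) := by
  refine Submodule.subset_span ⟨cyclicProj K S i, trivial, cyclicProj K S i * φ * cyclicProj K S j,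
    trivial, ?_⟩
  have h1 : cyclicProj K S i * cyclicProj K S i = cyclicProj K S i := by
    rw [← cyclicMul_mul, ← Pi.single_mul, mul_one]
  have h2 : cyclicProj K S j * cyclicProj K S i = 0 := by
    rw [← cyclicMul_mul, show (Pi.single j 1 * Pi.single i 1 : ∀ i, S i) = 0 from ?_, map_zero]
    ext k
    by_cases h : k = i
    · subst h; simp [hij]
    · simp [h]
  rw [mul_assoc _ _ (cyclicProj K S i), h2, mul_zero, sub_zero, ← mul_assoc, ← mul_assoc, h1]

theorem sum_cyclicProj_mul_mul [Fintype J] (φ : Module.End K[X] (∀ i, S i)) :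
    φ = ∑ i, ∑ j, cyclicProj K S i * φ * cyclicProj K S j := by
  simp only [← Finset.mul_sum, sum_cyclicProj, mul_one, ← Finset.sum_mul, one_mul]

theorem commSpan_sup_range_cyclicMul [Fintype J]
    (hS : ∀ i, Function.Surjective (algebraMap K[X] (S i))) :
    commSpan (K := K) (⊤ : Submodule K (Module.End K[X] (∀ i, S i)))
      ⊔ LinearMap.range (cyclicMul (K := K) S) = ⊤ := by
  refine eq_top_iff.mpr fun φ _ => ?_
  rw [sum_cyclicProj_mul_mul φ]
  refine Submodule.sum_mem _ fun i _ => Submodule.sum_mem _ fun j _ => ?_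
  by_cases h : i = j
  · subst h
    exact Submodule.mem_sup_right (cyclicProj_mul_mul_cyclicProj_self hS i φ)
  · exact Submodule.mem_sup_left (cyclicProj_mul_mul_cyclicProj_mem i j h φ)

/-- Multiplication by r descends from K[X]/(q_j) to K[X]/(q_i) exactly because q_j r is divisible by
q_i. -/
theorem exists_end_of_dvd {q : J → K[X]} (hS : ∀ i, Function.Surjective (algebraMap K[X] (S i)))
    (hker : ∀ i p, algebraMap K[X] (S i) p = 0 ↔ q i ∣ p) (i j : J) (r : K[X])
    (hr : q i ∣ q j * r) : ∃ φ : Module.End K[X] (∀ i, S i), ∀ x p, x j = algebraMap K[X] (S j) p →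
      φ x = Pi.single i (algebraMap K[X] (S i) (p * r)) := by
  obtain ⟨f, hf⟩ : ∃ f : S j →ₗ[K[X]] S i, ∀ p, f (algebraMap _ _ p) = algebraMap _ _ (p * r) := by
    let g : K[X] →ₗ[K[X]] S j := Algebra.linearMap K[X] (S j)
    have hg : Function.Surjective g := hS j
    let e := g.quotKerEquivOfSurjective hg
    let f0 : K[X] →ₗ[K[X]] S i := LinearMap.toSpanSingleton K[X] (S i) (algebraMap _ _ r)
    have hle : LinearMap.ker g ≤ LinearMap.ker f0 := by
      intro p hp
      have h1 : q j ∣ p := (hker j p).mp hp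
      change p • algebraMap K[X] (S i) r = 0
      rw [Algebra.smul_def, ← map_mul, hker]
      exact hr.trans (mul_dvd_mul_right h1 r)
    refine ⟨(LinearMap.ker g).liftQ f0 hle ∘ₗ e.symm.toLinearMap, fun p => ?_⟩
    have : e.symm (algebraMap K[X] (S j) p) = (LinearMap.ker g).mkQ p := by
      rw [LinearEquiv.symm_apply_eq]; rfl
    rw [LinearMap.comp_apply, LinearEquiv.coe_coe, this, Submodule.mkQ_apply, Submodule.liftQ_apply]
    change p • algebraMap K[X] (S i) r = _
    rw [Algebra.smul_def, ← map_mul]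
  refine ⟨LinearMap.single K[X] S i ∘ₗ f ∘ₗ LinearMap.proj j, fun x p hx => ?_⟩
  rw [LinearMap.comp_apply, LinearMap.comp_apply, LinearMap.proj_apply, hx, hf]
  rfl

/-- Write q_i = d r and q_j = d s with d the gcd. Multiplication by r from factor j to i and by s
back have as commutator the multiplication by r s on factor i minus that on factor j. If it
vanished, d would divide both r and s, so d² would divide d, contradicting that d is not a unit. -/
theorem exists_commSpan_inf_range_ne_zero {q : J → K[X]}
    (hS : ∀ i, Function.Surjective (algebraMap K[X] (S i)))
    (hker : ∀ i p, algebraMap K[X] (S i) p = 0 ↔ q i ∣ p)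
    (hq : ∀ i, q i ≠ 0) (i j : J) (hij : i ≠ j) (h : ¬ IsCoprime (q i) (q j)) :
    ∃ z ∈ commSpan (K := K) (⊤ : Submodule K (Module.End K[X] (∀ i, S i))),
      z ∈ LinearMap.range (cyclicMul (K := K) S) ∧ z ≠ 0 := by
  classical
  set d := EuclideanDomain.gcd (q i) (q j) with hd
  have hdu : ¬ IsUnit d := fun hu => h (EuclideanDomain.gcd_isUnit_iff.mp hu)
  obtain ⟨r, hr⟩ : d ∣ q i := EuclideanDomain.gcd_dvd_left _ _
  obtain ⟨s, hs⟩ : d ∣ q j := EuclideanDomain.gcd_dvd_right _ _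
  have hd0 : d ≠ 0 := fun h0 => hq i (by rw [hr, h0, zero_mul])
  obtain ⟨α, hα⟩ := exists_end_of_dvd hS hker i j r ⟨s, by rw [hr, hs]; ring⟩
  obtain ⟨β, hβ⟩ := exists_end_of_dvd hS hker j i s ⟨r, by rw [hr, hs]; ring⟩
  have key : α * β - β * α = cyclicMul S (Pi.single i (algebraMap _ _ (r * s))
      - Pi.single j (algebraMap _ _ (r * s))) := by
    refine LinearMap.ext fun x => ?_
    obtain ⟨p, hp⟩ := hS i (x i)
    obtain ⟨p', hp'⟩ := hS j (x j)
    rw [LinearMap.sub_apply, Module.End.mul_apply, Module.End.mul_apply,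
      hβ x p hp.symm, hα x p' hp'.symm, hα _ (p * s) (by simp), hβ _ (p' * r) (by simp),
      cyclicMul_apply, sub_mul]
    congr 1
    · ext k
      by_cases hk : k = i
      · subst hk; simp [← hp]; ring
      · simp [hk]
    · ext k
      by_cases hk : k = j
      · subst hk; simp [← hp']; ring
      · simp [hk]
  refine ⟨α * β - β * α, Submodule.subset_span ⟨α, trivial, β, trivial, rfl⟩, ⟨_, key.symm⟩, ?_⟩
  rw [key]
  intro h0
  have h3 := cyclicMul_injective S (h0.trans (map_zero _).symm)
  have h4 : q i ∣ r * s := by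
    have := congrFun h3 i
    simp only [Pi.sub_apply, Pi.single_eq_same, Pi.single_eq_of_ne hij, sub_zero,
      Pi.zero_apply] at this
    exact (hker _ _).mp this
  have h5 : q j ∣ r * s := by
    have := congrFun h3 j
    simp only [Pi.sub_apply, Pi.single_eq_same, Pi.single_eq_of_ne hij.symm, zero_sub,
      Pi.zero_apply, neg_eq_zero] at this
    exact (hker _ _).mp this
  have hr0 : r ≠ 0 := fun h0 => hq i (by rw [hr, h0, mul_zero])
  have hs0 : s ≠ 0 := fun h0 => hq j (by rw [hs, h0, mul_zero])
  have h6 : d ∣ s := by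
    rw [hr, mul_comm d r] at h4
    exact (mul_dvd_mul_iff_left hr0).mp h4
  have h7 : d ∣ r := by
    rw [hs, mul_comm d s, mul_comm r s] at h5
    exact (mul_dvd_mul_iff_left hs0).mp h5
  have h8 : d * d ∣ d := EuclideanDomain.dvd_gcd
    (by conv_rhs => rw [hr]
        exact mul_dvd_mul_left d h7)
    (by conv_rhs => rw [hs]
        exact mul_dvd_mul_left d h6)
  obtain ⟨e, he⟩ := h8
  refine hdu (IsUnit.of_mul_eq_one e ?_)
  have : d * (d * e) = d * 1 := by rw [mul_one, ← mul_assoc, ← he]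
  exact mul_left_cancel₀ hd0 this

theorem cyclicProj_mul_mul_eq_zero_of_isCoprime {q : J → K[X]}
    (hker : ∀ i p, algebraMap K[X] (S i) p = 0 ↔ q i ∣ p)
    (i j : J) (h : IsCoprime (q i) (q j))
    (φ : Module.End K[X] (∀ i, S i)) : cyclicProj K S i * φ * cyclicProj K S j = 0 := by
  refine LinearMap.ext fun x => ?_
  obtain ⟨u, v, huv⟩ := h
  rw [Module.End.mul_apply, Module.End.mul_apply, cyclicProj_apply, cyclicProj_apply]
  have h0 : ∀ k (z : S k), q k • z = 0 := fun k z => by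
    rw [Algebra.smul_def, (hker k (q k)).mpr dvd_rfl, zero_mul]
  set y := φ (Pi.single j (x j)) with hy
  have h1 : q j • y = 0 := by
    rw [hy, ← map_smul, ← Pi.single_smul, h0, Pi.single_zero, map_zero]
  have h3 : y i = 0 := by
    have h4 : q j • y i = 0 := congrFun h1 i
    rw [← one_smul K[X] (y i), ← huv, add_smul, mul_smul, mul_smul, h0, h4, smul_zero, smul_zero,
      add_zero]
  rw [h3, Pi.single_zero]; rfl

theorem finrank_end_cyclic_le [Fintype J] [FiniteDimensional K (∀ i, S i)]
    [FiniteDimensional K (Module.End K[X] (∀ i, S i))]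
    (hS : ∀ i, Function.Surjective (algebraMap K[X] (S i))) :
    Module.finrank K (Module.End K[X] (∀ i, S i)) ≤
      Module.finrank K (commSpan (K := K) (⊤ : Submodule K (Module.End K[X] (∀ i, S i))))
        + Module.finrank K (∀ i, S i) := by
  have h1 := Submodule.finrank_add_le_finrank_add_finrank
    (commSpan (K := K) (⊤ : Submodule K (Module.End K[X] (∀ i, S i))))
    (LinearMap.range (cyclicMul (K := K) S))
  rw [commSpan_sup_range_cyclicMul hS, finrank_top,
    LinearMap.finrank_range_of_inj (cyclicMul_injective S)] at h1
  exact h1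

/-- If the q_i were pairwise coprime there would be no maps between different factors, so all
endomorphisms would be multiplications and the dimensions would agree. Otherwise commutators and
multiplications have a nonzero intersection, which makes the inequality strict. -/
theorem finrank_end_cyclic_lt [Fintype J] [FiniteDimensional K (∀ i, S i)]
    [FiniteDimensional K (Module.End K[X] (∀ i, S i))] {q : J → K[X]}
    (hS : ∀ i, Function.Surjective (algebraMap K[X] (S i)))
    (hker : ∀ i p, algebraMap K[X] (S i) p = 0 ↔ q i ∣ p) (hq : ∀ i, q i ≠ 0)
    (hlt : Module.finrank K (∀ i, S i) < Module.finrank K (Module.End K[X] (∀ i, S i))) :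
    Module.finrank K (Module.End K[X] (∀ i, S i)) <
      Module.finrank K (commSpan (K := K) (⊤ : Submodule K (Module.End K[X] (∀ i, S i))))
        + Module.finrank K (∀ i, S i) := by
  have h1 := Submodule.finrank_sup_add_finrank_inf_eq
    (commSpan (K := K) (⊤ : Submodule K (Module.End K[X] (∀ i, S i))))
    (LinearMap.range (cyclicMul (K := K) S))
  rw [commSpan_sup_range_cyclicMul hS, finrank_top,
    LinearMap.finrank_range_of_inj (cyclicMul_injective S)] at h1
  have hex : ∃ i j, i ≠ j ∧ ¬ IsCoprime (q i) (q j) := by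
    by_contra hcon
    push Not at hcon
    have htop : LinearMap.range (cyclicMul (K := K) S) = ⊤ := by
      refine eq_top_iff.mpr fun φ _ => ?_
      rw [sum_cyclicProj_mul_mul φ]
      refine Submodule.sum_mem _ fun i _ => Submodule.sum_mem _ fun j _ => ?_
      by_cases h : i = j
      · subst h; exact cyclicProj_mul_mul_cyclicProj_self hS i φ
      · rw [cyclicProj_mul_mul_eq_zero_of_isCoprime hker i j (hcon i j h)]
        exact Submodule.zero_mem _
    have := LinearMap.finrank_range_of_inj (cyclicMul_injective (K := K) S)
    rw [htop, finrank_top] at this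
    omega
  obtain ⟨i, j, hij, hc⟩ := hex
  obtain ⟨z, hz1, hz2, hz0⟩ := exists_commSpan_inf_range_ne_zero hS hker hq i j hij hc
  have h2 : 0 < Module.finrank K ↥(commSpan (K := K)
      (⊤ : Submodule K (Module.End K[X] (∀ i, S i))) ⊓ LinearMap.range (cyclicMul (K := K) S)) := by
    refine Nat.pos_of_ne_zero fun h => hz0 ?_
    rw [Submodule.finrank_eq_zero] at h
    have : z ∈ commSpan (K := K) (⊤ : Submodule K (Module.End K[X] (∀ i, S i))) ⊓
      LinearMap.range (cyclicMul (K := K) S) := ⟨hz1, hz2⟩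
    rwa [h, Submodule.mem_bot] at this
  omega

/-- The centralizer of a is the algebra of K[X]-endomorphisms of W, with X acting as a. A
decomposition into cyclic modules carries the bounds over. -/
theorem finrank_centralizer_le_of_equiv {W : Type*} [AddCommGroup W] [Module K W]
    [FiniteDimensional K W] (a : Module.End K W) [Fintype J] {q : J → K[X]}
    (hS : ∀ i, Function.Surjective (algebraMap K[X] (S i)))
    (hker : ∀ i p, algebraMap K[X] (S i) p = 0 ↔ q i ∣ p) (hq : ∀ i, q i ≠ 0)
    (E1 : Module.AEval' a ≃ₗ[K[X]] ∀ i, S i) :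
    Module.finrank K (LinearMap.ker (adL (K := K) a)) ≤
      Module.finrank K (commSpan (LinearMap.ker (adL (K := K) a))) + Module.finrank K W ∧
    (Module.finrank K W < Module.finrank K (LinearMap.ker (adL (K := K) a)) →
      Module.finrank K (LinearMap.ker (adL (K := K) a)) <
      Module.finrank K (commSpan (LinearMap.ker (adL (K := K) a))) + Module.finrank K W) := by
  let E2 : W ≃ₗ[K] ∀ i, S i := (Module.AEval'.of a).trans (E1.restrictScalars K)
  have hE2 : ∀ w, E2 (a w) = (X : K[X]) • E2 w := fun w => by
    change E1 (Module.AEval'.of a (a w)) = X • E1 (Module.AEval'.of a w)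
    rw [← map_smul, Module.AEval'.X_smul_of]
  have hE2' : ∀ y, a (E2.symm y) = E2.symm ((X : K[X]) • y) := fun y => by
    rw [LinearEquiv.eq_symm_apply, hE2, LinearEquiv.apply_symm_apply]
  have hfin : FiniteDimensional K (∀ i, S i) := LinearEquiv.finiteDimensional E2
  let Θ : Module.End K[X] (∀ i, S i) →ₗ[K] Module.End K W :=
    { toFun := fun φ => E2.symm.toLinearMap ∘ₗ φ.restrictScalars K ∘ₗ E2.toLinearMap
      map_add' := fun φ ψ => by ext; simp
      map_smul' := fun c φ => by ext; simp }
  have hΘ : ∀ φ w, Θ φ w = E2.symm (φ (E2 w)) := fun _ _ => rfl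
  have hΘmul : ∀ φ ψ, Θ (φ * ψ) = Θ φ * Θ ψ := fun φ ψ => by
    ext w; simp [hΘ]
  have hΘinj : Function.Injective Θ := fun φ ψ h => by
    refine LinearMap.ext fun y => ?_
    have := LinearMap.congr_fun h (E2.symm y)
    simpa [hΘ] using this
  have hrange : LinearMap.range Θ = LinearMap.ker (adL (K := K) a) := by
    refine le_antisymm ?_ fun w hw => ?_
    · rintro _ ⟨φ, rfl⟩
      rw [LinearMap.mem_ker]
      ext w
      simp [hΘ, hE2, hE2']
    · rw [LinearMap.mem_ker] at hw
      have hw' : ∀ v, a (w v) = w (a v) := fun v => by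
        simpa [sub_eq_zero] using LinearMap.congr_fun hw v
      let φ0 : Module.AEval' a →ₗ[K[X]] ∀ i, S i :=
        LinearMap.ofAEval a (E2.toLinearMap ∘ₗ w) fun v => by
          change E2 (w (a v)) = X • E2 (w v)
          rw [← hE2, hw']
      refine ⟨φ0 ∘ₗ E1.symm.toLinearMap, ?_⟩
      ext v
      rw [hΘ, LinearEquiv.symm_apply_eq]
      change φ0 (E1.symm (E1 (Module.AEval'.of a v))) = _
      rw [LinearEquiv.symm_apply_apply]
      rfl
  have hfin2 : FiniteDimensional K (Module.End K[X] (∀ i, S i)) :=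
    FiniteDimensional.of_injective Θ hΘinj
  have h1 := finrank_end_cyclic_le (K := K) hS
  have h2 := finrank_end_cyclic_lt (K := K) hS hker hq
  have h3 : Module.finrank K (Module.End K[X] (∀ i, S i))
      = Module.finrank K (LinearMap.ker (adL (K := K) a)) := by
    rw [← hrange, LinearMap.finrank_range_of_inj hΘinj]
  have h4 : Module.finrank K (∀ i, S i) = Module.finrank K W := E2.finrank_eq.symm
  have h5 : Module.finrank K (commSpan (K := K) (⊤ : Submodule K (Module.End K[X] (∀ i, S i)))) ≤
      Module.finrank K (commSpan (LinearMap.ker (adL (K := K) a))) := by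
    rw [← hrange]
    exact (Submodule.equivMapOfInjective Θ hΘinj (commSpan ⊤)).finrank_eq.trans_le
      (Submodule.finrank_mono (map_commSpan_top Θ hΘmul))
  rw [h3, h4] at h1 h2
  exact ⟨by omega, fun h => by have := h2 h; omega⟩

/-- The abelianization of the centralizer of `a` has dimension at most `m`, and at most `m - 1` if
the centralizer has dimension greater than `m`. -/
theorem finrank_centralizer_le {W : Type*} [AddCommGroup W] [Module K W]
    [FiniteDimensional K W] (a : Module.End K W) :
    Module.finrank K (LinearMap.ker (adL (K := K) a)) ≤
      Module.finrank K (commSpan (LinearMap.ker (adL (K := K) a))) + Module.finrank K W ∧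
    (Module.finrank K W < Module.finrank K (LinearMap.ker (adL (K := K) a)) →
      Module.finrank K (LinearMap.ker (adL (K := K) a)) <
      Module.finrank K (commSpan (LinearMap.ker (adL (K := K) a))) + Module.finrank K W) := by
  classical
  -- Structure theorem for finitely generated torsion modules over the principal ideal domain K[X].
  obtain ⟨J, hJ, p, hp, e, ⟨E⟩⟩ :=
    Module.equiv_directSum_of_isTorsion (Module.AEval.isTorsion_of_finiteDimensional K W a)
  exact finrank_centralizer_le_of_equiv a (q := fun i => p i ^ e i)
    (S := fun i => K[X] ⧸ Ideal.span {p i ^ e i}) (fun i => Ideal.Quotient.mk_surjective)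
    (fun i p => Ideal.Quotient.eq_zero_iff_dvd _ _) (fun i => pow_ne_zero _ (hp i).ne_zero)
    (E.trans (DirectSum.linearEquivFunOnFintype K[X] J _))

end Centralizer

end QuiverMoment

end

noncomputable section

namespace QuiverMoment

/-! ### Dimension counts in linear algebra. -/

section Dimension

variable {K : Type*} [Field K]

theorem finrank_map_add_finrank_inf_ker {V V' : Type*} [AddCommGroup V] [AddCommGroup V']
    [Module K V] [Module K V'] [FiniteDimensional K V] (f : V →ₗ[K] V') (L : Submodule K V) :
    Module.finrank K (L.map f) + Module.finrank K ↥(L ⊓ LinearMap.ker f)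
      = Module.finrank K L := by
  have h1 := LinearMap.finrank_range_add_finrank_ker (f.domRestrict L)
  have h2 : LinearMap.range (f.domRestrict L) = L.map f := by
    rw [LinearMap.range_domRestrict]
  have h3 : Module.finrank K (LinearMap.ker (f.domRestrict L))
      = Module.finrank K ↥(L ⊓ LinearMap.ker f) := by
    refine (Submodule.equivMapOfInjective L.subtype L.injective_subtype _).finrank_eq.trans ?_
    exact congrArg (fun N : Submodule K V => Module.finrank K N)
      (Submodule.map_comap_subtype L (LinearMap.ker f))
  rw [h2, h3] at h1
  exact h1

/-- Compute dim L by both projections: the first bounds it below by base `T` and fibre `S`, the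
second above by base `B'` and fibre `C'`. -/
theorem finrank_add_finrank_le_of_fibration {V B : Type*} [AddCommGroup V] [AddCommGroup B]
    [Module K V] [Module K B] [FiniteDimensional K V] [FiniteDimensional K B]
    (L : Submodule K (V × B)) (T C' : Submodule K V) (S B' : Submodule K B)
    (hT : ∀ v ∈ T, ∃ b, (v, b) ∈ L) (hS : ∀ b ∈ S, ((0 : V), b) ∈ L)
    (hB : ∀ v b, (v, b) ∈ L → b ∈ B') (hC : ∀ v, (v, (0 : B)) ∈ L → v ∈ C') :
    Module.finrank K T + Module.finrank K S ≤ Module.finrank K B' + Module.finrank K C' := by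
  have h1 := finrank_map_add_finrank_inf_ker (LinearMap.fst K V B) L
  have h2 := finrank_map_add_finrank_inf_ker (LinearMap.snd K V B) L
  have h3 : T ≤ L.map (LinearMap.fst K V B) := fun v hv => by
    obtain ⟨b, hb⟩ := hT v hv
    exact ⟨_, hb, rfl⟩
  have h4 : S.map (LinearMap.inr K V B) ≤ L ⊓ LinearMap.ker (LinearMap.fst K V B) := by
    rintro _ ⟨b, hb, rfl⟩
    exact ⟨hS b hb, rfl⟩
  have h5 : L.map (LinearMap.snd K V B) ≤ B' := by
    rintro _ ⟨⟨v, b⟩, hvb, rfl⟩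
    exact hB v b hvb
  have h6 : L ⊓ LinearMap.ker (LinearMap.snd K V B) ≤ C'.map (LinearMap.inl K V B) := by
    rintro ⟨v, b⟩ ⟨hvb, hb⟩
    obtain rfl : b = 0 := hb
    exact ⟨v, hC v hvb, rfl⟩
  have h3' := Submodule.finrank_mono h3
  have h4' := Submodule.finrank_mono h4
  have h5' := Submodule.finrank_mono h5
  have h6' := Submodule.finrank_mono h6
  have h7 := (Submodule.equivMapOfInjective (LinearMap.inr K V B) LinearMap.inr_injective S).finrank_eq
  have h8 := (Submodule.equivMapOfInjective (LinearMap.inl K V B) LinearMap.inl_injective C').finrank_eq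
  omega

theorem finrank_submodule_pi {Q : Type*} [Fintype Q] {V : Q → Type*} [∀ β, AddCommGroup (V β)]
    [∀ β, Module K (V β)] [∀ β, FiniteDimensional K (V β)] (p : ∀ β, Submodule K (V β)) :
    Module.finrank K (Submodule.pi Set.univ p) = ∑ β, Module.finrank K (p β) := by
  rw [← Module.finrank_pi_fintype]
  refine LinearEquiv.finrank_eq
    { toFun := fun x β => ⟨x.1 β, x.2 β trivial⟩
      invFun := fun x => ⟨fun β => x β, fun β _ => (x β).2⟩
      map_add' := fun _ _ => rfl
      map_smul' := fun _ _ => rfl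
      left_inv := fun _ => rfl
      right_inv := fun _ => rfl }

/-- The elements of `g` orthogonal to `M`. -/
def perpIn {E : Type*} [AddCommGroup E] [Module K E] (B : E →ₗ[K] E →ₗ[K] K)
    (g M : Submodule K E) : Submodule K E where
  carrier := {b | b ∈ g ∧ ∀ w ∈ M, B b w = 0}
  add_mem' := fun ha hb => ⟨add_mem ha.1 hb.1, fun w hw => by
    rw [map_add, LinearMap.add_apply, ha.2 w hw, hb.2 w hw, add_zero]⟩
  zero_mem' := ⟨zero_mem _, fun w _ => by simp⟩
  smul_mem' := fun c b hb => ⟨Submodule.smul_mem _ c hb.1, fun w hw => by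
    rw [map_smul, LinearMap.smul_apply, hb.2 w hw, smul_zero]⟩

theorem finrank_perpIn_add_le {E : Type*} [AddCommGroup E] [Module K E] [FiniteDimensional K E]
    (B : E →ₗ[K] E →ₗ[K] K) (g M : Submodule K E) (hM : M ≤ g)
    (hB : ∀ w ∈ g, (∀ b ∈ g, B b w = 0) → w = 0) :
    Module.finrank K (perpIn B g M) + Module.finrank K M ≤ Module.finrank K g := by
  let r : g →ₗ[K] Module.Dual K M := LinearMap.lcomp K K M.subtype ∘ₗ B ∘ₗ g.subtype
  have h1 := LinearMap.finrank_range_add_finrank_ker r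
  have h2 := finrank_range_le_of_adjoint r (Submodule.inclusion hM)
    (B.compl₁₂ g.subtype g.subtype) LinearMap.id (fun _ _ => rfl)
    (fun w hw => Subtype.ext (hB w w.2 fun b hb => hw ⟨b, hb⟩))
  rw [LinearMap.finrank_range_of_inj (Submodule.inclusion_injective hM)] at h2
  have h3 : perpIn B g M ≤ (LinearMap.ker r).map g.subtype := fun b hb =>
    ⟨⟨b, hb.1⟩, LinearMap.ext fun w => hb.2 w w.2, rfl⟩
  have h4 := Submodule.finrank_mono h3
  have h5 := Submodule.finrank_map_le g.subtype (LinearMap.ker r)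
  omega

/-- A bound for the elements of `g` orthogonal to `M ⊆ C`. -/
theorem finrank_perpIn_add_add_le {E : Type*} [AddCommGroup E] [Module K E] [FiniteDimensional K E]
    (B : E →ₗ[K] E →ₗ[K] K) (g C M : Submodule K E) (hM : M ≤ C)
    (hB : ∀ w ∈ g, (∀ b ∈ g, B b w = 0) → w = 0) :
    Module.finrank K (perpIn B g M) + Module.finrank K ↥(g ⊓ C) + Module.finrank K M
      ≤ Module.finrank K g + Module.finrank K C := by
  let r : E →ₗ[K] Module.Dual K C := LinearMap.lcomp K K C.subtype ∘ₗ B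
  have h1 := finrank_map_add_finrank_inf_ker r (perpIn B g M)
  -- Restrict b to a functional on C. It kills M, so the image has dimension at most dim C - dim M.
  -- The kernel is orthogonal to g ∩ C, and nondegeneracy on g bounds it by dim g - dim(g ∩ C).
  have h2 : perpIn B g M ⊓ LinearMap.ker r ≤ perpIn B g (g ⊓ C) := fun b hb =>
    ⟨hb.1.1, fun w hw => LinearMap.congr_fun hb.2 ⟨w, hw.2⟩⟩
  have h3 := finrank_perpIn_add_le B g (g ⊓ C) inf_le_left hB
  have h4 : (perpIn B g M).map r ≤ (M.comap C.subtype).dualAnnihilator := by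
    rintro _ ⟨b, hb, rfl⟩
    rw [Submodule.mem_dualAnnihilator]
    exact fun w hw => hb.2 w hw
  have h5 := Subspace.finrank_add_finrank_dualAnnihilator_eq (M.comap C.subtype)
  have h6 : Module.finrank K (M.comap C.subtype) = Module.finrank K M := by
    refine (Submodule.equivMapOfInjective C.subtype C.injective_subtype _).finrank_eq.trans ?_
    have : (M.comap C.subtype).map C.subtype = M := by
      rw [Submodule.map_comap_subtype, inf_eq_right.mpr hM]
    exact congrArg (fun N : Submodule K E => Module.finrank K N) this
  have h7 := Submodule.finrank_mono h2
  have h8 := Submodule.finrank_mono h4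
  omega

/-- A subspace stable under a complete family of orthogonal projections is the direct sum of its
intersections with their ranges. -/
theorem finrank_eq_sum_finrank_inf_range {E R : Type*} [AddCommGroup E] [Module K E]
    [FiniteDimensional K E] [Fintype R] [DecidableEq R] (P : R → E →ₗ[K] E)
    (hP : ∀ r x, P r (P r x) = P r x) (hP' : ∀ r r' x, r ≠ r' → P r (P r' x) = 0)
    (hsum : ∀ x, ∑ r, P r x = x) (N : Submodule K E) (hN : ∀ r, ∀ x ∈ N, P r x ∈ N) :
    Module.finrank K N = ∑ r, Module.finrank K ↥(N ⊓ LinearMap.range (P r)) := by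
  rw [← Module.finrank_pi_fintype]
  have hfix : ∀ r (y : ↥(N ⊓ LinearMap.range (P r))), P r y = y := by
    rintro r ⟨_, -, y, rfl⟩
    exact hP r y
  have hsingle : ∀ r (x : ∀ r, ↥(N ⊓ LinearMap.range (P r))), P r (∑ r', (x r' : E)) = x r := by
    intro r x
    rw [map_sum, Finset.sum_eq_single r]
    · exact hfix r _
    · intro r' _ hr'
      rw [← hfix r' (x r'), hP' r r' _ hr'.symm]
    · simp
  refine LinearEquiv.finrank_eq
    { toFun := fun x r => ⟨P r x, hN r x x.2, x, rfl⟩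
      invFun := fun x => ⟨∑ r, (x r : E), Submodule.sum_mem _ fun r _ => (x r).2.1⟩
      map_add' := fun x y => by ext r; simp
      map_smul' := fun c x => by ext r; simp
      left_inv := fun x => Subtype.ext (hsum x)
      right_inv := fun x => by
        ext r
        exact hsingle r x }

end Dimension

end QuiverMoment

end

noncomputable section

namespace QuiverMoment

theorem finrank_submodule_congr {K V : Type*} [Field K] [AddCommGroup V] [Module K V]
    {N N' : Submodule K V} (h : N = N') : Module.finrank K N = Module.finrank K N' := by rw [h]

/-! ### Matrices graded by the vertices of the quiver. -/

section Blocks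

variable {K : Type*} [Field K] {I : Type*} [Fintype I] [DecidableEq I] {ι : Type*}
  (ν : I → ι)

variable (K) in
/-- Matrices supported on the block `(i, j)`. -/
def blk (i j : ι) : Submodule K (Matrix I I K) where
  carrier := {X | ∀ p q, X p q ≠ 0 → ν p = i ∧ ν q = j}
  add_mem' := fun {X Y} hX hY p q h => by
    by_cases h1 : X p q = 0
    · refine hY p q fun h2 => h ?_
      rw [Matrix.add_apply, h1, h2, add_zero]
    · exact hX p q h1
  zero_mem' := fun p q h => absurd rfl h
  smul_mem' := fun c X hX p q h => hX p q fun h1 => h (by rw [Matrix.smul_apply, h1, smul_zero])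

variable (K) in
/-- Block diagonal matrices. -/
def blkDiag : Submodule K (Matrix I I K) where
  carrier := {X | ∀ p q, X p q ≠ 0 → ν p = ν q}
  add_mem' := fun {X Y} hX hY p q h => by
    by_cases h1 : X p q = 0
    · refine hY p q fun h2 => h ?_
      rw [Matrix.add_apply, h1, h2, add_zero]
    · exact hX p q h1
  zero_mem' := fun p q h => absurd rfl h
  smul_mem' := fun c X hX p q h => hX p q fun h1 => h (by rw [Matrix.smul_apply, h1, smul_zero])

variable {ν}

theorem mul_mem_blk {i j k : ι} {X Y : Matrix I I K} (hX : X ∈ blk K ν i j)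
    (hY : Y ∈ blk K ν j k) : X * Y ∈ blk K ν i k := by
  intro p q h
  rw [Matrix.mul_apply] at h
  obtain ⟨r, -, hr⟩ := Finset.exists_ne_zero_of_sum_ne_zero h
  exact ⟨(hX p r (left_ne_zero_of_mul hr)).1, (hY r q (right_ne_zero_of_mul hr)).2⟩

theorem mul_mem_blk_of_left {i j : ι} {a X : Matrix I I K} (ha : a ∈ blkDiag K ν)
    (hX : X ∈ blk K ν i j) : a * X ∈ blk K ν i j := by
  intro p q h
  rw [Matrix.mul_apply] at h
  obtain ⟨r, -, hr⟩ := Finset.exists_ne_zero_of_sum_ne_zero h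
  have h1 := hX r q (right_ne_zero_of_mul hr)
  exact ⟨(ha p r (left_ne_zero_of_mul hr)).trans h1.1, h1.2⟩

theorem mul_mem_blk_of_right {i j : ι} {a X : Matrix I I K} (ha : a ∈ blkDiag K ν)
    (hX : X ∈ blk K ν i j) : X * a ∈ blk K ν i j := by
  intro p q h
  rw [Matrix.mul_apply] at h
  obtain ⟨r, -, hr⟩ := Finset.exists_ne_zero_of_sum_ne_zero h
  have h1 := hX p r (left_ne_zero_of_mul hr)
  exact ⟨h1.1, (ha r q (right_ne_zero_of_mul hr)).symm.trans h1.2⟩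

theorem adL_mem_blk {i j : ι} {a X : Matrix I I K} (ha : a ∈ blkDiag K ν)
    (hX : X ∈ blk K ν i j) : adL (K := K) a X ∈ blk K ν i j :=
  sub_mem (mul_mem_blk_of_left ha hX) (mul_mem_blk_of_right ha hX)

theorem blk_self_le (i : ι) : blk K ν i i ≤ blkDiag K ν := fun _ hX p q h =>
  (hX p q h).1.trans (hX p q h).2.symm

theorem blkDiag_inf_blk_eq_bot {i j : ι} (h : i ≠ j) : blkDiag K ν ⊓ blk K ν i j = ⊥ := by
  rw [eq_bot_iff]
  rintro X ⟨h1, h2⟩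
  ext p q
  by_contra hne
  exact h ((h2 p q hne).1.symm.trans ((h1 p q hne).trans (h2 p q hne).2))

theorem one_mem_blkDiag : (1 : Matrix I I K) ∈ blkDiag K ν := fun p q h => by
  by_contra hne
  exact h (Matrix.one_apply_ne fun hpq => hne (congrArg ν hpq))

/-- The truncation of a matrix to a block. -/
def trunc [DecidableEq ι] (ν : I → ι) (r : ι × ι) : Matrix I I K →ₗ[K] Matrix I I K where
  toFun X := Matrix.of fun p q => if ν p = r.1 ∧ ν q = r.2 then X p q else 0
  map_add' X Y := by ext p q; simp only [Matrix.of_apply, Matrix.add_apply]; split_ifs <;> simp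
  map_smul' c X := by ext p q; simp

theorem trunc_apply [DecidableEq ι] (r : ι × ι) (X : Matrix I I K) (p q : I) :
    trunc ν r X p q = if ν p = r.1 ∧ ν q = r.2 then X p q else 0 := rfl

theorem trunc_mem_blk [DecidableEq ι] (r : ι × ι) (X : Matrix I I K) :
    trunc ν r X ∈ blk K ν r.1 r.2 := fun p q h => by
  by_contra hne
  rw [trunc_apply, if_neg hne] at h
  exact h rfl

theorem trunc_of_mem [DecidableEq ι] {r : ι × ι} {X : Matrix I I K} (hX : X ∈ blk K ν r.1 r.2) :
    trunc ν r X = X := by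
  ext p q
  rw [trunc_apply]
  split_ifs with h
  · rfl
  · by_contra hne
    exact h (hX p q (Ne.symm hne))

theorem range_trunc [DecidableEq ι] (r : ι × ι) :
    LinearMap.range (trunc (K := K) ν r) = blk K ν r.1 r.2 := by
  refine le_antisymm ?_ fun X hX => ⟨X, trunc_of_mem hX⟩
  rintro _ ⟨X, rfl⟩
  exact trunc_mem_blk r X

theorem finrank_eq_sum_finrank_inf_blk [Fintype ι] [DecidableEq ι]
    (N : Submodule K (Matrix I I K)) (hN : ∀ r, ∀ X ∈ N, trunc ν r X ∈ N) :
    Module.finrank K N = ∑ i, ∑ j, Module.finrank K ↥(N ⊓ blk K ν i j) := by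
  refine (finrank_eq_sum_finrank_inf_range (trunc (K := K) ν)
    (fun r X => trunc_of_mem (trunc_mem_blk r X))
    (fun r r' X h => ?_) (fun X => ?_) N hN).trans ?_
  rotate_left 2
  · rw [Fintype.sum_prod_type]
    exact Finset.sum_congr rfl fun i _ => Finset.sum_congr rfl fun j _ =>
      finrank_submodule_congr (by rw [range_trunc])
  · ext p q
    rw [trunc_apply, trunc_apply]
    split_ifs with h1 h2
    · exact absurd (Prod.ext (h1.1.symm.trans h2.1) (h1.2.symm.trans h2.2)) h
    · rfl
    · rfl
  · ext p q
    simp only [Matrix.sum_apply, trunc_apply]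
    rw [Finset.sum_eq_single (ν p, ν q)]
    · simp
    · intro r _ hr
      exact if_neg fun h => hr (Prod.ext h.1.symm h.2.symm)
    · simp

theorem trunc_mem_blkDiag [DecidableEq ι] (r : ι × ι) {X : Matrix I I K} (hX : X ∈ blkDiag K ν) :
    trunc ν r X ∈ blkDiag K ν := fun p q h => by
  rw [trunc_apply] at h
  split_ifs at h with h1
  · exact hX p q h
  · exact absurd rfl h

theorem adL_trunc [DecidableEq ι] {a : Matrix I I K} (ha : a ∈ blkDiag K ν) (r : ι × ι)
    (X : Matrix I I K) : adL (K := K) a (trunc ν r X) = trunc ν r (adL (K := K) a X) := by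
  ext p q
  simp only [adL_apply, trunc_apply, Matrix.sub_apply, Matrix.mul_apply]
  have h1 : ∀ k, a p k * (if ν k = r.1 ∧ ν q = r.2 then X k q else 0)
      = if ν p = r.1 ∧ ν q = r.2 then a p k * X k q else 0 := fun k => by
    by_cases h0 : a p k = 0
    · simp [h0]
    · rw [ha p k h0]; split_ifs <;> simp
  have h2 : ∀ k, (if ν p = r.1 ∧ ν k = r.2 then X p k else 0) * a k q
      = if ν p = r.1 ∧ ν q = r.2 then X p k * a k q else 0 := fun k => by
    by_cases h0 : a k q = 0
    · simp [h0]
    · rw [ha k q h0]; split_ifs <;> simp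
  simp only [h1, h2]
  split_ifs <;> simp

/-- The dimension of the part of the centralizer of `a` supported on the block `(i, j)`. -/
def cdim (ν : I → ι) (a : Matrix I I K) (i j : ι) : ℕ :=
  Module.finrank K ↥(LinearMap.ker (adL (K := K) a) ⊓ blk K ν i j)

variable (K) in
/-- The dimension of the block `(i, j)`. -/
def ddim (ν : I → ι) (i j : ι) : ℕ := Module.finrank K (blk K ν i j)

theorem cdim_le_ddim (a : Matrix I I K) (i j : ι) : cdim ν a i j ≤ ddim K ν i j :=
  Submodule.finrank_mono inf_le_right

/-- Commutation with a block diagonal matrix can be tested block by block, so the centralizer is the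
direct sum of its parts in the blocks. -/
theorem sum_cdim [Fintype ι] [DecidableEq ι] {a : Matrix I I K} (ha : a ∈ blkDiag K ν) :
    ∑ i, ∑ j, cdim ν a i j = Module.finrank K (LinearMap.ker (adL (K := K) a)) := by
  rw [finrank_eq_sum_finrank_inf_blk (ν := ν) _ fun r X hX => ?_]
  · rfl
  · rw [LinearMap.mem_ker] at hX ⊢
    rw [adL_trunc ha, hX, map_zero]

theorem sum_ddim [Fintype ι] [DecidableEq ι] :
    ∑ i, ∑ j, ddim K ν i j = Fintype.card I ^ 2 := by
  have h := finrank_eq_sum_finrank_inf_blk (K := K) (ν := ν) ⊤ fun r X hX => trivial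
  simp only [finrank_top, Module.finrank_matrix, Module.finrank_self, mul_one] at h
  rw [sq, h]
  exact Finset.sum_congr rfl fun i _ => Finset.sum_congr rfl fun j _ =>
    finrank_submodule_congr (top_inf_eq _).symm

theorem finrank_blkDiag_inf [Fintype ι] [DecidableEq ι] (N : Submodule K (Matrix I I K))
    (hN : ∀ r, ∀ X ∈ N, trunc ν r X ∈ N) :
    Module.finrank K ↥(blkDiag K ν ⊓ N) = ∑ i, Module.finrank K ↥(N ⊓ blk K ν i i) := by
  rw [finrank_eq_sum_finrank_inf_blk (ν := ν) (blkDiag K ν ⊓ N) fun r X hX =>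
    Submodule.mem_inf.mpr ⟨trunc_mem_blkDiag r hX.1, hN r X hX.2⟩]
  refine Finset.sum_congr rfl fun i _ => ?_
  rw [Finset.sum_eq_single i]
  · exact finrank_submodule_congr
      (by rw [inf_right_comm, inf_eq_right.mpr (blk_self_le i), inf_comm])
  · intro j _ hj
    refine (finrank_submodule_congr ?_).trans (finrank_bot K (Matrix I I K))
    rw [inf_right_comm, blkDiag_inf_blk_eq_bot hj.symm, bot_inf_eq]
  · simp

theorem sum_cdim_self [Fintype ι] [DecidableEq ι] {a : Matrix I I K} (ha : a ∈ blkDiag K ν) :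
    ∑ i, cdim ν a i i = Module.finrank K ↥(blkDiag K ν ⊓ LinearMap.ker (adL (K := K) a)) := by
  rw [finrank_blkDiag_inf]
  · rfl
  · intro r X hX
    rw [LinearMap.mem_ker] at hX ⊢
    rw [adL_trunc ha, hX, map_zero]

theorem sum_ddim_self [Fintype ι] [DecidableEq ι] :
    ∑ i, ddim K ν i i = Module.finrank K (blkDiag K ν : Submodule K (Matrix I I K)) := by
  have h := finrank_blkDiag_inf (K := K) (ν := ν) ⊤ fun r X hX => trivial
  rw [finrank_submodule_congr (inf_top_eq _)] at h
  rw [h]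
  exact Finset.sum_congr rfl fun i _ => finrank_submodule_congr (top_inf_eq _).symm

theorem ddim_eq [DecidableEq ι] (i j : ι) :
    ddim K ν i j = Fintype.card {p // ν p = i} * Fintype.card {p // ν p = j} := by
  rw [← Fintype.card_prod, ← Module.finrank_fintype_fun_eq_card K]
  refine LinearEquiv.finrank_eq
    { toFun := fun X r => X.1 r.1 r.2
      invFun := fun x => ⟨Matrix.of fun p q => if h : ν p = i ∧ ν q = j then
        x (⟨p, h.1⟩, ⟨q, h.2⟩) else 0, fun p q h => by
          by_contra hne
          rw [Matrix.of_apply, dif_neg hne] at h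
          exact h rfl⟩
      map_add' := fun _ _ => rfl
      map_smul' := fun _ _ => rfl
      left_inv := fun X => Subtype.ext (by
        ext p q
        simp only [Matrix.of_apply]
        split_ifs with h
        · rfl
        · by_contra hne
          exact h (X.2 p q (Ne.symm hne)))
      right_inv := fun x => by
        funext ⟨⟨p, hp⟩, ⟨q, hq⟩⟩
        simp [hp, hq] }

/-- The trace form. -/
def trForm : Matrix I I K →ₗ[K] Matrix I I K →ₗ[K] K :=
  (LinearMap.mul K (Matrix I I K)).compr₂ (Matrix.traceLinearMap I K K)

theorem trForm_apply (X Y : Matrix I I K) : trForm X Y = (X * Y).trace := rfl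

theorem trForm_single (w : Matrix I I K) (p q : I) :
    trForm (Matrix.single q p 1) w = w p q := by
  rw [trForm_apply, Matrix.trace_single_mul]
  simp

theorem single_mem_blk (p q : I) : Matrix.single p q (1 : K) ∈ blk K ν (ν p) (ν q) := by
  intro p' q' h
  by_cases hpq : p = p' ∧ q = q'
  · rw [hpq.1, hpq.2]; exact ⟨rfl, rfl⟩
  · exact absurd (Matrix.single_apply_of_ne _ _ _ _ _ hpq) h

theorem eq_zero_of_trForm_blk {i j : ι} {w : Matrix I I K} (hw : w ∈ blk K ν j i)
    (h : ∀ b ∈ blk K ν i j, trForm b w = 0) : w = 0 := by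
  ext p q
  by_contra hne
  have h1 := hw p q hne
  have h2 : Matrix.single q p (1 : K) ∈ blk K ν i j := by
    rw [← h1.1, ← h1.2]; exact single_mem_blk q p
  exact hne ((trForm_single w p q).symm.trans (h _ h2))

theorem eq_zero_of_trForm_blkDiag {w : Matrix I I K} (hw : w ∈ blkDiag K ν)
    (h : ∀ b ∈ blkDiag K ν, trForm b w = 0) : w = 0 := by
  ext p q
  by_contra hne
  have h1 := hw p q hne
  have h2 : Matrix.single q p (1 : K) ∈ blkDiag K ν := by
    refine blk_self_le (ν p) ?_
    have := single_mem_blk (K := K) (ν := ν) q p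
    rwa [← h1] at this
  exact hne ((trForm_single w p q).symm.trans (h _ h2))

theorem trForm_comm (X Y : Matrix I I K) : trForm X Y = trForm Y X := Matrix.trace_mul_comm X Y

theorem trForm_adL (a X Y : Matrix I I K) :
    trForm (adL (K := K) a X) Y = - trForm X (adL (K := K) a Y) := by
  simp only [trForm_apply, adL_apply, sub_mul, mul_sub, Matrix.trace_sub]
  rw [Matrix.mul_assoc a X Y, Matrix.trace_mul_comm a (X * Y), Matrix.mul_assoc X Y a,
    Matrix.mul_assoc X a Y]
  ring

theorem ddim_comm (i j : ι) : ddim K ν i j = ddim K ν j i := by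
  classical
  rw [ddim_eq, ddim_eq, mul_comm]

/-- The trace form pairs block (i, j) perfectly with block (j, i), and ad a is skew for it. So ad a
has the same rank on both blocks, and the blocks have equal dimension. -/
theorem cdim_comm_le {a : Matrix I I K} (ha : a ∈ blkDiag K ν) (i j : ι) :
    cdim ν a i j ≤ cdim ν a j i := by
  let f : ∀ i j, blk K ν i j →ₗ[K] blk K ν i j := fun i j =>
    (adL (K := K) a).restrict fun X hX => adL_mem_blk ha hX
  have hf : ∀ i j, Module.finrank K (LinearMap.range (f i j)) + cdim ν a i j = ddim K ν i j := by
    intro i j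
    have h := LinearMap.finrank_range_add_finrank_ker (f i j)
    have h2 : Module.finrank K (LinearMap.ker (f i j)) = cdim ν a i j := by
      refine (Submodule.equivMapOfInjective _ (blk K ν i j).injective_subtype _).finrank_eq.trans ?_
      have : (LinearMap.ker (f i j)).map (blk K ν i j).subtype
          = LinearMap.ker (adL (K := K) a) ⊓ blk K ν i j := by
        ext X
        constructor
        · rintro ⟨Y, hY, rfl⟩
          exact ⟨congrArg Subtype.val hY, Y.2⟩
        · rintro ⟨h1, h2⟩
          exact ⟨⟨X, h2⟩, Subtype.ext h1, rfl⟩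
      exact congrArg (fun N : Submodule K (Matrix I I K) => Module.finrank K N) this
    rw [← h2]
    exact h
  have h1 := finrank_range_le_of_adjoint (f i j) (-(f j i))
    (trForm.compl₁₂ (blk K ν i j).subtype (blk K ν j i).subtype)
    (trForm.compl₁₂ (blk K ν i j).subtype (blk K ν j i).subtype)
    (fun x y => by
      change trForm (x : Matrix I I K) (-(adL (K := K) a y)) = trForm (adL (K := K) a x) _
      rw [trForm_adL, map_neg]; rfl)
    (fun x' h => Subtype.ext (eq_zero_of_trForm_blk x'.2 fun b hb => h ⟨b, hb⟩))
  rw [LinearMap.range_neg] at h1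
  have h2 := hf i j
  have h3 := hf j i
  rw [ddim_comm] at h3
  have := hf i j
  omega

theorem cdim_comm {a : Matrix I I K} (ha : a ∈ blkDiag K ν) (i j : ι) :
    cdim ν a i j = cdim ν a j i :=
  le_antisymm (cdim_comm_le ha i j) (cdim_comm_le ha j i)

end Blocks

end QuiverMoment

end

noncomputable section

namespace QuiverMoment

/-! ### The centralizer bounds for matrices. -/

section Transfer

variable {K : Type*} [Field K]

theorem map_ker_adL {E E' : Type*} [Ring E] [Algebra K E] [Ring E'] [Algebra K E']
    (e : E ≃ₐ[K] E') (a : E) : (LinearMap.ker (adL (K := K) a)).map e.toLinearMap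
      = LinearMap.ker (adL (K := K) (e a)) := by
  ext y
  constructor
  · rintro ⟨x, hx, rfl⟩
    have := congrArg e hx
    simpa using this
  · intro hy
    refine ⟨e.symm y, e.injective ?_, by simp⟩
    simpa using hy

theorem map_commSpan {E E' : Type*} [Ring E] [Algebra K E] [Ring E'] [Algebra K E']
    (e : E ≃ₐ[K] E') (C : Submodule K E) :
    (commSpan C).map e.toLinearMap = commSpan (C.map e.toLinearMap) := by
  rw [commSpan, Submodule.map_span, commSpan]
  congr 1
  ext y
  constructor
  · rintro ⟨_, ⟨w, hw, w', hw', rfl⟩, rfl⟩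
    exact ⟨e w, ⟨w, hw, rfl⟩, e w', ⟨w', hw', rfl⟩, by simp⟩
  · rintro ⟨_, ⟨w, hw, rfl⟩, _, ⟨w', hw', rfl⟩, rfl⟩
    exact ⟨_, ⟨w, hw, w', hw', rfl⟩, by simp⟩

theorem finrank_map_algEquiv {E E' : Type*} [Ring E] [Algebra K E] [Ring E'] [Algebra K E']
    (e : E ≃ₐ[K] E') (C : Submodule K E) :
    Module.finrank K (C.map e.toLinearMap) = Module.finrank K C :=
  (Submodule.equivMapOfInjective _ e.injective C).finrank_eq.symm

variable {I : Type*} [Fintype I] [DecidableEq I]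

theorem Matrix.finrank_centralizer_le (a : Matrix I I K) :
    Module.finrank K (LinearMap.ker (adL (K := K) a)) ≤
      Module.finrank K (commSpan (LinearMap.ker (adL (K := K) a))) + Fintype.card I ∧
    (Fintype.card I < Module.finrank K (LinearMap.ker (adL (K := K) a)) →
      Module.finrank K (LinearMap.ker (adL (K := K) a)) <
      Module.finrank K (commSpan (LinearMap.ker (adL (K := K) a))) + Fintype.card I) := by
  have h := QuiverMoment.finrank_centralizer_le (Matrix.toLinAlgEquiv' (R := K) a)
  rwa [← map_ker_adL, ← map_commSpan, finrank_map_algEquiv, finrank_map_algEquiv,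
    Module.finrank_fintype_fun_eq_card] at h

theorem Matrix.two_mul_card_add_finrank_ker_adL_le (a : Matrix I I K)
    (ha : ∀ c : K, a ≠ algebraMap K _ c) :
    2 * Fintype.card I + Module.finrank K (LinearMap.ker (adL (K := K) a))
      ≤ Fintype.card I ^ 2 + 2 := by
  have h := two_mul_finrank_le_finrank_range_adL (Matrix.toLinAlgEquiv' (R := K) a)
    (fun c hc => ha c (Matrix.toLinAlgEquiv'.injective (by rw [hc, AlgEquiv.commutes])))
  have h2 := LinearMap.finrank_range_add_finrank_ker
    (adL (K := K) (Matrix.toLinAlgEquiv' (R := K) a))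
  have h3 : Module.finrank K (Module.End K (I → K)) = Fintype.card I ^ 2 := by
    rw [Module.finrank_linearMap, Module.finrank_fintype_fun_eq_card, sq]
  have h4 : Module.finrank K (LinearMap.ker (adL (K := K) (Matrix.toLinAlgEquiv' (R := K) a)))
      = Module.finrank K (LinearMap.ker (adL (K := K) a)) := by
    rw [← map_ker_adL, finrank_map_algEquiv]
  rw [h3.symm.trans h2.symm, ← h4]
  rw [Module.finrank_fintype_fun_eq_card] at h
  lia

end Transfer

/-! ### Tangent vectors given by derivations, and the basic dimension estimate. -/

section Estimate

variable {K : Type*} [Field K] {I : Type*} [Fintype I] [DecidableEq I] {ι : Type*}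
  {ν : I → ι}

theorem map_derivation_mul (D : Derivation ℤ K K) (X Y : Matrix I I K) :
    (X * Y).map D = X.map D * Y + X * Y.map D := by
  ext p q
  simp only [Matrix.map_apply, Matrix.mul_apply, Matrix.add_apply, map_sum, Derivation.leibniz,
    smul_eq_mul, ← Finset.sum_add_distrib]
  exact Finset.sum_congr rfl fun r _ => by ring

/-- Leibniz rule applied to [X, Y] = 0. This is how first-order variations of the stabilizer enter.
-/
theorem map_derivation_adL (D : Derivation ℤ K K) {X Y : Matrix I I K}
    (h : adL (K := K) X Y = 0) : adL (K := K) (X.map D) Y + adL (K := K) X (Y.map D) = 0 := by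
  have h1 : (X * Y).map D = (Y * X).map D := congrArg (fun Z => Z.map D) (sub_eq_zero.mp h)
  rw [map_derivation_mul, map_derivation_mul] at h1
  rw [adL_apply, adL_apply, ← sub_eq_zero.mpr h1]
  abel

variable {Q : Type*}

variable (ν) in
/-- Block diagonal matrices commuting with all `x β`. -/
def stab (x : Q → Matrix I I K) : Submodule K (Matrix I I K) :=
  blkDiag K ν ⊓ ⨅ β, LinearMap.ker (adL (K := K) (x β))

theorem mem_stab {x : Q → Matrix I I K} {a : Matrix I I K} :
    a ∈ stab ν x ↔ a ∈ blkDiag K ν ∧ ∀ β, a * x β = x β * a := by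
  simp only [stab, Submodule.mem_inf, Submodule.mem_iInf, LinearMap.mem_ker, adL_apply,
    sub_eq_zero, eq_comm]

theorem adL_add_smul (a z : Matrix I I K) (t : K) :
    adL (K := K) (a + t • z) = adL (K := K) a + t • adL (K := K) z := by
  ext1 w
  simp only [adL_apply, LinearMap.add_apply, LinearMap.smul_apply, add_mul, mul_add,
    smul_mul_assoc, mul_smul_comm, smul_sub]
  abel

/-- For w, w' in the centralizer, tr(b [w, w']) = tr([b, w] w') = tr([a, y] w') = - tr(y [a, w']) =
0. The hypothesis on b is the tangency condition to the locus where ad a has constant rank. -/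
theorem mem_perpIn_commSpan {a b : Matrix I I K} (hb : b ∈ blkDiag K ν)
    (h : ∀ w, adL (K := K) a w = 0 → ∃ y, adL (K := K) b w = adL (K := K) a y) :
    b ∈ perpIn trForm (blkDiag K ν) (commSpan (LinearMap.ker (adL (K := K) a))) := by
  refine ⟨hb, fun w hw => ?_⟩
  refine Submodule.span_induction ?_ (map_zero _) (fun x y _ _ hx hy => by rw [map_add, hx, hy, add_zero])
    (fun c x _ hx => by rw [map_smul, hx, smul_zero]) hw
  rintro _ ⟨w, hw, w', hw', rfl⟩
  obtain ⟨y, hy⟩ := h w hw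
  have h1 : trForm b (w * w' - w' * w) = trForm (adL (K := K) b w) w' := by
    simp only [trForm_apply, adL_apply, mul_sub, sub_mul, Matrix.trace_sub]
    rw [← Matrix.mul_assoc b w' w, Matrix.trace_mul_comm (b * w') w, Matrix.mul_assoc b w w',
      Matrix.mul_assoc w b w']
  rw [h1, hy, trForm_adL, LinearMap.mem_ker.mp hw', map_zero, neg_zero]

/-- The central estimate. It holds for any family of arrows, with no momentum equation, so it can be
used for all arrows or for half of them. -/
theorem exists_mem_stab_estimate [Infinite K] [Fintype Q] (s t : Q → ι) (x : Q → Matrix I I K)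
    (T : Submodule K (Q → Matrix I I K)) (hTR : ∀ v ∈ T, ∀ β, v β ∈ blk K ν (t β) (s β))
    (hT : ∀ v ∈ T, ∃ D : Derivation ℤ K K, ∀ β, (x β).map D = v β)
    (a₀ : Matrix I I K) (ha₀ : a₀ ∈ stab ν x) (hns : ∀ c : K, a₀ ≠ algebraMap K _ c) :
    ∃ a ∈ stab ν x, (∀ c : K, a ≠ algebraMap K _ c) ∧
      Module.finrank K T + Module.finrank K (stab ν x)
        + Module.finrank K ↥(blkDiag K ν ⊓ LinearMap.ker (adL (K := K) a))
        + Module.finrank K (commSpan (LinearMap.ker (adL (K := K) a)))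
      ≤ Module.finrank K (blkDiag K ν : Submodule K (Matrix I I K))
        + Module.finrank K (LinearMap.ker (adL (K := K) a)) + ∑ β, cdim ν a (t β) (s β) := by
  let rk : Matrix I I K → ℕ := fun a => Module.finrank K (LinearMap.range (adL (K := K) a))
  have hbdd : BddAbove (rk '' (stab ν x : Set (Matrix I I K))) :=
    ⟨Module.finrank K (Matrix I I K), by rintro _ ⟨b, _, rfl⟩; exact Submodule.finrank_le _⟩
  -- An element of the stabilizer with ad a of largest rank: along every line a + r b inside the
  -- stabilizer the rank does not increase.
  obtain ⟨a, haS, ha⟩ := Nat.sSup_mem ⟨_, Set.mem_image_of_mem rk ha₀⟩ hbdd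
  have hmax : ∀ b ∈ stab ν x, rk b ≤ rk a := fun b hb =>
    (le_csSup hbdd (Set.mem_image_of_mem rk hb)).trans_eq ha.symm
  refine ⟨a, haS, fun c hc => ?_, ?_⟩
  · have h1 : rk a = 0 := by
      have : adL (K := K) a = 0 := by
        ext1 w
        rw [adL_apply, hc, Algebra.commutes, sub_self, LinearMap.zero_apply]
      change Module.finrank K (LinearMap.range (adL (K := K) a)) = 0
      rw [this, LinearMap.range_zero, finrank_bot]
    -- If the maximal element were scalar, all ranks would be 0. Then `a₀` would commute with every
    -- matrix and be scalar too.
    have h2 : rk a₀ = 0 := Nat.le_zero.mp ((hmax a₀ ha₀).trans_eq h1)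
    have h3 := LinearMap.range_eq_bot.mp (Submodule.finrank_eq_zero.mp h2)
    have h4 : ∀ w, a₀ * w = w * a₀ := fun w => sub_eq_zero.mp (LinearMap.congr_fun h3 w)
    obtain ⟨c, hc⟩ := Matrix.mem_range_scalar_iff_commute_single'.mpr
      fun i j => (h4 (Matrix.single i j 1)).symm
    exact hns c hc.symm
  have haD : a ∈ blkDiag K ν := (mem_stab.mp haS).1
  have hax := (mem_stab.mp haS).2
  set C := LinearMap.ker (adL (K := K) a) with hC
  have hcomm : commSpan C ≤ C := by
    refine Submodule.span_le.mpr ?_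
    rintro _ ⟨w, hw, w', hw', rfl⟩
    have e1 : a * w = w * a := sub_eq_zero.mp hw
    have e2 : a * w' = w' * a := sub_eq_zero.mp hw'
    change adL (K := K) a _ = 0
    rw [adL_apply, sub_eq_zero, mul_sub, sub_mul, ← mul_assoc, e1, mul_assoc, e2, ← mul_assoc a,
      e2, mul_assoc w' a, e1, mul_assoc, mul_assoc]
  have h1 := finrank_perpIn_add_add_le trForm (blkDiag K ν) C (commSpan C) hcomm
    (fun w hw h => eq_zero_of_trForm_blkDiag hw h)
  -- Pairs (v, b) satisfying the derivative [a, v_β] = [x_β, b] of [a, x_β] = 0, with b orthogonal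
  -- to [C, C]. Every v in `T` lifts with b = Da, and the fibre over v = 0 contains the stabilizer.
  -- Where b = 0, each v_β centralizes a.
  let L : Submodule K ((Q → Matrix I I K) × Matrix I I K) :=
    { carrier := {r | (∀ β, r.1 β ∈ blk K ν (t β) (s β)) ∧
        r.2 ∈ perpIn (trForm (K := K) (I := I)) (blkDiag K ν) (commSpan C) ∧
        ∀ β, adL (K := K) a (r.1 β) - adL (K := K) (x β) r.2 = 0}
      add_mem' := fun {r r'} hr hr' => ⟨fun β => add_mem (hr.1 β) (hr'.1 β),
        add_mem hr.2.1 hr'.2.1, fun β => by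
          rw [Prod.snd_add, Prod.fst_add, Pi.add_apply, map_add, map_add, add_sub_add_comm,
            hr.2.2, hr'.2.2, add_zero]⟩
      zero_mem' := ⟨fun β => zero_mem _, zero_mem _, fun β => by simp⟩
      smul_mem' := fun c r hr => ⟨fun β => Submodule.smul_mem _ c (hr.1 β),
        Submodule.smul_mem _ c hr.2.1, fun β => by
          rw [Prod.smul_snd, Prod.smul_fst, Pi.smul_apply, map_smul, map_smul, ← smul_sub,
            hr.2.2, smul_zero]⟩ }
  have h2 := finrank_add_finrank_le_of_fibration L T
    (Submodule.pi Set.univ fun β => C ⊓ blk K ν (t β) (s β)) (stab ν x)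
    (perpIn trForm (blkDiag K ν) (commSpan C)) ?_ ?_ (fun v b h => h.2.1) ?_
  · rw [finrank_submodule_pi] at h2
    have h3 : ∑ β, cdim ν a (t β) (s β) = ∑ β, Module.finrank K ↥(C ⊓ blk K ν (t β) (s β)) := rfl
    omega
  · intro v hv
    obtain ⟨D, hD⟩ := hT v hv
    refine ⟨a.map D, hTR v hv, mem_perpIn_commSpan ?_ fun w hw => ⟨-(w.map D), ?_⟩, fun β => ?_⟩
    · intro p q h
      exact haD p q fun h0 => h ((congrArg D h0).trans (map_zero D))
    -- For w in the centralizer, [Da, w] = -[a, Dw] lies in the image of ad a.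
    · rw [map_neg]
      exact eq_neg_of_add_eq_zero_left (map_derivation_adL D hw)
    · change adL (K := K) a (v β) - adL (K := K) (x β) (a.map D) = 0
      rw [← hD β, ← map_derivation_adL D (sub_eq_zero.mpr (hax β)), add_comm]
      simp only [adL_apply]
      abel
  · intro b hb
    refine ⟨fun β => zero_mem _, mem_perpIn_commSpan (mem_stab.mp hb).1 fun w hw => ?_, fun β => ?_⟩
    -- Maximality of the rank of ad a on the line a + r b makes ad b map ker(ad a) into the image of
    -- ad a.
    · obtain ⟨y, hy⟩ := apply_mem_range_of_finrank_range_le (adL (K := K) a) (adL (K := K) b)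
        (fun r => by
          rw [← adL_add_smul]
          exact hmax _ (add_mem haS (Submodule.smul_mem _ r hb))) hw
      exact ⟨y, hy.symm⟩
    · simp only [Pi.zero_apply, map_zero, adL_apply, (mem_stab.mp hb).2 β, sub_self]
  · rintro v ⟨hv1, -, hv2⟩ β -
    refine Submodule.mem_inf.mpr ⟨?_, hv1 β⟩
    have := hv2 β
    rwa [map_zero, sub_zero] at this

end Estimate

end QuiverMoment

end

noncomputable section

namespace QuiverMoment

/-! ### Restriction to half of the arrows. -/

section Arrows

variable {K : Type*} [Field K] {I : Type*} [Fintype I] [DecidableEq I] {ι : Type*}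
  {ν : I → ι} {Q : Type*} [Fintype Q]

/-- Fibre estimate for the projection to the positive arrows. A vertical tangent vector has its
negative components in the kernel of `N`, the map w ↦ Σ [x_β, w_β]. Under the trace form `N` is
adjoint to `G`, the infinitesimal action up to sign, whose kernel is the stabilizer. So rank N is at
least dim g - dim stab. -/
theorem finrank_le_add_finrank_map_restrict (P : Q → Prop) [DecidablePred P] (τ : Q → Q)
    (hτ : ∀ β, τ (τ β) = β) (hP : ∀ β, P (τ β) ↔ ¬ P β) (s t : Q → ι)
    (hs : ∀ β, s (τ β) = t β) (ht : ∀ β, t (τ β) = s β)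
    (x : {β // P β} → Matrix I I K) (hx : ∀ β : {β // P β}, x β ∈ blk K ν (t β) (s β))
    (T : Submodule K (Q → Matrix I I K)) (hTR : ∀ v ∈ T, ∀ β, v β ∈ blk K ν (t β) (s β))
    (hT : ∀ v ∈ T, (∀ β, P β → v β = 0) → ∑ β, adL (K := K) (x β) (v (τ β)) = 0) :
    Module.finrank K T + Module.finrank K (blkDiag K ν : Submodule K (Matrix I I K))
      ≤ Module.finrank K (T.map (LinearMap.funLeft K (Matrix I I K) (Subtype.val : {β // P β} → Q)))
        + ∑ β : {β // P β}, ddim K ν (t β) (s β) + Module.finrank K (stab ν x) := by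
  have h1 := finrank_map_add_finrank_inf_ker
    (LinearMap.funLeft K (Matrix I I K) (Subtype.val : {β // P β} → Q)) T
  let R1 : Submodule K ({β // P β} → Matrix I I K) :=
    Submodule.pi Set.univ fun β => blk K ν (s β) (t β)
  let R2 : Submodule K ({β // P β} → Matrix I I K) :=
    Submodule.pi Set.univ fun β => blk K ν (t β) (s β)
  have hR1 : Module.finrank K R1 = ∑ β : {β // P β}, ddim K ν (t β) (s β) := by
    rw [finrank_submodule_pi]
    exact Finset.sum_congr rfl fun β _ => ddim_comm _ _
  let N : ({β // P β} → Matrix I I K) →ₗ[K] Matrix I I K :=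
    ∑ β, adL (K := K) (x β) ∘ₗ LinearMap.proj β
  have hN : ∀ w, N w = ∑ β, adL (K := K) (x β) (w β) := fun w => by
    simp only [N, LinearMap.sum_apply, LinearMap.comp_apply, LinearMap.proj_apply]
  let G : (blkDiag K ν : Submodule K (Matrix I I K)) →ₗ[K] R2 :=
    { toFun := fun b => ⟨fun β => - adL (K := K) (x β) b, fun β _ => by
        have := adL_mem_blk b.2 (hx β)
        rw [adL_apply, ← neg_sub] at this
        exact this⟩
      map_add' := fun b b' => Subtype.ext (funext fun β => by
        change -adL (K := K) (x β) (b + b' : Matrix I I K) = _ + _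
        rw [map_add, neg_add])
      map_smul' := fun c b => Subtype.ext (funext fun β => by
        change -adL (K := K) (x β) (c • b : Matrix I I K) = c • _
        rw [map_smul, smul_neg]) }
  have hG := LinearMap.finrank_range_add_finrank_ker G
  have hGker : Module.finrank K (LinearMap.ker G) ≤ Module.finrank K (stab ν x) := by
    rw [(Submodule.equivMapOfInjective _ (blkDiag K ν).injective_subtype
      (LinearMap.ker G)).finrank_eq]
    refine Submodule.finrank_mono ?_
    rintro _ ⟨b, hb, rfl⟩
    refine mem_stab.mpr ⟨b.2, fun β => ?_⟩
    have : - adL (K := K) (x β) b = 0 := congrFun (congrArg Subtype.val (LinearMap.mem_ker.mp hb)) β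
    exact (sub_eq_zero.mp (neg_eq_zero.mp this)).symm
  let B : ({β // P β} → Matrix I I K) →ₗ[K] ({β // P β} → Matrix I I K) →ₗ[K] K :=
    ∑ β, trForm.compl₁₂ (LinearMap.proj β) (LinearMap.proj β)
  have hB : ∀ w w', B w w' = ∑ β, trForm (w β) (w' β) := fun w w' => by
    simp only [B, LinearMap.sum_apply, LinearMap.compl₁₂_apply, LinearMap.proj_apply]
  have h2 := finrank_range_le_of_adjoint (N.domRestrict R1) G (B.compl₁₂ R1.subtype R2.subtype)
    (trForm.compl₁₂ LinearMap.id (blkDiag K ν).subtype) (fun w b => by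
      change B w (fun β => - adL (K := K) (x β) b) = trForm (N w) b
      rw [hB, hN, map_sum, LinearMap.sum_apply]
      refine Finset.sum_congr rfl fun β _ => ?_
      rw [trForm_adL, map_neg]) (fun w h => by
      refine Subtype.ext (funext fun β => eq_zero_of_trForm_blk (w.2 β trivial) fun b hb => ?_)
      classical
      have h3 := h ⟨Pi.single β b, fun γ _ => by
        by_cases hγ : γ = β
        · rw [hγ, Pi.single_eq_same]; exact hb
        · rw [Pi.single_eq_of_ne hγ]; exact zero_mem _⟩
      change B (Pi.single β b) w = 0 at h3
      rw [hB, Finset.sum_eq_single β] at h3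
      · rwa [Pi.single_eq_same] at h3
      · intro γ _ hγ
        rw [Pi.single_eq_of_ne hγ, map_zero, LinearMap.zero_apply]
      · simp)
  have h3 := finrank_map_add_finrank_inf_ker N R1
  rw [LinearMap.range_domRestrict] at h2
  have h4 : Module.finrank K ↥(T ⊓ LinearMap.ker
      (LinearMap.funLeft K (Matrix I I K) (Subtype.val : {β // P β} → Q)))
      ≤ Module.finrank K ↥(R1 ⊓ LinearMap.ker N) := by
    let ρ : ↥(T ⊓ LinearMap.ker
      (LinearMap.funLeft K (Matrix I I K) (Subtype.val : {β // P β} → Q))) →ₗ[K]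
        ({β // P β} → Matrix I I K) :=
      (LinearMap.funLeft K (Matrix I I K) fun β : {β // P β} => τ β).domRestrict _
    have hρ : Function.Injective ρ := by
      rw [injective_iff_map_eq_zero]
      rintro ⟨w, hw1, hw2⟩ hw
      refine Subtype.ext (funext fun β => ?_)
      by_cases hβ : P β
      · exact congrFun hw2 ⟨β, hβ⟩
      · have := congrFun hw ⟨τ β, (hP β).mpr hβ⟩
        change w (τ (τ β)) = 0 at this
        rwa [hτ] at this
    rw [← LinearMap.finrank_range_of_inj hρ]
    refine Submodule.finrank_mono ?_
    rintro _ ⟨⟨w, hw1, hw2⟩, rfl⟩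
    refine Submodule.mem_inf.mpr ⟨fun β _ => ?_, ?_⟩
    · have := hTR w hw1 (τ β)
      rwa [hs, ht] at this
    · rw [LinearMap.mem_ker, hN]
      exact hT w hw1 fun β hβ => congrFun hw2 ⟨β, hβ⟩
  omega

theorem sum_arrows [Fintype ι] [DecidableEq ι] (s t : Q → ι) (d : ι → ι → ℕ)
    (hd : ∀ i j, (Finset.univ.filter fun β => t β = i ∧ s β = j).card = d i j) (f : ι → ι → ℕ) :
    ∑ β, f (t β) (s β) = ∑ i, ∑ j, d i j * f i j := by
  rw [← Finset.sum_fiberwise Finset.univ (fun β => (t β, s β)), Fintype.sum_prod_type]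
  refine Finset.sum_congr rfl fun i _ => Finset.sum_congr rfl fun j _ => ?_
  rw [← hd, ← smul_eq_mul, ← Finset.sum_const]
  refine Finset.sum_congr ?_ fun β hβ => ?_
  · ext β; simp [Prod.ext_iff]
  · simp only [Finset.mem_filter, Finset.mem_univ, true_and] at hβ
    rw [hβ.1, hβ.2]

theorem sum_eq_two_mul_sum_subtype (P : Q → Prop) [DecidablePred P] (τ : Q → Q)
    (hτ : ∀ β, τ (τ β) = β) (hP : ∀ β, P (τ β) ↔ ¬ P β) (f : Q → ℕ) (hf : ∀ β, f (τ β) = f β) :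
    ∑ β, f β = 2 * ∑ β : {β // P β}, f β := by
  rw [← Fintype.sum_subtype_add_sum_subtype P f, two_mul]
  congr 1
  refine Fintype.sum_equiv
    { toFun := fun β => ⟨τ β, (hP β).mpr β.2⟩
      invFun := fun β => ⟨τ β, fun h => (hP β).mp h β.2⟩
      left_inv := fun β => Subtype.ext (hτ β)
      right_inv := fun β => Subtype.ext (hτ β) } _ _ fun β => (hf β).symm

/-- At a vertex of dimension at most one the diagonal block is commutative, so its loops impose no
condition on the stabilizer. This allows small d_ii there in the exceptional analysis. -/
theorem mul_comm_of_mem_blk_of_subsingleton {i : ι} (hi : ∀ p q, ν p = i → ν q = i → p = q)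
    {a X : Matrix I I K} (ha : a ∈ blkDiag K ν) (hX : X ∈ blk K ν i i) : a * X = X * a := by
  have h1 := mul_mem_blk_of_left ha hX
  have h2 := mul_mem_blk_of_right ha hX
  ext p q
  by_cases h : ν p = i ∧ ν q = i
  · obtain rfl := hi p q h.1 h.2
    rw [Matrix.mul_apply, Matrix.mul_apply]
    refine Finset.sum_congr rfl fun r _ => ?_
    by_cases hr : r = p
    · rw [hr, mul_comm]
    · have h3 : X r p = 0 := by
        by_contra hne
        exact hr (hi r p (hX r p hne).1 h.1)
      have h4 : X p r = 0 := by
        by_contra hne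
        exact hr (hi r p (hX p r hne).2 h.1)
      rw [h3, h4, mul_zero, zero_mul]
  · have h3 : (a * X) p q = 0 := by
      by_contra hne
      exact h (h1 p q hne)
    have h4 : (X * a) p q = 0 := by
      by_contra hne
      exact h (h2 p q hne)
    rw [h3, h4]

theorem algebraMap_mem_stab (x : Q → Matrix I I K) (c : K) :
    algebraMap K (Matrix I I K) c ∈ stab ν x := by
  refine mem_stab.mpr ⟨?_, fun β => Algebra.commutes c _⟩
  rw [Algebra.algebraMap_eq_smul_one]
  exact Submodule.smul_mem _ c one_mem_blkDiag

theorem two_le_finrank_of_ne_algebraMap {S : Submodule K (Matrix I I K)} {a : Matrix I I K}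
    (h1 : 1 ∈ S) (ha : a ∈ S) (hns : ∀ c : K, a ≠ algebraMap K _ c) :
    2 ≤ Module.finrank K S := by
  have h3 : LinearIndependent K ![(⟨1, h1⟩ : S), ⟨a, ha⟩] := by
    rw [LinearIndependent.pair_iff]
    intro r r' h
    have h4 : r • (1 : Matrix I I K) + r' • a = 0 := congrArg Subtype.val h
    have hr' : r' = 0 := by
      by_contra hr'
      refine hns (-(r'⁻¹ * r)) ?_
      rw [Algebra.algebraMap_eq_smul_one, neg_smul, mul_smul, ← smul_neg,
        ← eq_neg_of_add_eq_zero_right h4, smul_smul, inv_mul_cancel₀ hr', one_smul]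
    refine ⟨?_, hr'⟩
    rw [hr', zero_smul, add_zero] at h4
    by_contra hr
    have h5 : (1 : Matrix I I K) = 0 := (smul_eq_zero.mp h4).resolve_left hr
    refine hns 0 ?_
    rw [map_zero, ← mul_one a, h5, mul_zero]
  simpa using h3.fintype_card_le_finrank

end Arrows

/-! ### Codimension of the degenerate locus. -/

section Bound

variable {K : Type*} [Field K] [Infinite K] {I : Type*} [Fintype I] [DecidableEq I] {ι : Type*}
  [Fintype ι] [DecidableEq ι] {ν : I → ι} {Q : Type*} [Fintype Q]

/-- Combines the basic estimate with d_ij ≥ 2 + 2δ_ij and the centralizer bounds. Only size m = 2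
fails to give the gain 3 automatically, so the extra hypothesis concerns that size alone. -/
theorem finrank_tangent_add_le (P : Q → Prop) [DecidablePred P] (τ : Q → Q)
    (hτ : ∀ β, τ (τ β) = β) (hP : ∀ β, P (τ β) ↔ ¬ P β) (s t : Q → ι)
    (hs : ∀ β, s (τ β) = t β) (ht : ∀ β, t (τ β) = s β) (d : ι → ι → ℕ)
    (hd : ∀ i j, (Finset.univ.filter fun β => t β = i ∧ s β = j).card = d i j)
    (hd2 : ∀ i j, (if i = j then 4 else 2) ≤ d i j)
    (u : Q → Matrix I I K) (hu : ∀ β, u β ∈ blk K ν (t β) (s β))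
    (hμ : ∑ β, (if P β then (1 : K) else -1) • (u β * u (τ β)) = 0)
    (T : Submodule K (Q → Matrix I I K)) (hTR : ∀ v ∈ T, ∀ β, v β ∈ blk K ν (t β) (s β))
    (hT : ∀ v ∈ T, ∃ D : Derivation ℤ K K, ∀ β, (u β).map D = v β)
    (a₀ : Matrix I I K) (ha₀ : a₀ ∈ stab ν u) (hns : ∀ c : K, a₀ ≠ algebraMap K _ c) :
    Module.finrank K T + Module.finrank K (blkDiag K ν : Submodule K (Matrix I I K)) + 2
      ≤ ∑ β, ddim K ν (t β) (s β) ∧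
    ((Fintype.card I = 2 → ∀ p q, p ≠ q → (if ν p = ν q then 5 else 3) ≤ d (ν p) (ν q)) →
    Module.finrank K T + Module.finrank K (blkDiag K ν : Submodule K (Matrix I I K)) + 3
      ≤ ∑ β, ddim K ν (t β) (s β)) := by
  -- numerical consequences of the results on centralizers
  have hnum : ∀ a ∈ blkDiag K ν, (∀ c : K, a ≠ algebraMap K _ c) → ∃ o oo : ℕ,
      o + Module.finrank K (LinearMap.ker (adL (K := K) a)) = Fintype.card I ^ 2 ∧
      oo + Module.finrank K ↥(blkDiag K ν ⊓ LinearMap.ker (adL (K := K) a))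
        = Module.finrank K (blkDiag K ν : Submodule K (Matrix I I K)) ∧
      ∑ β, cdim ν a (t β) (s β) + 2 * o + 2 * oo ≤ ∑ β, ddim K ν (t β) (s β) ∧
      ((Fintype.card I = 2 → ∀ p q, p ≠ q → (if ν p = ν q then 5 else 3) ≤ d (ν p) (ν q)) →
        Fintype.card I = 2 →
        ∑ β, cdim ν a (t β) (s β) + 3 * o + 2 * oo ≤ ∑ β, ddim K ν (t β) (s β)) := by
    intro a ha hns
    have hle := fun i j => cdim_le_ddim (ν := ν) a i j
    refine ⟨∑ i, ∑ j, (ddim K ν i j - cdim ν a i j), ∑ i, (ddim K ν i i - cdim ν a i i), ?_, ?_,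
      ?_, ?_⟩
    · rw [← sum_cdim ha, ← sum_ddim (K := K) (ν := ν), ← Finset.sum_add_distrib]
      refine Finset.sum_congr rfl fun i _ => ?_
      rw [← Finset.sum_add_distrib]
      exact Finset.sum_congr rfl fun j _ => Nat.sub_add_cancel (hle i j)
    · rw [← sum_cdim_self ha, ← sum_ddim_self (K := K) (ν := ν), ← Finset.sum_add_distrib]
      exact Finset.sum_congr rfl fun i _ => Nat.sub_add_cancel (hle i i)
    · rw [sum_arrows s t d hd, sum_arrows s t d hd, Finset.mul_sum, Finset.mul_sum,
        ← Finset.sum_add_distrib, ← Finset.sum_add_distrib]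
      refine Finset.sum_le_sum fun i _ => ?_
      have h1 : 2 * (ddim K ν i i - cdim ν a i i)
          = ∑ j, if i = j then 2 * (ddim K ν i j - cdim ν a i j) else 0 := by simp
      rw [h1, Finset.mul_sum, ← Finset.sum_add_distrib, ← Finset.sum_add_distrib]
      refine Finset.sum_le_sum fun j _ => ?_
      obtain ⟨k, hk⟩ := Nat.exists_eq_add_of_le (hle i j)
      rw [hk, Nat.add_sub_cancel_left, mul_add]
      have := Nat.mul_le_mul_right k (hd2 i j)
      split_ifs with hij
      · rw [if_pos hij] at this; linarith
      · rw [if_neg hij] at this; linarith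
    · intro hexc hI
      rw [sum_arrows s t d hd, sum_arrows s t d hd, Finset.mul_sum, Finset.mul_sum,
        ← Finset.sum_add_distrib, ← Finset.sum_add_distrib]
      refine Finset.sum_le_sum fun i _ => ?_
      have h1 : 2 * (ddim K ν i i - cdim ν a i i)
          = ∑ j, if i = j then 2 * (ddim K ν i j - cdim ν a i j) else 0 := by simp
      rw [h1, Finset.mul_sum, ← Finset.sum_add_distrib, ← Finset.sum_add_distrib]
      refine Finset.sum_le_sum fun j _ => ?_
      -- For m = 2, a block with small d_ij contributes nothing. If i = j, the vertex has dimension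
      -- at most one, so the block lies in the centralizer; if i ≠ j, the block is zero.
      have h2 : ddim K ν i j = cdim ν a i j ∨ (if i = j then 5 else 3) ≤ d i j := by
        by_contra hcon
        push Not at hcon
        refine hcon.1 (le_antisymm (Submodule.finrank_mono fun X hX =>
          Submodule.mem_inf.mpr ⟨?_, hX⟩) (hle i j))
        rw [LinearMap.mem_ker]
        by_cases hij : i = j
        · subst hij
          refine sub_eq_zero.mpr (mul_comm_of_mem_blk_of_subsingleton (fun p q hp hq => ?_) ha hX)
          by_contra hpq
          have h3 := hexc hI p q hpq
          rw [hp, hq] at h3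
          exact absurd h3 (not_le.mpr hcon.2)
        · have hX0 : X = 0 := by
            ext p q
            by_contra hne
            obtain ⟨hp, hq⟩ := hX p q hne
            have h3 := hexc hI p q (fun h => hij (by rw [← hp, ← hq, h]))
            rw [hp, hq] at h3
            exact absurd h3 (not_le.mpr hcon.2)
          rw [hX0, map_zero]
      obtain ⟨k, hk⟩ := Nat.exists_eq_add_of_le (hle i j)
      rw [hk, Nat.add_sub_cancel_left, mul_add]
      rcases h2 with h2 | h2
      · have : k = 0 := by omega
        subst this
        simp
      · have := Nat.mul_le_mul_right k h2
        split_ifs with hij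
        · rw [if_pos hij] at this; linarith
        · rw [if_neg hij] at this; linarith
  have hfacts : ∀ a ∈ blkDiag K ν, (∀ c : K, a ≠ algebraMap K _ c) →
      2 ≤ Module.finrank K (LinearMap.ker (adL (K := K) a)) := fun a _ hns =>
    two_le_finrank_of_ne_algebraMap (by simp [LinearMap.mem_ker]) (by simp [LinearMap.mem_ker]) hns
  -- For m ≤ 3 the gain is 2·o + dim stab - dim(g ∩ C) - (dim C - dim [C,C]), with dim stab ≥ 2. For
  -- m = 2, where dim C = 2, it is at least 4 + 2 - 2 - 2 = 2, and 3·o in place of 2·o raises this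
  -- to 4. For m = 3 the worst case is dim C = 5, giving 8 + 2 - 5 - 2 = 3.
  by_cases hm : Fintype.card I ≤ 3
  · obtain ⟨a, haS, hans, hest⟩ := exists_mem_stab_estimate s t u T hTR hT a₀ ha₀ hns
    have haD := (mem_stab.mp haS).1
    obtain ⟨o, oo, h1, h2, h3, h4⟩ := hnum a haD hans
    have h5 := Matrix.finrank_centralizer_le a
    have h6 := Matrix.two_mul_card_add_finrank_ker_adL_le a hans
    have h7 := hfacts a haD hans
    have h8 : 2 ≤ Module.finrank K (stab ν u) := two_le_finrank_of_ne_algebraMap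
      (by simpa using algebraMap_mem_stab (ν := ν) u 1) haS hans
    have h9 : Module.finrank K ↥(blkDiag K ν ⊓ LinearMap.ker (adL (K := K) a))
      ≤ Module.finrank K (LinearMap.ker (adL (K := K) a)) := Submodule.finrank_mono inf_le_right
    generalize Fintype.card I = m at *
    have h10 : m = 2 ∨ m = 3 := by
      interval_cases m <;> omega
    rcases h10 with rfl | rfl
    · refine ⟨by omega, fun hexc => ?_⟩
      have := h4 hexc rfl
      omega
    · exact ⟨by omega, fun _ => by omega⟩
  -- For m ≥ 4, dim stab of the positive half cancels between the two estimates and the gain is at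
  -- least o - (dim C - dim [C,C]). If dim C > m, this is at least (2m - 2) - (m - 1) = m - 1 ≥ 3.
  -- If dim C ≤ m, then o ≥ m² - m and the gain is at least m² - 2m.
  · have h0 := finrank_le_add_finrank_map_restrict P τ hτ hP s t hs ht (fun β => u β)
      (fun β => hu β) T hTR (fun v hv hv0 => ?_)
    · obtain ⟨a, haS, hans, hest⟩ := exists_mem_stab_estimate (fun β : {β // P β} => s β)
        (fun β => t β) (fun β => u β)
        (T.map (LinearMap.funLeft K (Matrix I I K) (Subtype.val : {β // P β} → Q)))
        (by rintro _ ⟨v, hv, rfl⟩ β; exact hTR v hv β)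
        (by
          rintro _ ⟨v, hv, rfl⟩
          obtain ⟨D, hD⟩ := hT v hv
          exact ⟨D, fun β => hD β⟩) a₀
        (mem_stab.mpr ⟨(mem_stab.mp ha₀).1, fun β => (mem_stab.mp ha₀).2 β⟩) hns
      have haD := (mem_stab.mp haS).1
      obtain ⟨o, oo, h1, h2, h3, -⟩ := hnum a haD hans
      have h5 := Matrix.finrank_centralizer_le a
      have h6 := Matrix.two_mul_card_add_finrank_ker_adL_le a hans
      have h7 := sum_eq_two_mul_sum_subtype P τ hτ hP (fun β => cdim ν a (t β) (s β))
        (fun β => by rw [hs, ht, cdim_comm haD])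
      have h8 := sum_eq_two_mul_sum_subtype P τ hτ hP (fun β => ddim K ν (t β) (s β))
        (fun β => by rw [hs, ht, ddim_comm])
      have h9 : 4 * Fintype.card I ≤ Fintype.card I ^ 2 := by nlinarith
      generalize Fintype.card I ^ 2 = mm at *
      generalize Fintype.card I = m at *
      exact ⟨by omega, fun _ => by omega⟩
    -- Differentiate μ(u) = 0 along D, with v = 0 on the positive arrows. The surviving terms for β
    -- and τβ have opposite signs and combine into commutators indexed by the positive arrows.
    · obtain ⟨D, hD⟩ := hT v hv
      have h1 : (∑ β, (if P β then (1 : K) else -1) • (u β * u (τ β))).map D = 0 := by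
        rw [hμ]; ext p q; simp
      have h2 : ∀ X : Q → Matrix I I K, (∑ β, (if P β then (1 : K) else -1) • X β).map D
          = ∑ β, (if P β then (1 : K) else -1) • (X β).map D := by
        intro X
        ext p q
        simp only [Matrix.map_apply, Matrix.sum_apply, Matrix.smul_apply, smul_eq_mul, map_sum,
          Derivation.leibniz]
        refine Finset.sum_congr rfl fun β _ => ?_
        split_ifs <;> simp
      rw [h2] at h1
      simp only [map_derivation_mul, hD] at h1
      rw [← Fintype.sum_subtype_add_sum_subtype P] at h1
      rw [← h1, ← sub_eq_zero]
      have h3 : ∑ β : {β // ¬ P β}, (if P β then (1 : K) else -1)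
            • (v β * u (τ β) + u β * v (τ β))
          = ∑ β : {β // P β}, -(v (τ β) * u β) := by
        refine Fintype.sum_equiv
          { toFun := fun β => ⟨τ β, (hP β).mpr β.2⟩
            invFun := fun β => ⟨τ β, fun h => (hP β).mp h β.2⟩
            left_inv := fun β => Subtype.ext (hτ β)
            right_inv := fun β => Subtype.ext (hτ β) } _ _ fun β => ?_
        simp only [Equiv.coe_fn_mk]
        rw [if_neg β.2, hτ, hv0 (τ β) ((hP β).mpr β.2), mul_zero, add_zero, neg_smul, one_smul]
      rw [h3, ← Finset.sum_add_distrib, ← Finset.sum_sub_distrib]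
      refine Finset.sum_eq_zero fun β _ => ?_
      rw [if_pos β.2, hv0 β β.2, zero_mul, zero_add, one_smul, adL_apply, sub_eq_add_neg]
      abel

end Bound

end QuiverMoment

end

noncomputable section

namespace QuiverMoment

/-! ### Depth and unmixedness over local rings. -/

section Depth

open IsLocalRing RingTheory.Sequence CategoryTheory Abelian Limits
open scoped Pointwise

universe u

/-- A chain of primes in the quotient pulls back to a chain whose lowest member already has height
at least k. -/
theorem le_height_comap_of_le_height {R S : Type*} [CommRing R] [CommRing S] (f : R →+* S)
    (hf : Function.Surjective f) (k : ℕ)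
    (hk : ∀ (p : Ideal R) [p.IsPrime], RingHom.ker f ≤ p → (k : ℕ∞) ≤ p.height) (n : ℕ) :
    ∀ (P : Ideal S) [P.IsPrime], (n : ℕ∞) ≤ P.height →
      ((n + k : ℕ) : ℕ∞) ≤ (P.comap f).height := by
  induction n with
  | zero =>
    intro P _ _
    rw [zero_add]
    exact hk _ fun x hx => by
      rw [Ideal.mem_comap, RingHom.mem_ker.mp hx]; exact zero_mem _
  | succ n ih =>
    intro P _ hP
    have h1 : ¬ P.height ≤ n := fun h => by
      have := hP.trans h
      norm_cast at this
      omega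
    rw [Ideal.height_le_iff] at h1
    push Not at h1
    obtain ⟨q, hq, hqP, hn⟩ := h1
    have h2 := ih q hn
    have h3 : q.comap f < P.comap f := by
      refine lt_of_le_of_ne (Ideal.comap_mono hqP.le) fun h => hqP.ne ?_
      exact Ideal.comap_injective_of_surjective f hf h
    have h4 := Ideal.height_add_one_le_of_lt_of_isPrime h3
    calc ((n + 1 + k : ℕ) : ℕ∞) = ((n + k : ℕ) : ℕ∞) + 1 := by push_cast; ring
      _ ≤ (q.comap f).height + 1 := by gcongr
      _ ≤ _ := h4

theorem ringKrullDim_add_le_of_surjective {R S : Type*} [CommRing R] [CommRing S] (f : R →+* S)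
    (hf : Function.Surjective f) (k N : ℕ)
    (hk : ∀ (p : Ideal R) [p.IsPrime], RingHom.ker f ≤ p → (k : ℕ∞) ≤ p.height)
    (hN : ringKrullDim R ≤ N) : ringKrullDim S + k ≤ N := by
  have h1 : ∀ (P : Ideal S) [P.IsPrime] (n : ℕ), (n : ℕ∞) ≤ P.height → n + k ≤ N := by
    intro P _ n hn
    have h2 := le_height_comap_of_le_height f hf k hk n P hn
    have h3 := (WithBot.coe_le_coe.mpr h2).trans
      ((Ideal.height_le_ringKrullDim_of_isPrime (I := P.comap f)).trans hN)
    exact_mod_cast h3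
  rcases subsingleton_or_nontrivial S with hS | hS
  · rw [ringKrullDim_eq_bot_of_subsingleton, WithBot.bot_add]
    exact bot_le
  · obtain ⟨P, hP⟩ := Ideal.exists_maximal S
    have hkN : k ≤ N := by
      have := h1 P 0 (by simp)
      omega
    have h2 : ringKrullDim S ≤ ((N - k : ℕ) : WithBot ℕ∞) := by
      rw [ringKrullDim_le_iff_height_le]
      intro I hI
      have h4 : ∀ n : ℕ, (n : ℕ∞) ≤ I.height → n ≤ N - k := fun n hn => by
        have := h1 I n hn
        omega
      have h5 : I.height ≤ ((N - k : ℕ) : ℕ∞) := by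
        by_contra hcon
        have h6 := h4 (N - k + 1) (by
          have := Order.add_one_le_of_lt (not_le.mp hcon)
          exact_mod_cast this)
        omega
      exact WithBot.coe_le_coe.mpr h5
    calc ringKrullDim S + k ≤ ((N - k : ℕ) : WithBot ℕ∞) + k := by gcongr
      _ = ((N - k + k : ℕ) : WithBot ℕ∞) := by push_cast; rfl
      _ = N := by rw [Nat.sub_add_cancel hkN]

variable {R : Type u} [CommRing R] [IsLocalRing R] [IsNoetherianRing R]

/-- Depth is at most dim R/q for each associated prime q. In the induction, the submodule N killed
by q is not inside r M: otherwise N = r N, because r is regular, contradicting Nakayama. So some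
associated prime of M / r M contains both q and r, while r is not in q. -/
theorem length_le_ringKrullDim_quotient (rs : List R) : ∀ (M : Type u) [AddCommGroup M] [Module R M]
    [Module.Finite R M] (_ : ∀ r ∈ rs, r ∈ maximalIdeal R) (_ : IsWeaklyRegular M rs) (q : Ideal R)
    (_ : q ∈ associatedPrimes R M), (rs.length : WithBot ℕ∞) ≤ ringKrullDim (R ⧸ q) := by
  induction rs with
  | nil =>
    intro M _ _ _ _ _ q hq
    have := hq.isPrime
    have : Nontrivial (R ⧸ q) := Ideal.Quotient.nontrivial_iff.mpr hq.isPrime.ne_top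
    simpa using ringKrullDim_nonneg_of_nontrivial (R := R ⧸ q)
  | cons r rs ih =>
    intro M _ _ _ mem reg q hq
    rw [isWeaklyRegular_cons_iff] at reg
    have hqp := hq.isPrime
    have hrm : r ∈ maximalIdeal R := mem r List.mem_cons_self
    obtain ⟨-, x, hx⟩ := isAssociatedPrime_iff.mp hq
    have hxq : ∀ a, a ∈ q ↔ a • x = 0 := fun a => by
      rw [hx, Submodule.mem_colon_singleton, Submodule.mem_bot]
    have hrq : r ∉ q := fun h => by
      have hx0 : x = 0 := reg.1 (((hxq r).mp h).trans (smul_zero r).symm)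
      exact hqp.ne_top (Ideal.eq_top_iff_one _ |>.mpr ((hxq 1).mpr (by rw [hx0, smul_zero])))
    let N : Submodule R M :=
      { carrier := {y | ∀ a ∈ q, a • y = 0}
        add_mem' := fun hy hz a ha => by rw [smul_add, hy a ha, hz a ha, add_zero]
        zero_mem' := fun a _ => smul_zero a
        smul_mem' := fun c y hy a ha => by rw [smul_comm, hy a ha, smul_zero] }
    have hN : ¬ N ≤ r • (⊤ : Submodule R M) := fun hle => by
      have h1 : N ≤ (Ideal.span {r}) • N := fun y hy => by
        obtain ⟨z, -, rfl⟩ := (Submodule.mem_smul_pointwise_iff_exists _ _ _).mp (hle hy)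
        refine Submodule.smul_mem_smul (Ideal.mem_span_singleton_self r) fun a ha => reg.1 ?_
        change r • a • z = r • 0
        rw [smul_comm, smul_zero]
        exact hy a ha
      have h2 := Submodule.eq_bot_of_le_smul_of_le_jacobson_bot _ N (IsNoetherian.noetherian N) h1
        (((Ideal.span_singleton_le_iff_mem _).mpr hrm).trans (maximalIdeal_le_jacobson _))
      have hxN : x ∈ N := fun a ha => (hxq a).mp ha
      rw [h2, Submodule.mem_bot] at hxN
      exact hqp.ne_top (Ideal.eq_top_iff_one _ |>.mpr ((hxq 1).mpr (by rw [hxN, smul_zero])))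
    obtain ⟨y, hy, hyr⟩ := SetLike.not_le_iff_exists.mp hN
    obtain ⟨P, hP, hPle⟩ := exists_le_isAssociatedPrime_of_isNoetherianRing R
      (Submodule.Quotient.mk y : QuotSMulTop r M)
      (fun h => hyr ((Submodule.Quotient.mk_eq_zero _).mp h))
    have hPp := hP.isPrime
    have h3 := ih (QuotSMulTop r M) (fun s hs => mem s (List.mem_cons_of_mem _ hs)) reg.2 P hP
    have hqP : q ≤ P := fun a ha => hPle <| by
      rw [Submodule.mem_colon_singleton, Submodule.mem_bot, ← Submodule.Quotient.mk_smul, hy a ha,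
        Submodule.Quotient.mk_zero]
    have hrP : r ∈ P := hPle <| by
      rw [Submodule.mem_colon_singleton, Submodule.mem_bot, ← Submodule.Quotient.mk_smul,
        Submodule.Quotient.mk_eq_zero]
      exact Submodule.smul_mem_pointwise_smul _ _ _ trivial
    have h4 := ringKrullDim_succ_le_of_surjective (Ideal.Quotient.factor hqP)
      (Ideal.Quotient.factor_surjective hqP) (r := Ideal.Quotient.mk q r)
      (mem_nonZeroDivisors_of_ne_zero fun h => hrq (Ideal.Quotient.eq_zero_iff_mem.mp h))
      (by rw [Ideal.Quotient.factor_mk]; exact Ideal.Quotient.eq_zero_iff_mem.mpr hrP)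
    refine le_trans ?_ h4
    rw [List.length_cons]
    push_cast
    gcongr

theorem add_le_of_add_add_one_le (a : WithBot ℕ∞) (m n : ℕ)
    (h : a + m + 1 ≤ (n : WithBot ℕ∞) + 1) : a + m ≤ n := by
  induction a with
  | bot => rw [WithBot.bot_add]; exact bot_le
  | coe a =>
    induction a with
    | top =>
      have h1 : (⊤ : ℕ∞) ≤ ((n + 1 : ℕ) : ℕ∞) :=
        WithBot.coe_le_coe.mp (le_trans (le_of_eq rfl) h)
      exact absurd h1 (not_le.mpr (ENat.natCast_lt_top _))
    | coe a =>
      norm_cast at h ⊢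
      omega

/-- The given sequence need not begin with g, so depth is read off from the vanishing of Ext(R/m,
-). The long exact sequence of multiplication by g lowers the vanishing range by one. -/
theorem exists_isRegular_quotSMulTop (n : ℕ) (M : Type u) [AddCommGroup M] [Module R M]
    [Module.Finite R M] [Nontrivial M] (g : R) (hg : g ∈ maximalIdeal R) (hgM : IsSMulRegular M g)
    (h : ∃ rs : List R, rs.length = n + 1 ∧ (∀ r ∈ rs, r ∈ maximalIdeal R) ∧ IsRegular M rs) :
    ∃ rs : List R, rs.length = n ∧ (∀ r ∈ rs, r ∈ maximalIdeal R) ∧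
      IsRegular (QuotSMulTop g M) rs := by
  have hlt : ∀ (L : Type u) [AddCommGroup L] [Module R L] [Module.Finite R L] [Nontrivial L],
      maximalIdeal R • (⊤ : Submodule R L) < ⊤ := fun L _ _ _ _ =>
    (Ne.symm (Submodule.top_ne_ideal_smul_of_le_jacobson_annihilator
      (maximalIdeal_le_jacobson _))).lt_top
  have := nontrivial_quotSMulTop_of_mem_maximalIdeal M hg
  have hsupp : Module.support R (ModuleCat.of R (R ⧸ maximalIdeal R))
      = PrimeSpectrum.zeroLocus (maximalIdeal R) := by
    rw [Module.support_eq_zeroLocus, Ideal.annihilator_quotient]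
  obtain ⟨rs, hlen, hmem, hreg⟩ := h
  have h1 := ModuleCat.subsingleton_ext_of_exists_isRegular (maximalIdeal R)
    (ModuleCat.of R (R ⧸ maximalIdeal R)) hsupp.subset (ModuleCat.of R M) (hlt M) rs hmem hreg
  rw [hlen] at h1
  have hgM' : IsSMulRegular (ModuleCat.of R M) g := hgM
  refine ModuleCat.exists_isRegular_of_exists_subsingleton_ext (maximalIdeal R) n
    (ModuleCat.of R (QuotSMulTop g M)) (hlt _) (ModuleCat.of R (R ⧸ maximalIdeal R)) hsupp
    fun i hi => ?_
  have zero1 := AddCommGrpCat.isZero_of_iff_subsingleton.mpr (h1 i (by omega))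
  have zero2 := AddCommGrpCat.isZero_of_iff_subsingleton.mpr (h1 (i + 1) (by omega))
  exact AddCommGrpCat.subsingleton_of_isZero <| ShortComplex.Exact.isZero_of_both_zeros
    ((Ext.covariant_sequence_exact₃' _ hgM'.smulShortComplex_shortExact) i (i + 1) rfl)
    (zero1.eq_zero_of_src _) (zero2.eq_zero_of_tgt _)

/-- A quotient of a Cohen-Macaulay module by as many elements as the dimension drops has no
embedded maximal ideal. -/
theorem le_length_of_socle_ne_bot (gs : List R) : ∀ (n : ℕ) (M : Type u) [AddCommGroup M]
    [Module R M] [Module.Finite R M] [Nontrivial M] (_ : ∀ g ∈ gs, g ∈ maximalIdeal R)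
    (_ : ∃ rs : List R, rs.length = n ∧ (∀ r ∈ rs, r ∈ maximalIdeal R) ∧ IsRegular M rs)
    (_ : ringKrullDim (R ⧸ (Module.annihilator R M ⊔ Ideal.ofList gs)) + gs.length ≤ n)
    (x : M) (_ : x ∉ (Ideal.ofList gs • ⊤ : Submodule R M))
    (_ : ∀ r ∈ maximalIdeal R, r • x ∈ (Ideal.ofList gs • ⊤ : Submodule R M)),
    n ≤ gs.length := by
  induction gs with
  | nil =>
    rintro n M _ _ _ _ - ⟨rs, rfl, hrm, hreg⟩ - x hx hx'
    rw [Ideal.ofList_nil, Submodule.bot_smul] at hx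
    simp only [Ideal.ofList_nil, Submodule.bot_smul, Submodule.mem_bot] at hx hx'
    cases rs with
    | nil => rfl
    | cons r rs =>
      have h1 := ((isRegular_cons_iff M r rs).mp hreg).1
      exact absurd (h1 ((hx' r (hrm r List.mem_cons_self)).trans (smul_zero r).symm)) hx
  | cons g gs ih =>
    intro n M _ _ _ _ hgm hrs hdim x hx hx'
    have hg := hgm g List.mem_cons_self
    have hgs : ∀ s ∈ gs, s ∈ maximalIdeal R := fun s hs => hgm s (List.mem_cons_of_mem _ hs)
    have hn : 1 ≤ n := by
      have hne : Module.annihilator R M ⊔ Ideal.ofList (g :: gs) ≠ ⊤ := by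
        refine ((sup_le (le_maximalIdeal ?_) (Ideal.span_le.mpr hgm)).trans_lt
          (maximalIdeal.isMaximal R).ne_top.lt_top).ne
        rw [Ne, Module.annihilator_eq_top_iff]
        exact not_subsingleton M
      have := Ideal.Quotient.nontrivial_iff.mpr hne
      have h0 := ringKrullDim_nonneg_of_nontrivial
        (R := R ⧸ (Module.annihilator R M ⊔ Ideal.ofList (g :: gs)))
      have h1 : (((g :: gs).length : ℕ) : WithBot ℕ∞) ≤ n :=
        le_trans (by simpa using add_le_add_left h0 ((g :: gs).length : WithBot ℕ∞)) hdim
      have h2 : (g :: gs).length ≤ n := by exact_mod_cast h1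
      rw [List.length_cons] at h2
      omega
    obtain ⟨n, rfl⟩ := Nat.exists_eq_add_of_le' hn
    have hdim' : ∀ (S : Type u) [CommRing S] (f : R →+* S), Function.Surjective f →
        Module.annihilator R M ≤ RingHom.ker f → f g = 0 → (∀ s ∈ gs, f s = 0) →
        ringKrullDim S + gs.length ≤ n := by
      intro S _ f hf h1 h2 h3
      have h4 : Module.annihilator R M ⊔ Ideal.ofList (g :: gs) ≤ RingHom.ker f := by
        refine sup_le h1 (Ideal.span_le.mpr fun s hs => ?_)
        rcases List.mem_cons.mp hs with rfl | hs
        · exact h2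
        · exact h3 s hs
      have h5 := ringKrullDim_le_of_surjective (Ideal.Quotient.lift _ f h4)
        (Ideal.Quotient.lift_surjective_of_surjective _ h4 hf)
      have h6 : ringKrullDim S + gs.length + 1 ≤ (n : WithBot ℕ∞) + 1 := by
        refine le_trans ?_ hdim
        rw [List.length_cons]
        push_cast
        rw [← add_assoc]
        gcongr
      exact add_le_of_add_add_one_le _ _ _ h6
    -- Otherwise g lies in an associated prime q, and dim R/q ≥ n + 1 by depth. But g is already
    -- zero in R/q and the remaining elements lower the dimension by at most their number, so the
    -- hypothesis on dimensions gives dim R/q ≤ n.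
    have hreg : IsSMulRegular M g := by
      by_contra hcon
      have h1 : g ∈ ⋃ p ∈ associatedPrimes R M, (p : Set R) := by
        rw [biUnion_associatedPrimes_eq_compl_regular]
        exact hcon
      simp only [Set.mem_iUnion] at h1
      obtain ⟨q, hq, hgq⟩ := h1
      have hqp := hq.isPrime
      obtain ⟨rs, hlen, hrm, hrs⟩ := hrs
      have h2 := length_le_ringKrullDim_quotient rs M hrm hrs.1 q hq
      let s : Set (R ⧸ q) := Ideal.Quotient.mk q '' {r | r ∈ gs}
      have : Nontrivial (R ⧸ q) := Ideal.Quotient.nontrivial_iff.mpr hqp.ne_top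
      have hloc : IsLocalRing (R ⧸ q) :=
        IsLocalRing.of_surjective' (R := R) (S := R ⧸ q) (Ideal.Quotient.mk q) Ideal.Quotient.mk_surjective
      have h3 : ringKrullDim (R ⧸ q) ≤ ringKrullDim ((R ⧸ q) ⧸ Ideal.span s) + s.encard := by
        refine ringKrullDim_le_ringKrullDim_quotient_add_encard s ?_
        rintro _ ⟨r, hr, rfl⟩
        rw [IsLocalRing.ringJacobson_eq_maximalIdeal]
        have hloc' := IsLocalHom.of_surjective (Ideal.Quotient.mk q) Ideal.Quotient.mk_surjective
        exact fun hu => hgs r hr (isUnit_of_map_unit (Ideal.Quotient.mk q) r hu)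
      have h4 : (s.encard : WithBot ℕ∞) ≤ gs.length := by
        have h5 : s.encard ≤ gs.length := by
          classical
          refine (Set.encard_image_le _ _).trans ?_
          have : {r | r ∈ gs} = (gs.toFinset : Set R) := by ext; simp
          rw [this, Set.encard_coe_eq_coe_finsetCard]
          exact_mod_cast gs.toFinset_card_le
        exact_mod_cast h5
      have h5 := hdim' ((R ⧸ q) ⧸ Ideal.span s)
        ((Ideal.Quotient.mk _).comp (Ideal.Quotient.mk q))
        (Ideal.Quotient.mk_surjective.comp Ideal.Quotient.mk_surjective)
        (fun a ha => by
          rw [RingHom.mem_ker, RingHom.comp_apply,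
            Ideal.Quotient.eq_zero_iff_mem.mpr (hq.annihilator_le (by rwa [Submodule.annihilator_top])), map_zero])
        (by rw [RingHom.comp_apply, Ideal.Quotient.eq_zero_iff_mem.mpr hgq, map_zero])
        (fun r hr => by
          rw [RingHom.comp_apply, Ideal.Quotient.eq_zero_iff_mem]
          exact Ideal.subset_span ⟨r, hr, rfl⟩)
      have h6 : ((n + 1 : ℕ) : WithBot ℕ∞) ≤ n := by
        rw [← hlen]
        exact h2.trans (h3.trans (le_trans (by gcongr) h5))
      have : n + 1 ≤ n := by exact_mod_cast h6
      omega
    have := nontrivial_quotSMulTop_of_mem_maximalIdeal M hg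
    let e := Submodule.quotOfListConsSMulTopEquivQuotSMulTopInner M g gs
    have hmem : ∀ y : M, y ∈ (Ideal.ofList (g :: gs) • ⊤ : Submodule R M) ↔
        (Submodule.Quotient.mk y : QuotSMulTop g M)
          ∈ (Ideal.ofList gs • ⊤ : Submodule R (QuotSMulTop g M)) := fun y => by
      rw [← Submodule.Quotient.mk_eq_zero, ← Submodule.Quotient.mk_eq_zero (Ideal.ofList gs • ⊤),
        ← e.map_eq_zero_iff]
      rfl
    have h1 := ih n (QuotSMulTop g M) hgs (exists_isRegular_quotSMulTop n M g hg hreg hrs)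
      (hdim' _ (Ideal.Quotient.mk _) Ideal.Quotient.mk_surjective
        (by
          rw [Ideal.mk_ker]
          refine le_sup_of_le_left fun a ha => Module.mem_annihilator.mpr fun y => ?_
          obtain ⟨y, rfl⟩ := Submodule.Quotient.mk_surjective _ y
          rw [← Submodule.Quotient.mk_smul, Module.mem_annihilator.mp ha,
            Submodule.Quotient.mk_zero])
        (by
          rw [Ideal.Quotient.eq_zero_iff_mem]
          refine Ideal.mem_sup_left (Module.mem_annihilator.mpr fun y => ?_)
          obtain ⟨y, rfl⟩ := Submodule.Quotient.mk_surjective _ y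
          rw [← Submodule.Quotient.mk_smul, Submodule.Quotient.mk_eq_zero]
          exact Submodule.smul_mem_pointwise_smul _ _ _ trivial)
        (fun s hs => Ideal.Quotient.eq_zero_iff_mem.mpr
          (Ideal.mem_sup_right (Ideal.subset_span hs))))
      (Submodule.Quotient.mk x) (fun h => hx ((hmem x).mpr h))
      (fun r hr => by
        rw [← Submodule.Quotient.mk_smul]
        exact (hmem _).mp (hx' r hr))
    rw [List.length_cons]
    omega

end Depth

end QuiverMoment

end

noncomputable section

namespace QuiverMoment

/-! ### Regular local rings: quotients, integrality, Cohen-Macaulayness. -/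

section Regular

open IsLocalRing RingTheory.Sequence
open scoped Pointwise

universe u

theorem exists_span_range_union_eq_top {k W Γ : Type*} [Field k] [AddCommGroup W] [Module k W]
    [FiniteDimensional k W] [Fintype Γ] (x : Γ → W) (hx : LinearIndependent k x) :
    ∃ (n : ℕ) (y : Fin n → W), n + Fintype.card Γ = Module.finrank k W ∧
      Submodule.span k (Set.range x ∪ Set.range y) = ⊤ := by
  set X := Submodule.span k (Set.range x) with hX
  let b := Module.finBasis k (W ⧸ X)
  choose y hy using fun i => X.mkQ_surjective (b i)
  refine ⟨_, y, ?_, ?_⟩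
  · rw [← finrank_span_eq_card hx]
    exact Submodule.finrank_quotient_add_finrank X
  · rw [Submodule.span_union, eq_top_iff]
    intro w _
    have h1 : X.mkQ (w - ∑ i, b.repr (X.mkQ w) i • y i) = 0 := by
      rw [map_sub, map_sum]
      simp only [map_smul, hy, b.sum_repr, sub_self]
    have h2 : w = (w - ∑ i, b.repr (X.mkQ w) i • y i) + ∑ i, b.repr (X.mkQ w) i • y i := by abel
    rw [h2]
    refine add_mem (Submodule.mem_sup_left ?_) (Submodule.mem_sup_right ?_)
    · rwa [← LinearMap.mem_ker, Submodule.ker_mkQ] at h1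
    · exact sum_mem fun i _ => Submodule.smul_mem _ _ (Submodule.subset_span ⟨i, rfl⟩)

/-- The hypothesis on `x` says that its classes in the cotangent space are independent. Complete
them to a basis: the added elements generate the maximal ideal of S, and S cannot have smaller
dimension because each x_γ lowers dimension by at most one. -/
theorem IsRegularLocalRing.of_surjective {R S Γ : Type*} [CommRing R] [CommRing S] [Nontrivial S]
    [IsRegularLocalRing R] [Fintype Γ] (h : ℕ) (hR : ringKrullDim R = h) (x : Γ → R)
    (hxm : ∀ γ, x γ ∈ maximalIdeal R)
    (hx : ∀ l : Γ → R, ∑ γ, l γ * x γ ∈ maximalIdeal R ^ 2 → ∀ γ, l γ ∈ maximalIdeal R)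
    (f : R →+* S) (hf : Function.Surjective f) (hker : RingHom.ker f = Ideal.span (Set.range x)) :
    IsRegularLocalRing S ∧ ∃ d : ℕ, ringKrullDim S = d ∧ d + Fintype.card Γ = h := by
  classical
  have hloc : IsLocalRing S := IsLocalRing.of_surjective' f hf
  have hnoeth : IsNoetherianRing S := isNoetherianRing_of_surjective R S f hf
  have hlocf : IsLocalHom f := IsLocalHom.of_surjective f hf
  let xm : Γ → maximalIdeal R := fun γ => ⟨x γ, hxm γ⟩
  have hlin : LinearIndependent (ResidueField R)
      fun γ => (maximalIdeal R).toCotangent (xm γ) := by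
    rw [Fintype.linearIndependent_iff]
    intro l hl γ
    choose l' hl' using fun γ => residue_surjective (l γ)
    have h1 : (maximalIdeal R).toCotangent (∑ γ, l' γ • xm γ) = 0 := by
      rw [map_sum, ← hl]
      refine Finset.sum_congr rfl fun γ _ => ?_
      rw [map_smul, ← hl' γ]
      rfl
    rw [Ideal.toCotangent_eq_zero] at h1
    rw [← hl' γ, residue_eq_zero_iff]
    refine hx l' ?_ γ
    convert h1
    simp [xm]
  obtain ⟨n, y, hn, hspan⟩ := exists_span_range_union_eq_top _ hlin
  choose y' hy' using fun i => (maximalIdeal R).toCotangent_surjective (y i)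
  have hcot : Module.finrank (ResidueField R) (CotangentSpace R) = h := by
    have := (IsRegularLocalRing.iff_finrank_cotangentSpace R).mp inferInstance
    rw [hR] at this
    exact_mod_cast this
  rw [hcot] at hn
  have hm : Ideal.span (Set.range x ∪ Set.range fun i => (y' i : R)) = maximalIdeal R := by
    have h1 : Submodule.span R (Set.range xm ∪ Set.range y') = ⊤ := by
      rw [← CotangentSpace.span_image_eq_top_iff, Set.image_union, ← Set.range_comp,
        ← Set.range_comp]
      have : (maximalIdeal R).toCotangent ∘ y' = y := funext hy'
      rw [this]
      exact hspan
    have h2 := congrArg (Submodule.map (maximalIdeal R).subtype) h1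
    rw [Submodule.map_span, Submodule.map_subtype_top, Set.image_union, ← Set.range_comp,
      ← Set.range_comp] at h2
    exact h2
  have hmS : maximalIdeal S = Ideal.span (Set.range fun i => f (y' i)) := by
    have h1 : (maximalIdeal R).map f = maximalIdeal S := by
      refine le_antisymm (Ideal.map_le_iff_le_comap.mpr fun r hr hu => ?_) fun s hs => ?_
      · exact hr (isUnit_of_map_unit f r hu)
      · obtain ⟨r, rfl⟩ := hf s
        exact Ideal.mem_map_of_mem _ fun hu => hs (hu.map f)
    have h2 := congrArg (Ideal.map f) hm
    rw [Ideal.map_span, Set.image_union, Ideal.span_union, ← Set.range_comp, ← Set.range_comp] at h2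
    rw [← h1, ← h2]
    refine sup_eq_right.mpr (Ideal.span_le.mpr ?_)
    rintro _ ⟨γ, rfl⟩
    have : x γ ∈ RingHom.ker f := hker ▸ Ideal.subset_span ⟨γ, rfl⟩
    rw [Function.comp_apply, RingHom.mem_ker.mp this]
    exact zero_mem _
  have hle : (maximalIdeal S).spanFinrank ≤ n := by
    rw [hmS]
    refine (Submodule.spanFinrank_span_le_ncard_of_finite (Set.finite_range _)).trans ?_
    rw [← Set.image_univ]
    refine (Set.ncard_image_le Set.finite_univ).trans ?_
    rw [Set.ncard_univ, Nat.card_eq_fintype_card, Fintype.card_fin]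
  have hdim : (n : WithBot ℕ∞) ≤ ringKrullDim S := by
    have h1 := ringKrullDim_le_ringKrullDim_quotient_add_encard (Set.range x) (by
      rintro _ ⟨γ, rfl⟩
      rw [IsLocalRing.ringJacobson_eq_maximalIdeal]
      exact hxm γ)
    have h2 : ((Set.range x).encard : WithBot ℕ∞) ≤ (Fintype.card Γ : ℕ) := by
      have h3 : (Set.range x).encard ≤ (Fintype.card Γ : ℕ) := by
        rw [← Set.image_univ]
        refine (Set.encard_image_le _ _).trans ?_
        rw [Set.encard_univ, ENat.card_eq_coe_fintype_card]
      exact WithBot.coe_le_coe.mpr h3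
    rw [← hker, ringKrullDim_eq_of_ringEquiv (RingHom.quotientKerEquivOfSurjective hf), hR,
      ← hn] at h1
    have h4 : ((n + Fintype.card Γ : ℕ) : WithBot ℕ∞) ≤ ringKrullDim S + (Fintype.card Γ : ℕ) :=
      h1.trans (by gcongr)
    generalize ringKrullDim S = a at h4
    generalize Fintype.card Γ = c at h4
    induction a with
    | bot => rw [WithBot.bot_add, le_bot_iff] at h4; exact absurd h4 (WithBot.coe_ne_bot)
    | coe a =>
      induction a with
      | top => exact WithBot.coe_le_coe.mpr le_top
      | coe a => norm_cast at h4 ⊢; omega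
  have hreg : IsRegularLocalRing S := IsRegularLocalRing.of_spanFinrank_maximalIdeal_le S
    (le_trans (by exact_mod_cast hle) hdim)
  refine ⟨hreg, n, le_antisymm ?_ hdim, hn⟩
  rw [← (isRegularLocalRing_iff S).mp hreg]
  exact_mod_cast hle

/-- Induction on the dimension, dividing by x in m but outside m² and all minimal primes. The
quotient is regular, hence a domain by induction, so (x) is prime. A minimal prime q inside (x) does
not contain x, so q = x q and q = 0 by Nakayama. -/
theorem IsRegularLocalRing.isDomain_and_exists_isRegular (d : ℕ) : ∀ (R : Type u) [CommRing R]
    [IsRegularLocalRing R], ringKrullDim R = d →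
    IsDomain R ∧ ∃ rs : List R, rs.length = d ∧ (∀ r ∈ rs, r ∈ maximalIdeal R) ∧ IsRegular R rs := by
  induction d with
  | zero =>
    intro R _ _ hR
    have h1 : (maximalIdeal R).spanFinrank = 0 := by
      have := (isRegularLocalRing_iff R).mp inferInstance
      rw [hR] at this
      exact_mod_cast this
    have h2 : maximalIdeal R = ⊥ :=
      (Submodule.spanFinrank_eq_zero_iff_eq_bot (IsNoetherian.noetherian _)).mp h1
    exact ⟨((isField_iff_maximalIdeal_eq).mpr h2).isDomain, [], rfl, by simp, .nil R R⟩
  | succ d ih =>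
    intro R _ _ hR
    have hne : maximalIdeal R ∉ minimalPrimes R := fun hmin => by
      have h1 := Ideal.height_eq_zero_iff.mpr hmin
      have h2 := maximalIdeal_height_eq_ringKrullDim (R := R)
      rw [h1, hR] at h2
      have h3 : ((0 : ℕ) : WithBot ℕ∞) = ((d + 1 : ℕ) : WithBot ℕ∞) := h2
      norm_cast at h3
    obtain ⟨x, hxm, hx2, hxmin⟩ : ∃ x ∈ maximalIdeal R, x ∉ maximalIdeal R ^ 2 ∧
        ∀ q ∈ minimalPrimes R, x ∉ q := by
      by_contra hcon
      push Not at hcon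
      have h1 : (maximalIdeal R : Set R) ⊆ ⋃ q ∈ insert (maximalIdeal R ^ 2) (minimalPrimes R),
          ((id q : Ideal R) : Set R) := by
        intro x hx
        by_cases hx2 : x ∈ maximalIdeal R ^ 2
        · exact Set.mem_biUnion (Set.mem_insert _ _) hx2
        · obtain ⟨q, hq, hxq⟩ := hcon x hx hx2
          exact Set.mem_biUnion (Set.mem_insert_of_mem _ hq) hxq
      -- Prime avoidance tolerates an exceptional non-prime member, here m².
      obtain ⟨q, hq, hle⟩ := (Ideal.subset_union_prime_finite
        ((minimalPrimes.finite_of_isNoetherianRing R).insert _) (f := id) (maximalIdeal R ^ 2)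
        (maximalIdeal R ^ 2) (fun q hq hq1 _ =>
          ((Set.mem_insert_iff.mp hq).resolve_left hq1).1.1)).mp h1
      rcases Set.mem_insert_iff.mp hq with rfl | hq
      · have h2 : maximalIdeal R ≤ maximalIdeal R • maximalIdeal R := by
          rw [smul_eq_mul, ← sq]; exact hle
        have h3 := Submodule.eq_bot_of_le_smul_of_le_jacobson_bot _ _ (IsNoetherian.noetherian _) h2
          (maximalIdeal_le_jacobson _)
        refine hne ⟨⟨inferInstance, bot_le⟩, fun J hJ _ => ?_⟩
        rw [h3]
        exact bot_le
      · have := hq.1.1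
        exact hne (((maximalIdeal.isMaximal R).eq_of_le this.ne_top hle) ▸ hq)
    let S := R ⧸ Ideal.span {x}
    have hxtop : Ideal.span {x} ≠ ⊤ := fun h =>
      (maximalIdeal.isMaximal R).ne_top (eq_top_iff.mpr
        (h ▸ (Ideal.span_singleton_le_iff_mem _).mpr hxm))
    have : Nontrivial S := Ideal.Quotient.nontrivial_iff.mpr hxtop
    obtain ⟨hS, d', hd', hdd⟩ := IsRegularLocalRing.of_surjective (S := S) (d + 1) hR
      (fun _ : Unit => x) (fun _ => hxm) (fun l hl _ => by
        by_contra hu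
        rw [mem_maximalIdeal, mem_nonunits_iff, not_not] at hu
        simp only [Finset.univ_unique, Finset.sum_singleton] at hl
        obtain ⟨v, hv⟩ := hu
        refine hx2 ?_
        have h1 := Ideal.mul_mem_left _ (↑v⁻¹ : R) hl
        rw [← mul_assoc] at h1
        change (↑v⁻¹ * l ()) * x ∈ _ at h1
        rw [← hv, Units.inv_mul, one_mul] at h1
        exact h1)
      (Ideal.Quotient.mk _) Ideal.Quotient.mk_surjective
      (by rw [Ideal.mk_ker, Set.range_const])
    have hd'' : d' = d := by simpa using hdd
    subst hd''
    obtain ⟨hdom, rs, hlen, hrm, hrs⟩ := ih S hd'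
    have hprime : (Ideal.span {x}).IsPrime := (Ideal.Quotient.isDomain_iff_prime _).mp hdom
    obtain ⟨q, hq, hqle⟩ := Ideal.exists_minimalPrimes_le (I := ⊥) (J := Ideal.span {x}) bot_le
    have hqp := hq.1.1
    have hq0 : q = ⊥ := by
      refine Submodule.eq_bot_of_le_smul_of_le_jacobson_bot (Ideal.span {x}) q
        (IsNoetherian.noetherian _) (fun y hy => ?_)
        (((Ideal.span_singleton_le_iff_mem _).mpr hxm).trans (maximalIdeal_le_jacobson _))
      obtain ⟨a, rfl⟩ := Ideal.mem_span_singleton'.mp (hqle hy)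
      rw [mul_comm, smul_eq_mul]
      exact Ideal.mul_mem_mul (Ideal.mem_span_singleton_self x)
        ((hqp.mem_or_mem hy).resolve_right (hxmin q hq))
    rw [hq0] at hqp
    have hdomR : IsDomain R := IsDomain.of_bot_isPrime R
    refine ⟨hdomR, ?_⟩
    have hx0 : x ≠ 0 := fun h => hx2 (h ▸ zero_mem _)
    have hlocmk : IsLocalHom (Ideal.Quotient.mk (Ideal.span {x})) :=
      IsLocalHom.of_surjective _ Ideal.Quotient.mk_surjective
    obtain ⟨rs', rfl⟩ : ∃ rs' : List R, rs'.map (algebraMap R S) = rs := by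
      obtain ⟨g, hg⟩ := Ideal.Quotient.mk_surjective (I := Ideal.span {x}).hasRightInverse
      exact ⟨rs.map g, by
        rw [List.map_map]
        exact (List.map_congr_left fun r _ => hg r).trans (List.map_id rs)⟩
    have hmem : ∀ r ∈ x :: rs', r ∈ maximalIdeal R := by
      intro r hr
      rcases List.mem_cons.mp hr with rfl | hr
      · exact hxm
      · exact fun hu => hrm _ (List.mem_map_of_mem hr) (hu.map _)
    refine ⟨x :: rs', by rw [List.length_cons, ← hlen, List.length_map], hmem,
      IsRegular.of_isWeaklyRegular_of_mem_maximalIdeal R hmem ?_⟩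
    refine IsWeaklyRegular.cons (fun a b hab => mul_left_cancel₀ hx0 hab) ?_
    have h1 := (isWeaklyRegular_map_algebraMap_iff (S := S) (M := S) rs').mp hrs.1
    have h2 : x • (⊤ : Submodule R R) = Ideal.span {x} := by
      rw [← Submodule.ideal_span_singleton_smul, smul_eq_mul, Ideal.mul_top]
    exact ((Submodule.quotEquivOfEq _ _ h2).isWeaklyRegular_congr rs').mpr h1

/-- Unmixedness in regular rings. -/
theorem height_le_length_of_annihilator_eq {A : Type u} [CommRing A] [IsRegularRing A] (gs : List A)
    (hgs : ∀ (q : Ideal A) [q.IsPrime], Ideal.ofList gs ≤ q → (gs.length : ℕ∞) ≤ q.height)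
    (p : Ideal A) [p.IsPrime] (x : A) (hx : ∀ a, a * x ∈ Ideal.ofList gs ↔ a ∈ p) :
    p.height ≤ gs.length := by
  obtain ⟨h, hh⟩ := ENat.ne_top_iff_exists.mp (Ideal.height_ne_top_of_isPrime (I := p))
  have hle : Ideal.ofList gs ≤ p := fun a ha => (hx a).mp (Ideal.mul_mem_right _ _ ha)
  let R := Localization.AtPrime p
  have hR : ringKrullDim R = h := by
    rw [IsLocalization.AtPrime.ringKrullDim_eq_height p R, ← hh]
    rfl
  obtain ⟨-, hrs⟩ := IsRegularLocalRing.isDomain_and_exists_isRegular h R hR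
  have hmap : (Ideal.ofList gs).map (algebraMap A R) = Ideal.ofList (gs.map (algebraMap A R)) :=
    Ideal.map_ofList _ _
  have htop : (Ideal.ofList (gs.map (algebraMap A R)) • ⊤ : Submodule R R)
      = (Ideal.ofList gs).map (algebraMap A R) := by
    rw [hmap, smul_eq_mul, Ideal.mul_top]
  have hpm : p.map (algebraMap A R) = maximalIdeal R := Localization.AtPrime.map_eq_maximalIdeal
  -- Localize at p. The local ring is Cohen-Macaulay of dimension `h`, the height hypothesis bounds
  -- the dimension of its quotient, and x becomes a socle element modulo `gs`.
  have h1 := le_length_of_socle_ne_bot (gs.map (algebraMap A R)) h R ?_ hrs ?_ (algebraMap A R x)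
    ?_ ?_
  · rw [← hh]
    rw [List.length_map] at h1
    exact_mod_cast h1
  · intro g hg
    obtain ⟨g, hg', rfl⟩ := List.mem_map.mp hg
    rw [← hpm]
    exact Ideal.mem_map_of_mem _ (hle (Ideal.subset_span hg'))
  · refine ringKrullDim_add_le_of_surjective (Ideal.Quotient.mk _) Ideal.Quotient.mk_surjective _ _
      (fun q _ hq => ?_) hR.le
    rw [Ideal.mk_ker] at hq
    rw [List.length_map, ← IsLocalization.height_under p.primeCompl q]
    refine hgs _ (Ideal.map_le_iff_le_comap.mp ?_)
    rw [hmap]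
    exact le_sup_right.trans hq
  · rw [htop, IsLocalization.algebraMap_mem_map_algebraMap_iff p.primeCompl]
    rintro ⟨a, ha, hax⟩
    exact ha ((hx a).mp hax)
  · intro r hr
    rw [← hpm] at hr
    rw [htop, smul_eq_mul]
    have h2 : p.map (algebraMap A R) ≤
        Submodule.comap (LinearMap.mulRight R (algebraMap A R x))
          ((Ideal.ofList gs).map (algebraMap A R)) := by
      refine Ideal.map_le_iff_le_comap.mpr fun a ha => ?_
      change algebraMap A R a * algebraMap A R x ∈ (Ideal.ofList gs).map (algebraMap A R)
      rw [← map_mul]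
      exact Ideal.mem_map_of_mem _ ((hx a).mpr ha)
    exact h2 hr

end Regular

end QuiverMoment

end

noncomputable section

namespace QuiverMoment

/-! ### Tangent spaces and the Jacobian matrix at a prime. -/

section Jacobian

open IsLocalRing MvPolynomial

variable {k σ : Type*} [Field k] [Fintype σ]

/-- The derivative of a polynomial in the direction `v`, evaluated by means of `φ`. -/
def dirDeriv {K : Type*} [CommRing K] (φ : MvPolynomial σ k →+* K) (v : σ → K)
    (g : MvPolynomial σ k) : K := ∑ s, φ (pderiv s g) * v s

variable {K : Type*} [Field K] (φ : MvPolynomial σ k →+* K)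

theorem dirDeriv_add (v : σ → K) (g h : MvPolynomial σ k) :
    dirDeriv φ v (g + h) = dirDeriv φ v g + dirDeriv φ v h := by
  simp only [dirDeriv, map_add, add_mul, Finset.sum_add_distrib]

theorem dirDeriv_zero (v : σ → K) : dirDeriv φ v 0 = 0 := by simp [dirDeriv]

theorem dirDeriv_one (v : σ → K) : dirDeriv φ v 1 = 0 := by simp [dirDeriv]

theorem dirDeriv_sum {Γ : Type*} (t : Finset Γ) (v : σ → K) (g : Γ → MvPolynomial σ k) :
    dirDeriv φ v (∑ γ ∈ t, g γ) = ∑ γ ∈ t, dirDeriv φ v (g γ) := by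
  classical
  induction t using Finset.induction_on with
  | empty => simp [dirDeriv_zero]
  | insert a t ha ih => rw [Finset.sum_insert ha, Finset.sum_insert ha, dirDeriv_add, ih]

theorem dirDeriv_mul (v : σ → K) (g h : MvPolynomial σ k) :
    dirDeriv φ v (g * h) = φ g * dirDeriv φ v h + φ h * dirDeriv φ v g := by
  simp only [dirDeriv, Derivation.leibniz, smul_eq_mul, map_add, map_mul, Finset.mul_sum,
    ← Finset.sum_add_distrib]
  exact Finset.sum_congr rfl fun s _ => by ring

theorem dirDeriv_X [DecidableEq σ] (v : σ → K) (s : σ) : dirDeriv φ v (X s) = v s := by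
  rw [dirDeriv, Finset.sum_eq_single s]
  · simp
  · intro t _ ht
    rw [pderiv_X_of_ne ht.symm, map_zero, zero_mul]
  · simp

theorem dirDeriv_single [DecidableEq σ] (s : σ) (g : MvPolynomial σ k) :
    dirDeriv φ (Pi.single s 1) g = φ (pderiv s g) := by
  rw [dirDeriv, Finset.sum_eq_single s]
  · simp
  · intro t _ ht
    rw [Pi.single_eq_of_ne ht, mul_zero]
  · simp

/-- The Zariski tangent space, over `K`, of the zero locus of an ideal. -/
def tangent (p : Ideal (MvPolynomial σ k)) : Submodule K (σ → K) where
  carrier := {v | ∀ g ∈ p, dirDeriv φ v g = 0}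
  add_mem' := fun {v w} hv hw g hg => by
    have h1 : dirDeriv φ (v + w) g = dirDeriv φ v g + dirDeriv φ w g := by
      simp only [dirDeriv, Pi.add_apply, mul_add, Finset.sum_add_distrib]
    rw [h1, hv g hg, hw g hg, add_zero]
  zero_mem' := fun g _ => by simp [dirDeriv]
  smul_mem' := fun c v hv g hg => by
    have h1 : dirDeriv φ (c • v) g = c * dirDeriv φ v g := by
      simp only [dirDeriv, Pi.smul_apply, smul_eq_mul, Finset.mul_sum]
      exact Finset.sum_congr rfl fun s _ => by ring
    rw [h1, hv g hg, mul_zero]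

theorem mem_tangent {p : Ideal (MvPolynomial σ k)} {v : σ → K} :
    v ∈ tangent φ p ↔ ∀ g ∈ p, dirDeriv φ v g = 0 := Iff.rfl

/-- Tangent vectors are given by derivations of the residue field. -/
theorem exists_derivation_of_mem_tangent [DecidableEq σ] (p : Ideal (MvPolynomial σ k))
    (hφ : ∀ g, φ g = 0 ↔ g ∈ p) (hfrac : ∀ x : K, ∃ a b, φ b ≠ 0 ∧ x * φ b = φ a)
    (v : σ → K) (hv : v ∈ tangent φ p) :
    ∃ D : Derivation ℤ K K, ∀ s, D (φ (X s)) = v s := by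
  choose n d hd hnd using hfrac
  -- The quotient rule for x = φ(n)/φ(d). `hD` shows independence of the chosen fraction: two
  -- fractions for x differ by an element of p, which v annihilates.
  let D : K → K := fun x => (dirDeriv φ v (n x) - x * dirDeriv φ v (d x)) / φ (d x)
  have hD : ∀ x a b, φ b ≠ 0 → x * φ b = φ a →
      D x * φ b = dirDeriv φ v a - x * dirDeriv φ v b := by
    intro x a b hb hab
    have h1 : n x * b - a * d x ∈ p := by
      rw [← hφ, map_sub, map_mul, map_mul, ← hnd, ← hab]
      ring
    have h2 : dirDeriv φ v (n x * b) = dirDeriv φ v (a * d x) := by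
      have h3 := dirDeriv_add φ v (n x * b - a * d x) (a * d x)
      rwa [sub_add_cancel, hv _ h1, zero_add] at h3
    rw [dirDeriv_mul, dirDeriv_mul, ← hnd, ← hab] at h2
    have h4 : D x * φ (d x) = dirDeriv φ v (n x) - x * dirDeriv φ v (d x) :=
      div_mul_cancel₀ _ (hd x)
    refine mul_right_cancel₀ (hd x) ?_
    linear_combination φ b * h4 + h2
  have hDn := fun x => hD x _ _ (hd x) (hnd x)
  refine ⟨Derivation.mk' { toFun := D, map_add' := fun x y => ?_, map_smul' := fun m x => ?_ }
    fun x y => ?_, fun s => ?_⟩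
  · have hb : φ (d x * d y) ≠ 0 := by rw [map_mul]; exact mul_ne_zero (hd x) (hd y)
    refine mul_right_cancel₀ hb ?_
    rw [hD (x + y) (n x * d y + n y * d x) (d x * d y) hb (by
      simp only [map_add, map_mul, ← hnd]; ring), dirDeriv_add, dirDeriv_mul, dirDeriv_mul,
      dirDeriv_mul, ← hnd, ← hnd, map_mul]
    linear_combination - φ (d y) * hDn x - φ (d x) * hDn y
  · refine mul_right_cancel₀ (hd x) ?_
    rw [hD (m • x) (m • n x) (d x) (hd x) (by rw [map_zsmul, ← hnd, smul_mul_assoc])]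
    have h1 : dirDeriv φ v (m • n x) = m • dirDeriv φ v (n x) :=
      map_zsmul (AddMonoidHom.mk' (dirDeriv φ v) (dirDeriv_add φ v)) m (n x)
    rw [h1]
    simp only [zsmul_eq_mul, eq_intCast]
    linear_combination - (m : K) * hDn x
  · change D (x * y) = x * D y + y * D x
    have hb : φ (d x * d y) ≠ 0 := by rw [map_mul]; exact mul_ne_zero (hd x) (hd y)
    refine mul_right_cancel₀ hb ?_
    rw [hD (x * y) (n x * n y) (d x * d y) hb (by
      simp only [map_mul, ← hnd]; ring), dirDeriv_mul, dirDeriv_mul, ← hnd, ← hnd, map_mul]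
    linear_combination - y * φ (d y) * hDn x - x * φ (d x) * hDn y
  · change D (φ (X s)) = v s
    have h1 := hD (φ (X s)) (X s) 1 (by rw [map_one]; exact one_ne_zero) (by rw [map_one, mul_one])
    rwa [map_one, mul_one, dirDeriv_X, dirDeriv_one, mul_zero, sub_zero] at h1

/-- The maximal ideal of the regular ring A_p needs only height p generators, and elements of p
already span the cotangent space. The factor t clears denominators. -/
theorem exists_generators_localization {A : Type*} [CommRing A] [IsRegularRing A] (p : Ideal A)
    [p.IsPrime] : ∃ (h : ℕ) (z : Fin h → A), p.height = h ∧ (∀ i, z i ∈ p) ∧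
      ∀ g ∈ p, ∃ t ∉ p, t * g ∈ Ideal.span (Set.range z) := by
  obtain ⟨h, hh⟩ := ENat.ne_top_iff_exists.mp (Ideal.height_ne_top_of_isPrime (I := p))
  let R := Localization.AtPrime p
  have hR : ringKrullDim R = h := by
    rw [IsLocalization.AtPrime.ringKrullDim_eq_height p R, ← hh]
    rfl
  have hcot : Module.finrank (ResidueField R) (CotangentSpace R) = h := by
    have := (IsRegularLocalRing.iff_finrank_cotangentSpace R).mp inferInstance
    rw [hR] at this
    exact_mod_cast this
  have hpm : p.map (algebraMap _ R) = maximalIdeal R := Localization.AtPrime.map_eq_maximalIdeal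
  let ξ : p → maximalIdeal R := fun g =>
    ⟨algebraMap (A) R g, hpm ▸ Ideal.mem_map_of_mem _ g.2⟩
  have hξ : Submodule.span (ResidueField R) (Set.range fun g => (maximalIdeal R).toCotangent (ξ g))
      = ⊤ := by
    have h1 : Submodule.span R (Set.range ξ) = ⊤ := by
      refine Submodule.map_injective_of_injective (maximalIdeal R).injective_subtype ?_
      rw [Submodule.map_span, Submodule.map_subtype_top, ← Set.range_comp]
      refine Eq.trans ?_ hpm
      rw [Ideal.map]
      refine congrArg Ideal.span (Set.ext fun z => ⟨?_, ?_⟩)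
      · rintro ⟨g, rfl⟩
        exact ⟨g, g.2, rfl⟩
      · rintro ⟨g, hg, rfl⟩
        exact ⟨⟨g, hg⟩, rfl⟩
    rw [← CotangentSpace.span_image_eq_top_iff, ← Set.range_comp] at h1
    exact h1
  obtain ⟨b, hb, hbspan, hblin⟩ := exists_linearIndependent (ResidueField R)
    (Set.range fun g => (maximalIdeal R).toCotangent (ξ g))
  rw [hξ] at hbspan
  have hbfin : Fintype b := hblin.setFinite.fintype
  have hbcard : Fintype.card b = h := by
    rw [← hcot, ← Set.toFinset_card, ← finrank_span_set_eq_card hblin, hbspan, finrank_top]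
  choose z hz using fun w : b => hb w.2
  have hspan : Ideal.span (Set.range fun w => algebraMap _ R (z w : A))
      = maximalIdeal R := by
    have h1 : Submodule.span R (Set.range fun w => ξ (z w)) = ⊤ := by
      rw [← CotangentSpace.span_image_eq_top_iff, ← Set.range_comp]
      have : (⇑(maximalIdeal R).toCotangent ∘ fun w => ξ (z w)) = ((↑) : b → _) := funext hz
      rw [this, Subtype.range_coe]
      exact hbspan
    have h2 := congrArg (Submodule.map (maximalIdeal R).subtype) h1
    rw [Submodule.map_span, Submodule.map_subtype_top, ← Set.range_comp] at h2
    exact h2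
  let e := (Fintype.equivFinOfCardEq hbcard).symm
  refine ⟨h, fun i => z (e i), hh.symm, fun i => (z (e i)).2, fun g hg => ?_⟩
  have h1 : algebraMap A R g ∈ (Ideal.span (Set.range fun i => (z (e i) : A))).map
      (algebraMap A R) := by
    have h2 : (Ideal.span (Set.range fun i => (z (e i) : A))).map (algebraMap A R)
        = maximalIdeal R := by
      rw [Ideal.map_span, ← Set.range_comp]
      exact (congrArg Ideal.span (e.surjective.range_comp fun w => algebraMap A R (z w))).trans hspan
    rw [h2, ← hpm]
    exact Ideal.mem_map_of_mem _ hg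
  obtain ⟨t, ht, htg⟩ :=
    (IsLocalization.algebraMap_mem_map_algebraMap_iff p.primeCompl R _ _).mp h1
  exact ⟨t, ht, htg⟩

/-- At its generic point V(p) is cut out by h = height p elements, whose h differentials already
define the tangent space. -/
theorem card_le_height_add_finrank_tangent (p : Ideal (MvPolynomial σ k)) [p.IsPrime]
    (hφ : ∀ g, φ g = 0 ↔ g ∈ p) :
    ∃ h : ℕ, p.height = h ∧ Fintype.card σ ≤ h + Module.finrank K (tangent φ p) := by
  obtain ⟨h, z, hh, hz, hspan⟩ := exists_generators_localization p
  refine ⟨h, hh, ?_⟩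
  let E : (σ → K) →ₗ[K] (Fin h → K) := LinearMap.pi fun w =>
    ∑ s, φ (pderiv s (z w)) • LinearMap.proj s
  have hE : ∀ v w, E v w = dirDeriv φ v (z w) := fun v w => by
    simp [E, dirDeriv]
  have h1 := LinearMap.finrank_range_add_finrank_ker E
  have h2 : Module.finrank K (LinearMap.range E) ≤ h := by
    refine (Submodule.finrank_le _).trans ?_
    rw [Module.finrank_fintype_fun_eq_card, Fintype.card_fin]
  have h3 : LinearMap.ker E ≤ tangent φ p := by
    intro v hv g hg
    obtain ⟨t, ht, htg⟩ := hspan g hg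
    obtain ⟨a, ha⟩ := (Ideal.mem_span_range_iff_exists_fun).mp htg
    have h5 : dirDeriv φ v (t * g) = 0 := by
      rw [← ha, dirDeriv_sum]
      refine Finset.sum_eq_zero fun w _ => ?_
      rw [dirDeriv_mul, (hφ _).mpr (hz w), zero_mul, add_zero, ← hE, LinearMap.mem_ker.mp hv,
        Pi.zero_apply, mul_zero]
    rw [dirDeriv_mul, (hφ g).mpr hg, zero_mul, add_zero] at h5
    exact (mul_eq_zero.mp h5).resolve_left fun h0 => ht ((hφ t).mp h0)
  have h4 := Submodule.finrank_mono h3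
  rw [Module.finrank_fintype_fun_eq_card] at h1
  omega

/-- Directional derivatives at p kill p². A relation Σ l_γ f_γ in m² thus becomes, after clearing
denominators, a relation between the Jacobian rows over K. -/
theorem mem_maximalIdeal_of_sum_mem_sq [DecidableEq σ] {Γ : Type*} [Fintype Γ]
    (p : Ideal (MvPolynomial σ k)) [p.IsPrime]
    (hφ : ∀ g, φ g = 0 ↔ g ∈ p) (f : Γ → MvPolynomial σ k) (hf : ∀ γ, f γ ∈ p)
    (hJ : ∀ l : Γ → K, (∀ s, ∑ γ, l γ * φ (pderiv s (f γ)) = 0) → l = 0)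
    (l : Γ → Localization.AtPrime p)
    (hl : ∑ γ, l γ * algebraMap _ _ (f γ) ∈ maximalIdeal (Localization.AtPrime p) ^ 2) (γ : Γ) :
    l γ ∈ maximalIdeal (Localization.AtPrime p) := by
  let R := Localization.AtPrime p
  have hpm : p.map (algebraMap _ R) = maximalIdeal R := Localization.AtPrime.map_eq_maximalIdeal
  obtain ⟨t, ht⟩ := IsLocalization.exist_integer_multiples_of_finite p.primeCompl l
  choose l' hl' using ht
  have h1 : algebraMap _ R (∑ γ, l' γ * f γ) ∈ (p ^ 2).map (algebraMap _ R) := by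
    rw [Ideal.map_pow, hpm, map_sum]
    have h2 : ∑ γ, algebraMap _ R (l' γ * f γ)
        = algebraMap _ R (t : MvPolynomial σ k) * ∑ γ, l γ * algebraMap _ _ (f γ) := by
      rw [Finset.mul_sum]
      refine Finset.sum_congr rfl fun γ _ => ?_
      rw [map_mul, hl', Algebra.smul_def, mul_assoc]
    rw [h2]
    exact Ideal.mul_mem_left _ _ hl
  rw [IsLocalization.algebraMap_mem_map_algebraMap_iff p.primeCompl] at h1
  obtain ⟨t', ht', h1⟩ := h1
  have hsq : ∀ g ∈ p ^ 2, ∀ v : σ → K, dirDeriv φ v g = 0 := by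
    intro g hg v
    rw [sq] at hg
    refine Submodule.mul_induction_on hg (fun a ha b hb => ?_) (fun a b ha hb => ?_)
    · rw [dirDeriv_mul, (hφ a).mpr ha, (hφ b).mpr hb, zero_mul, zero_mul, add_zero]
    · rw [dirDeriv_add, ha, hb, add_zero]
  have h2 : (fun γ => φ (t' * l' γ)) = 0 := hJ _ fun s => by
    rw [← hsq _ h1 (Pi.single s 1), Finset.mul_sum, dirDeriv_sum]
    refine Finset.sum_congr rfl fun γ _ => ?_
    rw [← mul_assoc, dirDeriv_mul, (hφ _).mpr (hf γ), zero_mul, add_zero, dirDeriv_single]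
  have h3 : l' γ ∈ p := by
    have h4 := congrFun h2 γ
    change φ (t' * l' γ) = 0 at h4
    rw [map_mul] at h4
    exact (hφ _).mp ((mul_eq_zero.mp h4).resolve_left fun h0 => ht' ((hφ t').mp h0))
  have h5 : algebraMap _ R (t : MvPolynomial σ k) * l γ ∈ maximalIdeal R := by
    have h6 := Ideal.mem_map_of_mem (algebraMap _ R) h3
    rw [hl', Algebra.smul_def, hpm] at h6
    exact h6
  exact ((maximalIdeal.isMaximal R).isPrime.mem_or_mem h5).resolve_left fun h0 =>
    h0 (IsLocalization.map_units R t)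

end Jacobian

end QuiverMoment

end

noncomputable section

namespace QuiverMoment

/-! ### Serre's normality criterion and connectedness. -/

section Serre

variable {B : Type*} [CommRing B]

theorem exists_prime_annihilator [IsNoetherianRing B] (I : Ideal B) (x : B) (hx : x ∉ I) :
    ∃ (P : Ideal B) (y : B), P.IsPrime ∧ (∀ b, b * y ∈ I ↔ b ∈ P) ∧ ∀ b, b * x ∈ I → b ∈ P := by
  have hx' : (Ideal.Quotient.mk I x) ≠ 0 := by rwa [Ne, Ideal.Quotient.eq_zero_iff_mem]
  obtain ⟨P, hP, hle⟩ := exists_le_isAssociatedPrime_of_isNoetherianRing B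
    (Ideal.Quotient.mk I x) hx'
  rw [isAssociatedPrime_iff] at hP
  obtain ⟨hP, y, hy⟩ := hP
  obtain ⟨y, rfl⟩ := Ideal.Quotient.mk_surjective y
  have key : ∀ b z : B, b ∈ (⊥ : Submodule B (B ⧸ I)).colon {Ideal.Quotient.mk I z} ↔
      b * z ∈ I := fun b z => by
    rw [Submodule.mem_colon_singleton, Submodule.mem_bot, ← Ideal.Quotient.eq_zero_iff_mem,
      map_mul, Algebra.smul_def]
    rfl
  exact ⟨P, y, hP, fun b => by rw [hy, key], fun b hb => hle ((key b x).2 hb)⟩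

theorem exists_mul_eq_zero_of_algebraMap_eq_zero (P : Ideal B) [P.IsPrime] (x : B)
    (hx : algebraMap B (Localization.AtPrime P) x = 0) : ∃ t, t ∉ P ∧ t * x = 0 := by
  obtain ⟨t, ht⟩ := (IsLocalization.map_eq_zero_iff P.primeCompl _ x).1 hx
  exact ⟨t, t.2, ht⟩

/-- The integral fraction r/s already lies in the normal localization L, and t is its denominator.
-/
theorem exists_mul_mem_span_of_isIntegral [IsDomain B] (M : Submonoid B)
    (hM : M ≤ nonZeroDivisors B) (L : Type*) [CommRing L] [IsDomain L] [Algebra B L]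
    [IsLocalization M L] [IsIntegrallyClosed L] (r s : B) (hs : s ∈ nonZeroDivisors B)
    (hx : IsIntegral B (algebraMap B (FractionRing B) r / algebraMap B (FractionRing B) s)) :
    ∃ t ∈ M, t * r ∈ Ideal.span {s} := by
  have hinj : Function.Injective (algebraMap B L) := IsLocalization.injective _ hM
  have hinj2 := IsFractionRing.injective L (FractionRing L)
  have hinj' : Function.Injective (algebraMap B (FractionRing L)) := by
    rw [IsScalarTower.algebraMap_eq B L]
    exact hinj2.comp hinj
  let ψ : FractionRing B →ₐ[B] FractionRing L :=
    IsFractionRing.liftAlgHom (g := Algebra.ofId B _) hinj'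
  have hψ : IsIntegral L (ψ (algebraMap B _ r / algebraMap B _ s)) := (hx.map ψ).tower_top
  obtain ⟨z, hz⟩ := IsIntegrallyClosed.algebraMap_eq_of_integral hψ
  obtain ⟨w, t, rfl⟩ := IsLocalization.exists_mk'_eq M z
  have hs0 : algebraMap B (FractionRing L) s ≠ 0 := by
    rw [Ne, map_eq_zero_iff _ hinj']; exact nonZeroDivisors.ne_zero hs
  rw [map_div₀, AlgHom.commutes, AlgHom.commutes, eq_div_iff hs0,
    IsScalarTower.algebraMap_apply B L _ s,
    IsScalarTower.algebraMap_apply B L _ r, ← map_mul] at hz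
  have hz2 := hinj2 hz
  have hz3 := congrArg (algebraMap B L t * ·) hz2
  simp only [← mul_assoc] at hz3
  rw [mul_comm (algebraMap B _ _), IsLocalization.mk'_spec, ← map_mul, ← map_mul] at hz3
  have hz4 := hinj hz3
  exact ⟨t, t.2, Ideal.mem_span_singleton.2 ⟨w, by rw [← hz4, mul_comm]⟩⟩

/-- A Noetherian ring without embedded primes, with domains as localizations at the associated
primes of `0` and with normal localizations at the associated primes of all nonzerodivisors, is a
normal domain once its spectrum is connected. -/
theorem isDomain_and_isIntegrallyClosed [IsNoetherianRing B] [Nontrivial B]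
    (h1 : ∀ (P : Ideal B) [P.IsPrime] (x : B), (∀ b, b * x = 0 ↔ b ∈ P) →
      P ∈ minimalPrimes B ∧ IsDomain (Localization.AtPrime P))
    (h2 : ∀ s ∈ nonZeroDivisors B, ∀ (P : Ideal B) [P.IsPrime] (x : B),
      (∀ b, b * x ∈ Ideal.span {s} ↔ b ∈ P) →
        IsDomain (Localization.AtPrime P) ∧ IsIntegrallyClosed (Localization.AtPrime P))
    (hid : ∀ e : B, e * e = e → e = 0 ∨ e = 1) : IsDomain B ∧ IsIntegrallyClosed B := by
  -- A nilpotent vanishes in the domain B_P at an associated prime P of 0 containing its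
  -- annihilator, contradicting the choice of P.
  have hred : ∀ x : B, IsNilpotent x → x = 0 := by
    intro x hx
    by_contra hx0
    obtain ⟨P, y, hP, hy, hle⟩ := exists_prime_annihilator (⊥ : Ideal B) x (by simpa using hx0)
    have := (h1 P y (by simpa using hy)).2
    obtain ⟨t, ht, htx⟩ := exists_mul_eq_zero_of_algebraMap_eq_zero P x
      (hx.map (algebraMap B (Localization.AtPrime P))).eq_zero
    exact ht (hle t (by simpa using htx))
  have hdom : IsDomain B := by
    obtain ⟨P₁, hP₁⟩ := Ideal.nonempty_minimalPrimes (I := (⊥ : Ideal B)) bot_ne_top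
    have hP₁p : P₁.IsPrime := hP₁.1.1
    have hfin : (minimalPrimes B).Finite := minimalPrimes.finite_of_isNoetherianRing B
    set J : Ideal B := (hfin.toFinset.erase P₁).inf id with hJ
    have hinf : ∀ x ∈ P₁, x ∈ J → x = 0 := by
      intro x hx hxJ
      refine hred x ?_
      rw [← mem_nilradical, nilradical, ← Ideal.sInf_minimalPrimes, Submodule.mem_sInf]
      intro P hP
      by_cases h : P = P₁
      · exact h ▸ hx
      · exact (Finset.inf_le (f := id) (Finset.mem_erase.2 ⟨h, hfin.mem_toFinset.2 hP⟩) : J ≤ P) hxJ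
    -- J is the intersection of the other minimal primes. All zero divisors lie in minimal primes,
    -- so prime avoidance would put P₁ + J inside one minimal prime, which would be P₁ and contain
    -- another.
    have hs : ∃ s ∈ P₁ ⊔ J, s ∈ nonZeroDivisors B := by
      by_contra! hcon
      have hsub : ((P₁ ⊔ J : Ideal B) : Set B) ⊆ ⋃ i ∈ (minimalPrimes B), ((id i : Ideal B) : Set B) := by
        intro z hz
        have hz' := hcon z hz
        rw [mem_nonZeroDivisors_iff_right] at hz'
        push Not at hz'
        obtain ⟨w, hw, hw0⟩ := hz'
        obtain ⟨P, y, hP, hy, hle⟩ := exists_prime_annihilator (⊥ : Ideal B) w (by simpa using hw0)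
        rw [Set.mem_iUnion₂]
        exact ⟨P, (h1 P y (by simpa using hy)).1, hle z (by simpa [mul_comm] using hw)⟩
      have := (Ideal.subset_union_prime_finite hfin (f := id) ⊥ ⊥
        (fun i hi _ _ => hi.1.1)).1 hsub
      obtain ⟨P, hP, hle⟩ := this
      have hPp : P.IsPrime := hP.1.1
      have e1 : P = P₁ := le_antisymm (hP.2 ⟨hP₁p, bot_le⟩ (le_sup_left.trans hle)) (le_sup_left.trans hle)
      obtain ⟨P₂, h₂, hle₂⟩ := (Ideal.IsPrime.inf_le' hPp).1 ((le_sup_right.trans hle : J ≤ P))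
      rw [Finset.mem_erase, hfin.mem_toFinset] at h₂
      have hle₂' : P₂ ≤ P := hle₂
      exact h₂.1 ((le_antisymm hle₂' (hP.2 h₂.2.1 hle₂')).trans e1)
    obtain ⟨s, hsI, hs⟩ := hs
    obtain ⟨a, haI, b, hbJ, rfl⟩ := Submodule.mem_sup.1 hsI
    have hab : a * b = 0 := hinf _ (P₁.mul_mem_right _ haI) (J.mul_mem_left _ hbJ)
    -- Tested at the associated primes of a + b: there the localization is a domain and a b = 0, so
    -- a or b vanishes. The quotient a / (a + b) is thus an idempotent of B, separating P₁ from the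
    -- other components.
    have hae : a ∈ Ideal.span {a + b} := by
      by_contra hcon
      obtain ⟨P, y, hP, hy, hle⟩ := exists_prime_annihilator _ a hcon
      have := (h2 _ hs P y hy).1
      have h0 : algebraMap B (Localization.AtPrime P) a * algebraMap B (Localization.AtPrime P) b
          = 0 := by rw [← map_mul, hab, map_zero]
      rcases mul_eq_zero.1 h0 with h0 | h0
      · obtain ⟨t, ht, hta⟩ := exists_mul_eq_zero_of_algebraMap_eq_zero P _ h0
        exact ht (hle t (by rw [hta]; exact zero_mem _))
      · obtain ⟨t, ht, hta⟩ := exists_mul_eq_zero_of_algebraMap_eq_zero P _ h0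
        refine ht (hle t (Ideal.mem_span_singleton.2 ⟨t, ?_⟩))
        linear_combination - hta
    obtain ⟨e, he⟩ := Ideal.mem_span_singleton.1 hae
    have hee : e * e = e := by
      have h3 : (e * e - e) * (a + b) * (a + b) = 0 := by
        have h4 : a * a = a * (a + b) := by linear_combination -hab
        have h5 : ((a + b) * e) * ((a + b) * e) = ((a + b) * e) * (a + b) := by
          rw [← he]; exact h4
        linear_combination h5
      rw [mul_right_mem_nonZeroDivisors_eq_zero_iff hs,
        mul_right_mem_nonZeroDivisors_eq_zero_iff hs] at h3
      exact sub_eq_zero.1 h3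
    have hbot : P₁ = ⊥ := by
      rcases hid e hee with rfl | rfl
      · have ha0 : a = 0 := by simpa using he
        subst ha0
        rw [zero_add] at hs
        rw [eq_bot_iff]
        intro x hx
        have := hinf (x * b) (P₁.mul_mem_right _ hx) (J.mul_mem_left _ hbJ)
        rw [mul_right_mem_nonZeroDivisors_eq_zero_iff hs] at this
        simpa using this
      · rw [mul_one] at he
        rw [← he] at hs
        exact absurd haI (Set.disjoint_left.1
          (Ideal.disjoint_nonZeroDivisors_of_mem_minimalPrimes hP₁).symm hs)
    rw [hbot] at hP₁p
    exact (MulEquiv.isDomain (B ⧸ (⊥ : Ideal B)) (RingEquiv.quotientBot B).symm.toMulEquiv)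
  refine ⟨hdom, ?_⟩
  rw [isIntegrallyClosed_iff (FractionRing B)]
  intro x hx
  obtain ⟨r, s, hs, rfl⟩ := IsFractionRing.div_surjective (A := B) x
  -- An integral fraction r/s lies in B because this holds at every associated prime of s, where B
  -- is normal.
  have hrs : r ∈ Ideal.span {s} := by
    by_contra hcon
    obtain ⟨P, y, hP, hy, hle⟩ := exists_prime_annihilator _ r hcon
    obtain ⟨hd, hic⟩ := h2 s hs P y hy
    obtain ⟨t, ht, htr⟩ := exists_mul_mem_span_of_isIntegral P.primeCompl
      P.primeCompl_le_nonZeroDivisors (Localization.AtPrime P) r s hs hx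
    exact ht (hle t htr)
  obtain ⟨y, rfl⟩ := Ideal.mem_span_singleton.1 hrs
  refine ⟨y, ?_⟩
  have hs0 : algebraMap B (FractionRing B) s ≠ 0 := by
    rw [Ne, IsFractionRing.to_map_eq_zero_iff]; exact nonZeroDivisors.ne_zero hs
  rw [map_mul, mul_div_cancel_left₀ _ hs0]

theorem isNormalRing_of_isIntegrallyClosed [IsDomain B] [IsIntegrallyClosed B] :
    IsNormalRing B := by
  intro p hp
  have hd : IsDomain (Localization.AtPrime p) :=
    IsLocalization.isDomain_localization p.primeCompl_le_nonZeroDivisors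
  exact ⟨hd, isIntegrallyClosed_of_isLocalization _ p.primeCompl p.primeCompl_le_nonZeroDivisors⟩

open Polynomial in
-- The difference N between E and its constant term satisfies N³ = N and is divisible by X, hence by
-- every power of X.
theorem polynomial_eq_C_of_mul_self_eq (E : B[X]) (hE : E * E = E) : E = C (E.coeff 0) := by
  have h0 : E.coeff 0 * E.coeff 0 = E.coeff 0 := by rw [← mul_coeff_zero, hE]
  have h0' : C (E.coeff 0) * C (E.coeff 0) = C (E.coeff 0) := by rw [← C_mul, h0]
  set N := E - C (E.coeff 0) with hN
  have h3 : N * N * N = N := by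
    rw [hN]
    linear_combination (E + 1 - 3 * C (E.coeff 0)) * hE + (3 * E - 1 - C (E.coeff 0)) * h0'
  have hX : X ∣ N := by rw [X_dvd_iff, hN]; simp
  have hdvd : ∀ n : ℕ, X ^ (n + 1) ∣ N := by
    intro n
    induction n with
    | zero => simpa using hX
    | succ n ih =>
      rw [← h3, pow_succ]
      exact (mul_dvd_mul ih hX).mul_right _
  have : N = 0 := by
    ext d
    exact X_pow_dvd_iff.1 (hdvd d) d (Nat.lt_succ_self d)
  exact sub_eq_zero.1 this

open Polynomial in
/-- The spectrum of a graded algebra with ground field in degree zero is connected. -/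
theorem eq_zero_or_one_of_mul_self_eq [Nontrivial B] {k σ Γ : Type*} [Field k]
    (π : MvPolynomial σ k →+* B) (hπ : Function.Surjective π) (f : Γ → MvPolynomial σ k)
    (hker : RingHom.ker π = Ideal.span (Set.range f)) (m : ℕ) (hf : ∀ γ, (f γ).IsHomogeneous m)
    (e : B) (he : e * e = e) : e = 0 ∨ e = 1 := by
  -- The grading as a coaction: a monomial of degree n is multiplied by X^n. It factors through B by
  -- homogeneity, so an idempotent gives a constant polynomial. Its values at X = 1 and X = 0 are
  -- the idempotent and a scalar.
  let Θ : MvPolynomial σ k →+* B[X] := MvPolynomial.eval₂Hom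
    ((C.comp π).comp MvPolynomial.C) (fun s => C (π (MvPolynomial.X s)) * X)
  have hΘm : ∀ (d : σ →₀ ℕ) (c : k), Θ (MvPolynomial.monomial d c) =
      C (π (MvPolynomial.monomial d c)) * X ^ d.degree := by
    intro d c
    rw [MvPolynomial.monomial_eq]
    simp only [Θ, map_mul, MvPolynomial.coe_eval₂Hom, MvPolynomial.eval₂_C, Finsupp.prod,
      map_prod, map_pow, MvPolynomial.eval₂_X, mul_pow, Finset.prod_mul_distrib, Finset.prod_pow_eq_pow_sum,
      RingHom.comp_apply]
    rw [mul_assoc]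
    rfl
  have hΘf : ∀ γ, Θ (f γ) = 0 := by
    intro γ
    have hγ : π (f γ) = 0 := by
      rw [← RingHom.mem_ker, hker]; exact Ideal.subset_span ⟨γ, rfl⟩
    have : Θ (f γ) = C (π (f γ)) * X ^ m := by
      conv_lhs => rw [(f γ).as_sum]
      conv_rhs => rw [(f γ).as_sum]
      rw [map_sum, map_sum, map_sum, Finset.sum_mul]
      refine Finset.sum_congr rfl fun d hd => ?_
      rw [hΘm, Finsupp.degree_eq_weight_one]
      exact congrArg (fun n => C (π (MvPolynomial.monomial d _)) * X ^ n)
        (hf γ (MvPolynomial.mem_support_iff.1 hd))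
    rw [this, hγ, map_zero, zero_mul]
  have hΘker : ∀ g ∈ RingHom.ker π, Θ g = 0 := by
    rw [hker]
    intro g hg
    have : Ideal.span (Set.range f) ≤ RingHom.ker Θ :=
      Ideal.span_le.2 (by rintro _ ⟨γ, rfl⟩; exact hΘf γ)
    exact this hg
  obtain ⟨g, rfl⟩ := hπ e
  have hE : Θ g * Θ g = Θ g := by
    rw [← sub_eq_zero, ← map_mul, ← map_sub]
    refine hΘker _ ?_
    rw [RingHom.mem_ker, map_sub, map_mul, he, sub_self]
  have hC := polynomial_eq_C_of_mul_self_eq _ hE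
  have h1 : (evalRingHom (1 : B)).comp Θ = π := by
    apply MvPolynomial.ringHom_ext
    · intro r; simp [Θ]
    · intro s; simp [Θ]
  have h2 : (evalRingHom (0 : B)).comp Θ = (π.comp MvPolynomial.C).comp MvPolynomial.constantCoeff := by
    apply MvPolynomial.ringHom_ext
    · intro r; simp [Θ]
    · intro s; simp [Θ]
  have h3 : π g = π (MvPolynomial.C (MvPolynomial.constantCoeff g)) := by
    have e1 := congrArg (fun h : MvPolynomial σ k →+* B => h g) h1
    have e2 := congrArg (fun h : MvPolynomial σ k →+* B => h g) h2
    simp only [RingHom.comp_apply] at e1 e2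
    rw [← e1, ← e2, hC]
    simp
  have hinj : Function.Injective (π.comp (MvPolynomial.C : k →+* _)) := RingHom.injective _
  rw [h3] at he ⊢
  have h4 : MvPolynomial.constantCoeff g * MvPolynomial.constantCoeff g
      = MvPolynomial.constantCoeff g := hinj (by simpa using he)
  rcases IsIdempotentElem.iff_eq_zero_or_one.1 h4 with h | h
  · left; rw [h]; simp
  · right; rw [h]; simp

end Serre

end QuiverMoment

end

noncomputable section

namespace QuiverMoment

/-! ### The Jacobian bound and regularity of local rings. -/

section JacobianCriterion

open IsLocalRing MvPolynomial

theorem localRingHom_surjective {A B : Type*} [CommRing A] [CommRing B] (π : A →+* B)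
    (hπ : Function.Surjective π) (p : Ideal A) [p.IsPrime] (P : Ideal B) [P.IsPrime]
    (h : p = P.comap π) : Function.Surjective (Localization.localRingHom p P π h) := by
  intro y
  obtain ⟨b, t, rfl⟩ := IsLocalization.exists_mk'_eq P.primeCompl y
  obtain ⟨a, rfl⟩ := hπ b
  obtain ⟨t, ht⟩ := t
  obtain ⟨u, rfl⟩ := hπ t
  exact ⟨IsLocalization.mk' _ a (⟨u, fun hu => ht (by rw [h] at hu; exact hu)⟩ : p.primeCompl),
    Localization.localRingHom_mk' _ _ _ _ _ _⟩

theorem ker_localRingHom {A B Γ : Type*} [CommRing A] [CommRing B] (π : A →+* B)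
    (hπ : Function.Surjective π) (f : Γ → A) (hker : RingHom.ker π = Ideal.span (Set.range f))
    (p : Ideal A) [p.IsPrime] (P : Ideal B) [P.IsPrime]
    (h : p = P.comap π) : RingHom.ker (Localization.localRingHom p P π h)
      = Ideal.span (Set.range fun γ => algebraMap A (Localization.AtPrime p) (f γ)) := by
  have hspan : Ideal.span (Set.range fun γ => algebraMap A (Localization.AtPrime p) (f γ))
      = (RingHom.ker π).map (algebraMap A (Localization.AtPrime p)) := by
    rw [hker, Ideal.map_span, ← Set.range_comp]
    rfl
  rw [hspan]
  apply le_antisymm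
  · intro y hy
    obtain ⟨a, t, rfl⟩ := IsLocalization.exists_mk'_eq p.primeCompl y
    rw [RingHom.mem_ker, Localization.localRingHom_mk', IsLocalization.mk'_eq_zero_iff] at hy
    obtain ⟨⟨u, hu⟩, hua⟩ := hy
    obtain ⟨u, rfl⟩ := hπ u
    have h1 : u * a ∈ RingHom.ker π := by rw [RingHom.mem_ker, map_mul]; exact hua
    have h2 : u ∉ p := by rw [h]; exact hu
    have h3 := (IsLocalization.algebraMap_mem_map_algebraMap_iff p.primeCompl
      (Localization.AtPrime p) (RingHom.ker π) a).2 ⟨u, h2, h1⟩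
    rw [IsLocalization.mk'_eq_mul_mk'_one]
    exact Ideal.mul_mem_right _ _ h3
  · refine Ideal.map_le_iff_le_comap.2 fun a ha => ?_
    rw [Ideal.mem_comap, RingHom.mem_ker, Localization.localRingHom_to_map, RingHom.mem_ker.1 ha,
      map_zero]

theorem card_le_of_regular {R Γ : Type*} [CommRing R] [IsRegularLocalRing R] [Fintype Γ] (h : ℕ)
    (hR : ringKrullDim R = h) (x : Γ → R) (hxm : ∀ γ, x γ ∈ maximalIdeal R)
    (hx : ∀ l : Γ → R, ∑ γ, l γ * x γ ∈ maximalIdeal R ^ 2 → ∀ γ, l γ ∈ maximalIdeal R) :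
    Fintype.card Γ ≤ h := by
  have hnt : Nontrivial (R ⧸ Ideal.span (Set.range x)) := by
    refine Ideal.Quotient.nontrivial_iff.2 fun h1 => ?_
    have : Ideal.span (Set.range x) ≤ maximalIdeal R :=
      Ideal.span_le.2 (by rintro _ ⟨γ, rfl⟩; exact hxm γ)
    rw [h1] at this
    exact (maximalIdeal.isMaximal _).ne_top (top_le_iff.1 this)
  obtain ⟨-, d, -, hd⟩ := IsRegularLocalRing.of_surjective h hR _ hxm hx
    (Ideal.Quotient.mk (Ideal.span (Set.range x))) Ideal.Quotient.mk_surjective Ideal.mk_ker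
  omega

universe u v w

theorem exists_fractionField_of_isPrime {A : Type u} [CommRing A] (p : Ideal A) [p.IsPrime] :
    ∃ (K : Type u) (_ : Field K) (φ : A →+* K), (∀ g, φ g = 0 ↔ g ∈ p) ∧
      ∀ x : K, ∃ a b, φ b ≠ 0 ∧ x * φ b = φ a := by
  refine ⟨FractionRing (A ⧸ p), inferInstance,
    (algebraMap (A ⧸ p) (FractionRing (A ⧸ p))).comp (Ideal.Quotient.mk p), fun g => ?_,
    fun x => ?_⟩
  · rw [RingHom.comp_apply, IsFractionRing.to_map_eq_zero_iff, Ideal.Quotient.eq_zero_iff_mem]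
  · obtain ⟨a, b, hb, rfl⟩ := IsFractionRing.div_surjective (A := A ⧸ p) x
    obtain ⟨a, rfl⟩ := Ideal.Quotient.mk_surjective a
    obtain ⟨b, rfl⟩ := Ideal.Quotient.mk_surjective b
    have h0 : algebraMap (A ⧸ p) (FractionRing (A ⧸ p)) (Ideal.Quotient.mk p b) ≠ 0 := by
      rw [Ne, IsFractionRing.to_map_eq_zero_iff]; exact nonZeroDivisors.ne_zero hb
    exact ⟨a, b, h0, div_mul_cancel₀ _ h0⟩

variable {k : Type u} {σ : Type v} {Γ : Type w} [Field k] [Fintype σ] [DecidableEq σ] [Fintype Γ]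

/-- At each prime containing the `f γ` where their Jacobian matrix is degenerate, the space of
tangent vectors has codimension greater than `card Γ + e`. -/
def JacobianBound (f : Γ → MvPolynomial σ k) (e : ℕ) : Prop :=
  ∀ (K : Type (max u v)) [Field K] (φ : MvPolynomial σ k →+* K),
    (∀ x : K, ∃ a b, φ b ≠ 0 ∧ x * φ b = φ a) → (∀ γ, φ (f γ) = 0) →
    ∀ l : Γ → K, l ≠ 0 → (∀ s, ∑ γ, l γ * φ (pderiv s (f γ)) = 0) →
      Module.finrank K (tangent φ (RingHom.ker φ)) + Fintype.card Γ + e + 1 ≤ Fintype.card σ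

variable {f : Γ → MvPolynomial σ k} {e : ℕ}

/-- Either the Jacobian rows are independent over the residue field and the f_γ are independent in
the cotangent space, or the bound on tangent vectors forces height at least card Γ + e + 1. -/
theorem JacobianBound.regular_of_height_le (hf : JacobianBound f e) (p : Ideal (MvPolynomial σ k))
    [p.IsPrime] (hfp : ∀ γ, f γ ∈ p) : ∃ h : ℕ, p.height = h ∧ Fintype.card Γ ≤ h ∧
      (h ≤ Fintype.card Γ + e → ∀ l : Γ → Localization.AtPrime p,
        ∑ γ, l γ * algebraMap _ _ (f γ) ∈ maximalIdeal (Localization.AtPrime p) ^ 2 →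
          ∀ γ, l γ ∈ maximalIdeal (Localization.AtPrime p)) := by
  obtain ⟨K, _, φ, hφ, hfrac⟩ := exists_fractionField_of_isPrime p
  obtain ⟨h, hh, hle⟩ := card_le_height_add_finrank_tangent φ p hφ
  have hpk : p = RingHom.ker φ := by ext g; rw [RingHom.mem_ker, hφ]
  refine ⟨h, hh, ?_⟩
  by_cases hJ : ∀ l : Γ → K, (∀ s, ∑ γ, l γ * φ (pderiv s (f γ)) = 0) → l = 0
  · have hind := mem_maximalIdeal_of_sum_mem_sq φ p hφ f hfp hJ
    refine ⟨?_, fun _ l hl γ => hind l hl γ⟩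
    have hm : ∀ γ, algebraMap _ (Localization.AtPrime p) (f γ)
        ∈ maximalIdeal (Localization.AtPrime p) := fun γ => by
      rw [← Localization.AtPrime.map_eq_maximalIdeal]
      exact Ideal.mem_map_of_mem _ (hfp γ)
    have hdim : ringKrullDim (Localization.AtPrime p) = h := by
      rw [IsLocalization.AtPrime.ringKrullDim_eq_height p, hh]
      rfl
    exact card_le_of_regular h hdim _ hm hind
  · push Not at hJ
    obtain ⟨l, hl, hl0⟩ := hJ
    have h1 := hf K φ hfrac (fun γ => (hφ _).2 (hfp γ)) l hl0 hl
    rw [← hpk] at h1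
    constructor
    · omega
    · intro h2
      omega

variable {B : Type*} [CommRing B] (π : MvPolynomial σ k →+* B)

theorem JacobianBound.isRegularLocalRing (hf : JacobianBound f e) (hπ : Function.Surjective π)
    (hker : RingHom.ker π = Ideal.span (Set.range f)) (P : Ideal B) [P.IsPrime] :
    ∃ h : ℕ, (P.comap π).height = h ∧ Fintype.card Γ ≤ h ∧
      (h ≤ Fintype.card Γ + e → IsRegularLocalRing (Localization.AtPrime P) ∧
        ∃ d : ℕ, ringKrullDim (Localization.AtPrime P) = d ∧ d + Fintype.card Γ = h) := by
  have hfp : ∀ γ, f γ ∈ P.comap π := fun γ => by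
    have : f γ ∈ RingHom.ker π := by rw [hker]; exact Ideal.subset_span ⟨γ, rfl⟩
    rw [Ideal.mem_comap, RingHom.mem_ker.1 this]
    exact zero_mem _
  obtain ⟨h, hh, hle, hreg⟩ := hf.regular_of_height_le (P.comap π) hfp
  refine ⟨h, hh, hle, fun h1 => ?_⟩
  have hdim : ringKrullDim (Localization.AtPrime (P.comap π)) = h := by
    rw [IsLocalization.AtPrime.ringKrullDim_eq_height (P.comap π), hh]
    rfl
  refine IsRegularLocalRing.of_surjective h hdim _ (fun γ => ?_) (hreg h1)
    (Localization.localRingHom (P.comap π) P π rfl) (localRingHom_surjective π hπ _ _ _)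
    (ker_localRingHom π hπ f hker _ _ _)
  rw [← Localization.AtPrime.map_eq_maximalIdeal]
  exact Ideal.mem_map_of_mem _ (hfp γ)

end JacobianCriterion

end QuiverMoment

end

noncomputable section

namespace QuiverMoment

/-! ### Dimension, normality and regularity in codimension e. -/

section JacobianCriterion

open IsLocalRing MvPolynomial

theorem IsRegularLocalRing.isIntegrallyClosed_of_ringKrullDim_le_one (R : Type*) [CommRing R]
    [IsRegularLocalRing R] [IsDomain R] (hR : ringKrullDim R ≤ 1) : IsIntegrallyClosed R := by
  have h1 := (IsRegularLocalRing.iff_finrank_cotangentSpace R).1 inferInstance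
  rw [← h1] at hR
  have h2 : Module.finrank (ResidueField R) (CotangentSpace R) ≤ 1 := by exact_mod_cast hR
  have h3 : IsPrincipalIdealRing R :=
    ((tfae_of_isNoetherianRing_of_isLocalRing_of_isDomain R).out 0 5).2 h2
  infer_instance

universe u v w

variable {k : Type u} {σ : Type v} {Γ : Type w} [Field k] [Fintype σ] [DecidableEq σ] [Fintype Γ]
  {f : Γ → MvPolynomial σ k} {e : ℕ} {B : Type*} [CommRing B] (π : MvPolynomial σ k →+* B)

theorem ofList_map_toList {A Γ : Type*} [CommRing A] [Fintype Γ] (f : Γ → A) :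
    Ideal.ofList ((Finset.univ : Finset Γ).toList.map f) = Ideal.span (Set.range f) := by
  refine congrArg Ideal.span (Set.ext fun x => ?_)
  simp [eq_comm]

theorem JacobianBound.card_le_height (hf : JacobianBound f e) (q : Ideal (MvPolynomial σ k))
    [q.IsPrime] (hq : Ideal.span (Set.range f) ≤ q) : (Fintype.card Γ : ℕ∞) ≤ q.height := by
  obtain ⟨h, hh, hle, -⟩ := hf.regular_of_height_le q fun γ => hq (Ideal.subset_span ⟨γ, rfl⟩)
  rw [hh]
  exact_mod_cast hle

variable {π}

theorem JacobianBound.mem_minimalPrimes_of_height_le (hf : JacobianBound f e)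
    (hπ : Function.Surjective π) (hker : RingHom.ker π = Ideal.span (Set.range f))
    (P : Ideal B) [P.IsPrime] (hP : (P.comap π).height ≤ Fintype.card Γ) :
    P ∈ minimalPrimes B := by
  obtain ⟨h, hh, hle, hreg⟩ := hf.isRegularLocalRing π hπ hker P
  rw [hh] at hP
  have hP' : h ≤ Fintype.card Γ := by exact_mod_cast hP
  obtain ⟨-, d, hd, hdh⟩ := hreg (by omega)
  have hd0 : d = 0 := by omega
  rw [IsLocalization.AtPrime.ringKrullDim_eq_height P, hd0] at hd
  rw [← Ideal.height_eq_zero_iff]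
  exact_mod_cast hd

theorem JacobianBound.isDomain_localization (hf : JacobianBound f e)
    (hπ : Function.Surjective π) (hker : RingHom.ker π = Ideal.span (Set.range f))
    (P : Ideal B) [P.IsPrime] (n : ℕ) (hne : n ≤ e) (hn : n ≤ 1)
    (hP : (P.comap π).height ≤ (Fintype.card Γ + n : ℕ)) :
    IsDomain (Localization.AtPrime P) ∧ IsIntegrallyClosed (Localization.AtPrime P) := by
  obtain ⟨h, hh, hle, hreg⟩ := hf.isRegularLocalRing π hπ hker P
  rw [hh] at hP
  have hP' : h ≤ Fintype.card Γ + n := by exact_mod_cast hP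
  obtain ⟨hr, d, hd, hdh⟩ := hreg (by omega)
  obtain ⟨hdom, -⟩ := IsRegularLocalRing.isDomain_and_exists_isRegular d
    (Localization.AtPrime P) hd
  refine ⟨hdom, IsRegularLocalRing.isIntegrallyClosed_of_ringKrullDim_le_one _ ?_⟩
  rw [hd]
  have : d ≤ 1 := by omega
  exact_mod_cast this

theorem JacobianBound.height_comap_le (hf : JacobianBound f e)
    (hπ : Function.Surjective π) (hker : RingHom.ker π = Ideal.span (Set.range f))
    (P : Ideal B) [P.IsPrime] (x : B) (hx : ∀ b, b * x = 0 ↔ b ∈ P) :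
    (P.comap π).height ≤ Fintype.card Γ := by
  obtain ⟨x, rfl⟩ := hπ x
  have := height_le_length_of_annihilator_eq ((Finset.univ : Finset Γ).toList.map f)
    (fun q _ hq => ?_) (P.comap π) x fun a => ?_
  · simpa using this
  · rw [ofList_map_toList] at hq
    simpa using hf.card_le_height q hq
  · rw [ofList_map_toList, ← hker, RingHom.mem_ker, map_mul, hx, Ideal.mem_comap]

/-- Primes of height card Γ over the f_γ become minimal primes of B and consist of zero divisors. So
primes also containing s have height at least card Γ + 1, and unmixedness applies to the longer
sequence. -/
theorem JacobianBound.height_comap_le_of_mem_nonZeroDivisors (hf : JacobianBound f e)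
    (hπ : Function.Surjective π) (hker : RingHom.ker π = Ideal.span (Set.range f))
    (P : Ideal B) [P.IsPrime] (s : B) (hs : s ∈ nonZeroDivisors B) (x : B)
    (hx : ∀ b, b * x ∈ Ideal.span {s} ↔ b ∈ P) :
    (P.comap π).height ≤ (Fintype.card Γ + 1 : ℕ) := by
  obtain ⟨x, rfl⟩ := hπ x
  obtain ⟨s, rfl⟩ := hπ s
  have hmem : ∀ a, a ∈ Ideal.ofList (s :: (Finset.univ : Finset Γ).toList.map f)
      ↔ π a ∈ Ideal.span {π s} := by
    intro a
    rw [Ideal.ofList_cons, ofList_map_toList, ← hker, ← Ideal.mem_comap, ← Set.image_singleton,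
      ← Ideal.map_span, Ideal.comap_map_of_surjective π hπ]
    rfl
  have := height_le_length_of_annihilator_eq (s :: (Finset.univ : Finset Γ).toList.map f)
    (fun q hqp hq => ?_) (P.comap π) x fun a => ?_
  · simpa using this
  · rw [Ideal.ofList_cons, ofList_map_toList] at hq
    have hq1 : Ideal.span (Set.range f) ≤ q := le_sup_right.trans hq
    have hq2 : s ∈ q := hq (Ideal.mem_sup_left (Ideal.mem_span_singleton_self s))
    have hQ : (q.map π).IsPrime := Ideal.map_isPrime_of_surjective hπ (hker.le.trans hq1)
    have hcomap : (q.map π).comap π = q := by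
      rw [Ideal.comap_map_of_surjective π hπ]
      exact sup_eq_left.2 (hker.le.trans hq1)
    have h1 := hf.card_le_height q hq1
    have h2 : ¬ q.height ≤ Fintype.card Γ := fun h => by
      rw [← hcomap] at h
      have h3 := hf.mem_minimalPrimes_of_height_le hπ hker (q.map π) h
      exact Set.disjoint_left.1 (Ideal.disjoint_nonZeroDivisors_of_mem_minimalPrimes h3)
        (Ideal.mem_map_of_mem π hq2) hs
    have h3 : (Fintype.card Γ : ℕ∞) + 1 ≤ q.height := Order.add_one_le_of_lt (not_le.1 h2)
    simpa using h3
  · rw [hmem, map_mul, hx, Ideal.mem_comap]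

/-- Domain and normality criterion for homogeneous polynomials satisfying the Jacobian bound. -/
theorem JacobianBound.isDomain_and_isIntegrallyClosed [Nontrivial B] (hf : JacobianBound f e)
    (he : 1 ≤ e)
    (hπ : Function.Surjective π) (hker : RingHom.ker π = Ideal.span (Set.range f)) (m : ℕ)
    (hm : ∀ γ, (f γ).IsHomogeneous m) : IsDomain B ∧ IsIntegrallyClosed B := by
  have hB : IsNoetherianRing B := isNoetherianRing_of_surjective _ _ π hπ
  refine QuiverMoment.isDomain_and_isIntegrallyClosed (fun P _ x hx => ?_) (fun s hs P _ x hx => ?_)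
    (eq_zero_or_one_of_mul_self_eq π hπ f hker m hm)
  · have h := hf.height_comap_le hπ hker P x hx
    exact ⟨hf.mem_minimalPrimes_of_height_le hπ hker P h,
      (hf.isDomain_localization hπ hker P 0 (Nat.zero_le _) zero_le_one (by simpa using h)).1⟩
  · exact hf.isDomain_localization hπ hker P 1 he le_rfl
      (hf.height_comap_le_of_mem_nonZeroDivisors hπ hker P s hs x hx)

theorem spanFinrank_span_range_le {A Γ : Type*} [CommRing A] [Fintype Γ] (f : Γ → A) :
    (Ideal.span (Set.range f)).spanFinrank ≤ Fintype.card Γ := by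
  refine (Submodule.spanFinrank_span_le_ncard_of_finite (Set.finite_range f)).trans ?_
  rw [← Set.image_univ]
  refine (Set.ncard_image_le Set.finite_univ).trans ?_
  rw [Set.ncard_univ, Nat.card_eq_fintype_card]

/-- Krull's height theorem: card Γ equations raise the height of the pulled-back prime by at most
card Γ. -/
theorem JacobianBound.isRegularInCodim (hf : JacobianBound f e)
    (hπ : Function.Surjective π) (hker : RingHom.ker π = Ideal.span (Set.range f)) :
    IsRegularInCodim B e := by
  intro P hP hPe
  obtain ⟨h, hh, hle, hreg⟩ := hf.isRegularLocalRing π hπ hker P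
  refine (hreg ?_).1
  have h1 : (P.comap π).height
      ≤ ((P.comap π).map (Ideal.Quotient.mk (RingHom.ker π))).height
        + (RingHom.ker π).spanFinrank :=
    Ideal.height_le_height_add_spanFinrank_of_le (fun a ha => by
      rw [Ideal.mem_comap, RingHom.mem_ker.1 ha]; exact zero_mem _)
  have h2 : (P.comap π).map (Ideal.Quotient.mk (RingHom.ker π))
      = P.comap (RingHom.quotientKerEquivOfSurjective hπ) := by
    ext y
    obtain ⟨y, rfl⟩ := Ideal.Quotient.mk_surjective y
    rw [Ideal.mem_comap]
    constructor
    · intro hy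
      obtain ⟨z, hz, hzy⟩ := (Ideal.mem_map_iff_of_surjective _ Ideal.Quotient.mk_surjective).1 hy
      rw [← hzy]
      exact hz
    · intro hy
      exact Ideal.mem_map_of_mem _ (Ideal.mem_comap.2 hy)
  rw [h2, RingEquiv.height_comap, hh] at h1
  have h3 : (RingHom.ker π).spanFinrank ≤ Fintype.card Γ := by
    rw [hker]; exact spanFinrank_span_range_le f
  have h4 : (h : ℕ∞) ≤ (e : ℕ∞) + (Fintype.card Γ : ℕ∞) :=
    h1.trans (add_le_add hPe (by exact_mod_cast h3))
  have h5 : h ≤ e + Fintype.card Γ := by exact_mod_cast h4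
  omega

/-- The upper bound comes from heights of primes over the f_γ. The lower bound is taken at the
origin, a prime with zero tangent space and therefore of height card σ. -/
theorem JacobianBound.ringKrullDim_add_card (hf : JacobianBound f e)
    (hπ : Function.Surjective π) (hker : RingHom.ker π = Ideal.span (Set.range f))
    (hf0 : ∀ γ, constantCoeff (f γ) = 0) :
    ringKrullDim B + Fintype.card Γ = Fintype.card σ := by
  apply le_antisymm
  · refine ringKrullDim_add_le_of_surjective π hπ _ _ (fun p _ hp => ?_) ?_
    · rw [hker] at hp
      exact hf.card_le_height p hp
    · rw [MvPolynomial.ringKrullDim_of_isNoetherianRing, ringKrullDim_eq_zero_of_field]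
      simp
  · have hprime : (RingHom.ker (constantCoeff (σ := σ) (R := k))).IsPrime :=
      RingHom.ker_isPrime _
    obtain ⟨h, hh, hle⟩ := card_le_height_add_finrank_tangent (constantCoeff (σ := σ) (R := k))
      (RingHom.ker constantCoeff) fun g => Iff.rfl
    have ht : tangent (constantCoeff (σ := σ) (R := k)) (RingHom.ker constantCoeff) = ⊥ := by
      rw [eq_bot_iff]
      intro v hv
      rw [Submodule.mem_bot]
      funext s
      rw [mem_tangent] at hv
      have := hv (X s) (by simp)
      rwa [dirDeriv_X] at this
    rw [ht, finrank_bot, add_zero] at hle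
    have h1 := height_le_ringKrullDim_quotient_add_spanFinrank
      (p := RingHom.ker (constantCoeff (σ := σ) (R := k))) (I := RingHom.ker π) (by
        rw [hker, Ideal.span_le]
        rintro _ ⟨γ, rfl⟩
        exact hf0 γ)
    rw [hh, ringKrullDim_eq_of_ringEquiv (RingHom.quotientKerEquivOfSurjective hπ)] at h1
    have h3 : (RingHom.ker π).spanFinrank ≤ Fintype.card Γ := by
      rw [hker]; exact spanFinrank_span_range_le f
    calc ((Fintype.card σ : ℕ) : WithBot ℕ∞) ≤ ((h : ℕ∞) : WithBot ℕ∞) := by exact_mod_cast hle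
      _ ≤ _ := h1
      _ ≤ _ := by gcongr

end JacobianCriterion

end QuiverMoment

end

/-! ### Doubled quivers and the momentum map in matrix coordinates. -/

noncomputable section

namespace QuiverMoment

/-- A doubled quiver with vertices `ι` and arrows `Q`. The involution `τ` exchanges the two arrows
of a pair, one of which is positive. -/
structure DoubledQuiver (ι Q : Type*) where
  s : Q → ι
  t : Q → ι
  τ : Q → Q
  pos : Q → Bool
  τ_τ : ∀ β, τ (τ β) = β
  pos_τ : ∀ β, pos (τ β) = !pos β
  s_τ : ∀ β, s (τ β) = t β
  t_τ : ∀ β, t (τ β) = s β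

namespace DoubledQuiver

open MvPolynomial

universe u v w

section Moment

variable {ι Q I : Type*} (𝒬 : DoubledQuiver ι Q) (ν : I → ι)

/-- The sign of an arrow. -/
def sign (R : Type*) [Ring R] (β : Q) : R := if 𝒬.pos β = true then 1 else -1

theorem sign_τ (R : Type*) [Ring R] (β : Q) : 𝒬.sign R (𝒬.τ β) = - 𝒬.sign R β := by
  rw [sign, sign, 𝒬.pos_τ]
  cases 𝒬.pos β <;> simp

theorem map_sign {R S : Type*} [Ring R] [Ring S] (φ : R →+* S) (β : Q) :
    φ (𝒬.sign R β) = 𝒬.sign S β := by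
  rw [sign, sign]
  split_ifs <;> simp

/-- The involution on the arrows as a permutation. -/
def τEquiv : Q ≃ Q := ⟨𝒬.τ, 𝒬.τ, 𝒬.τ_τ, 𝒬.τ_τ⟩

/-- The matrix entries of the representations of the quiver. -/
abbrev Coord : Type _ := Σ β : Q, {p // ν p = 𝒬.t β} × {q // ν q = 𝒬.s β}

variable {𝒬 ν} in
/-- The matrices with given entries. -/
def toMat [DecidableEq ι] {R : Type*} [Zero R] (x : 𝒬.Coord ν → R) (β : Q) : Matrix I I R :=
  Matrix.of fun p q => if h : ν p = 𝒬.t β ∧ ν q = 𝒬.s β then x ⟨β, ⟨p, h.1⟩, ⟨q, h.2⟩⟩ else 0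

variable [DecidableEq ι] {R : Type*}

theorem toMat_apply [Zero R] (x : 𝒬.Coord ν → R) (β : Q) (p q : I) : toMat x β p q =
    if h : ν p = 𝒬.t β ∧ ν q = 𝒬.s β then x ⟨β, ⟨p, h.1⟩, ⟨q, h.2⟩⟩ else 0 := rfl

theorem toMat_apply_coe [Zero R] (x : 𝒬.Coord ν → R) (c : 𝒬.Coord ν) :
    toMat x c.1 c.2.1 c.2.2 = x c := by
  rw [toMat_apply, dif_pos ⟨c.2.1.2, c.2.2.2⟩]

theorem toMat_add [AddZeroClass R] (x y : 𝒬.Coord ν → R) (β : Q) :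
    toMat (x + y) β = toMat x β + toMat y β := by
  ext p q
  simp only [toMat_apply, Matrix.add_apply]
  split_ifs <;> simp

theorem toMat_smul [MulZeroClass R] (c : R) (x : 𝒬.Coord ν → R) (β : Q) :
    toMat (c • x) β = c • toMat x β := by
  ext p q
  simp only [toMat_apply, Matrix.smul_apply]
  split_ifs <;> simp

theorem map_toMat {S F : Type*} [Zero R] [Zero S] [FunLike F R S] [ZeroHomClass F R S] (φ : F)
    (x : 𝒬.Coord ν → R) (β : Q) : (toMat x β).map φ = toMat (fun c => φ (x c)) β := by
  ext p q
  simp only [toMat_apply, Matrix.map_apply]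
  split_ifs <;> simp

theorem toMat_injective [Zero R] :
    Function.Injective (toMat : (𝒬.Coord ν → R) → Q → Matrix I I R) := fun x y h => by
  funext c
  rw [← 𝒬.toMat_apply_coe ν x, h, 𝒬.toMat_apply_coe ν y]

theorem toMat_mem_blk {K : Type*} [Field K] (x : 𝒬.Coord ν → K) (β : Q) :
    toMat x β ∈ blk K ν (𝒬.t β) (𝒬.s β) := fun p q h => by
  by_contra hne
  exact h (by rw [toMat_apply, dif_neg hne])

theorem exists_toMat_eq {K : Type*} [Field K] (w : Q → Matrix I I K)
    (hw : ∀ β, w β ∈ blk K ν (𝒬.t β) (𝒬.s β)) : ∃ x : 𝒬.Coord ν → K, toMat x = w := by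
  refine ⟨fun c => w c.1 c.2.1 c.2.2, ?_⟩
  funext β
  ext p q
  rw [toMat_apply]
  split_ifs with h
  · rfl
  · by_contra hne
    exact h (hw β p q (Ne.symm hne))

variable [Fintype Q] [DecidableEq Q] [Fintype I] [DecidableEq I]

/-- The momentum map on matrices. -/
def momentMat [Ring R] (x : Q → Matrix I I R) : Matrix I I R :=
  ∑ β, 𝒬.sign R β • (x β * x (𝒬.τ β))

/-- Exchanging β and τβ flips the sign and leaves the trace of the product unchanged. -/
theorem trace_momentMat [CommRing R] (x : Q → Matrix I I R) :
    (𝒬.momentMat x).trace = - (𝒬.momentMat x).trace := by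
  rw [momentMat, Matrix.trace_sum]
  conv_rhs => rw [← 𝒬.τEquiv.sum_comp]
  rw [← Finset.sum_neg_distrib]
  refine Finset.sum_congr rfl fun β _ => ?_
  change _ = - Matrix.trace (𝒬.sign R (𝒬.τ β) • (x (𝒬.τ β) * x (𝒬.τ (𝒬.τ β))))
  rw [𝒬.τ_τ, sign_τ, neg_smul, Matrix.trace_neg, neg_neg, Matrix.trace_smul, Matrix.trace_smul,
    Matrix.trace_mul_comm]

theorem momentMat_apply_eq_zero {K : Type*} [Field K] (x : 𝒬.Coord ν → K) (p q : I)
    (h : ν p ≠ ν q) : 𝒬.momentMat (toMat x) p q = 0 := by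
  rw [momentMat, Matrix.sum_apply]
  refine Finset.sum_eq_zero fun β _ => ?_
  by_contra hne
  have h1 : (toMat x β * toMat x (𝒬.τ β)) ∈ blk K ν (𝒬.t β) (𝒬.t β) := by
    refine mul_mem_blk (𝒬.toMat_mem_blk ν x β) ?_
    have := 𝒬.toMat_mem_blk ν x (𝒬.τ β)
    rwa [𝒬.t_τ, 𝒬.s_τ] at this
  have h2 := h1 p q (right_ne_zero_of_mul hne)
  exact h (h2.1.trans h2.2.symm)

theorem map_momentMat {S : Type*} [Ring R] [Ring S] (φ : R →+* S) (x : Q → Matrix I I R) :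
    (𝒬.momentMat x).map φ = 𝒬.momentMat fun β => (x β).map φ := by
  ext p q
  simp only [momentMat, Matrix.map_apply, Matrix.sum_apply, map_sum, Matrix.smul_apply, smul_eq_mul,
    map_mul, map_sign, Matrix.mul_apply]

/-- The positions of the matrix entries of the momentum map, without a redundant one. -/
abbrev Eqn (ν : I → ι) (p₀ : I) : Type _ := {r : I × I // ν r.1 = ν r.2 ∧ r ≠ (p₀, p₀)}

variable (k : Type u) [Field k] {ν}

/-- The components of the momentum map as polynomials. -/
def momentPoly (p₀ : I) (γ : Eqn ν p₀) : MvPolynomial (𝒬.Coord ν) k :=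
  𝒬.momentMat (toMat X) γ.1.1 γ.1.2

theorem isHomogeneous_momentPoly (p₀ : I) (γ : Eqn ν p₀) :
    (𝒬.momentPoly k p₀ γ).IsHomogeneous 2 := by
  have h1 : ∀ β p q, (toMat (X : 𝒬.Coord ν → MvPolynomial (𝒬.Coord ν) k) β p q).IsHomogeneous 1 := by
    intro β p q
    rw [toMat_apply]
    split_ifs
    · exact isHomogeneous_X _ _
    · exact isHomogeneous_zero _ _ _
  rw [momentPoly, momentMat, Matrix.sum_apply]
  refine IsHomogeneous.sum _ _ _ fun β _ => ?_
  rw [Matrix.smul_apply, Matrix.mul_apply, smul_eq_mul, ← map_sign (𝒬) C, ← zero_add 2]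
  refine (isHomogeneous_C _ _).mul ?_
  exact IsHomogeneous.sum _ _ _ fun r _ => (h1 _ _ _).mul (h1 _ _ _)

/-- The omitted entry at (p₀, p₀) is recovered from the vanishing trace; entries between different
vertices vanish automatically. -/
theorem momentMat_eq_zero {K : Type*} [Field K] (h2 : (2 : K) ≠ 0) (p₀ : I) (x : 𝒬.Coord ν → K)
    (hx : ∀ γ : Eqn ν p₀, 𝒬.momentMat (toMat x) γ.1.1 γ.1.2 = 0) :
    𝒬.momentMat (toMat x) = 0 := by
  have h3 : ∀ p q, (p, q) ≠ (p₀, p₀) → 𝒬.momentMat (toMat x) p q = 0 := by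
    intro p q hpq
    by_cases h : ν p = ν q
    · exact hx ⟨(p, q), h, hpq⟩
    · exact 𝒬.momentMat_apply_eq_zero ν x p q h
  have h4 : (𝒬.momentMat (toMat x)).trace = 0 := by
    have := 𝒬.trace_momentMat (toMat x)
    have h5 : (2 : K) * (𝒬.momentMat (toMat x)).trace = 0 := by linear_combination this
    exact (mul_eq_zero.1 h5).resolve_left h2
  rw [Matrix.trace, Finset.sum_eq_single p₀] at h4
  · ext p q
    by_cases h : (p, q) = (p₀, p₀)
    · obtain ⟨rfl, rfl⟩ := Prod.mk.inj h
      exact h4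
    · exact h3 p q h
  · intro p _ hp
    exact h3 p p fun h => hp (Prod.mk.inj h).1
  · simp

theorem card_eqn_add_one [Fintype ι] (K : Type*) [Field K] (p₀ : I) :
    Fintype.card (Eqn ν p₀) + 1 = Module.finrank K (blkDiag K ν : Submodule K (Matrix I I K)) := by
  have h1 : Fintype.card {r : I × I // ν r.1 = ν r.2}
      = Module.finrank K (blkDiag K ν : Submodule K (Matrix I I K)) := by
    rw [← sum_ddim_self]
    simp only [ddim_eq, ← Fintype.card_prod]
    rw [← Fintype.card_sigma]
    exact Fintype.card_congr
      { toFun := fun r => ⟨ν r.1.1, ⟨r.1.1, rfl⟩, ⟨r.1.2, r.2.symm⟩⟩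
        invFun := fun c => ⟨(c.2.1.1, c.2.2.1), c.2.1.2.trans c.2.2.2.symm⟩
        left_inv := fun r => rfl
        right_inv := fun ⟨i, ⟨p, hp⟩, ⟨q, hq⟩⟩ => by subst hp; rfl }
  have h2 : (Finset.univ.filter fun r : I × I => ν r.1 = ν r.2 ∧ r ≠ (p₀, p₀))
      = (Finset.univ.filter fun r : I × I => ν r.1 = ν r.2).erase (p₀, p₀) := by
    ext r
    simp [and_comm]
  rw [← h1, Fintype.card_subtype, Fintype.card_subtype, h2, Finset.card_erase_add_one (by simp)]

theorem card_coord [Fintype ι] (K : Type*) [Field K] :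
    Fintype.card (𝒬.Coord ν) = ∑ β, ddim K ν (𝒬.t β) (𝒬.s β) := by
  rw [Fintype.card_sigma]
  exact Finset.sum_congr rfl fun β _ => by rw [ddim_eq, Fintype.card_prod]

theorem dirDeriv_momentMat {K : Type*} [Field K] (φ : MvPolynomial (𝒬.Coord ν) k →+* K)
    (v : 𝒬.Coord ν → K) (p q : I) :
    dirDeriv φ v (𝒬.momentMat (toMat X) p q)
      = ∑ β, 𝒬.sign K β * ((toMat (fun c => φ (X c)) β * toMat v (𝒬.τ β)
        + toMat v β * toMat (fun c => φ (X c)) (𝒬.τ β)) p q) := by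
  have h1 : ∀ β p q, dirDeriv φ v (toMat (X : 𝒬.Coord ν → MvPolynomial (𝒬.Coord ν) k) β p q)
      = toMat v β p q := by
    intro β p q
    rw [toMat_apply, toMat_apply]
    split_ifs
    · rw [dirDeriv_X]
    · rw [dirDeriv_zero]
  have h2 : ∀ β p q, φ (toMat (X : 𝒬.Coord ν → MvPolynomial (𝒬.Coord ν) k) β p q)
      = toMat (fun c => φ (X c)) β p q := fun β p q => by
    rw [← 𝒬.map_toMat]; rfl
  have h3 : ∀ β g, dirDeriv φ v (𝒬.sign (MvPolynomial (𝒬.Coord ν) k) β * g)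
      = 𝒬.sign K β * dirDeriv φ v g := fun β g => by
    rw [sign, sign]
    split_ifs
    · rw [one_mul, one_mul]
    · have := dirDeriv_mul φ v (-1) g
      have h4 := dirDeriv_add φ v 1 (-1)
      rw [add_neg_cancel, dirDeriv_zero, dirDeriv_one, zero_add] at h4
      rw [this, ← h4, mul_zero, add_zero, map_neg, map_one]
  rw [momentMat, Matrix.sum_apply, dirDeriv_sum]
  refine Finset.sum_congr rfl fun β _ => ?_
  rw [Matrix.smul_apply, smul_eq_mul, h3, Matrix.mul_apply, dirDeriv_sum, Matrix.add_apply,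
    Matrix.mul_apply, Matrix.mul_apply, ← Finset.sum_add_distrib]
  congr 1
  refine Finset.sum_congr rfl fun r _ => ?_
  rw [dirDeriv_mul, h1, h1, h2, h2]
  ring

variable {k} in
/-- The matrix with entries `l` pairs with the momentum map by the trace form. -/
theorem exists_mem_stab_of_jacobian {K : Type*} [Field K]
    (φ : MvPolynomial (𝒬.Coord ν) k →+* K) (p₀ : I) (l : Eqn ν p₀ → K) (hl0 : l ≠ 0)
    (hl : ∀ c, ∑ γ, l γ * φ (pderiv c (𝒬.momentPoly k p₀ γ)) = 0) :
    ∃ a ∈ stab ν (toMat fun c => φ (X c) : Q → Matrix I I K), ∀ c : K, a ≠ algebraMap K _ c := by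
  set u : Q → Matrix I I K := toMat fun c => φ (X c) with hu
  -- The relation placed in transposed position, to pair with μ by the trace form. Its entry at (p₀,
  -- p₀) is 0, so a scalar a must be 0 and cannot come from `l ≠ 0`.
  let a : Matrix I I K := Matrix.of fun q p =>
    if h : ν p = ν q ∧ (p, q) ≠ (p₀, p₀) then l ⟨(p, q), h⟩ else 0
  have ha : ∀ q p, a q p = if h : ν p = ν q ∧ (p, q) ≠ (p₀, p₀) then l ⟨(p, q), h⟩ else 0 :=
    fun _ _ => rfl
  have haγ : ∀ γ : Eqn ν p₀, a γ.1.2 γ.1.1 = l γ := fun γ => by rw [ha, dif_pos γ.2]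
  have haD : a ∈ blkDiag K ν := fun q p h => by
    by_contra hne
    exact h (by rw [ha, dif_neg fun h => hne h.1.symm])
  have htr : ∀ m : Matrix I I K, ∑ γ : Eqn ν p₀, l γ * m γ.1.1 γ.1.2 = trForm a m := by
    intro m
    rw [trForm_apply, Matrix.trace]
    simp only [Matrix.diag_apply, Matrix.mul_apply]
    rw [← Fintype.sum_prod_type' (f := fun q p => a q p * m p q),
      ← (Equiv.prodComm I I).sum_comp]
    simp only [Equiv.prodComm_apply, Prod.fst_swap, Prod.snd_swap]
    let F : I × I → K := fun r => a r.2 r.1 * m r.1 r.2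
    have h1 := Finset.sum_subtype (F := (inferInstance : Fintype (Eqn ν p₀))) (p := fun r : I × I => ν r.1 = ν r.2 ∧ r ≠ (p₀, p₀))
      (Finset.univ.filter fun r : I × I => ν r.1 = ν r.2 ∧ r ≠ (p₀, p₀)) (fun r => by simp) F
    rw [Finset.sum_filter_of_ne fun r _ hr => ?_] at h1
    · refine Eq.trans ?_ h1.symm
      exact Finset.sum_congr rfl fun γ _ => by rw [← haγ]
    · by_contra hne
      exact left_ne_zero_of_mul hr (by rw [ha, dif_neg hne])
  have hpair : ∀ v : 𝒬.Coord ν → K, ∑ β, 𝒬.sign K β *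
      trForm (u (𝒬.τ β) * a - a * u (𝒬.τ β)) (toMat v β) = 0 := by
    intro v
    have h1 : ∑ γ : Eqn ν p₀, l γ * dirDeriv φ v (𝒬.momentPoly k p₀ γ) = 0 := by
      simp only [dirDeriv, Finset.mul_sum]
      rw [Finset.sum_comm]
      refine Finset.sum_eq_zero fun c _ => ?_
      simp only [← mul_assoc]
      rw [← Finset.sum_mul, hl, zero_mul]
    have h2 : trForm a (∑ β, 𝒬.sign K β • (u β * toMat v (𝒬.τ β) + toMat v β * u (𝒬.τ β))) = 0 := by
      rw [← htr, ← h1]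
      refine Finset.sum_congr rfl fun γ _ => ?_
      rw [momentPoly, dirDeriv_momentMat, Matrix.sum_apply]
      simp only [Matrix.smul_apply, smul_eq_mul]
      rfl
    have h3 : ∑ β, 𝒬.sign K β * trForm a (u β * toMat v (𝒬.τ β))
        = ∑ β, - (𝒬.sign K β * trForm a (u (𝒬.τ β) * toMat v β)) := by
      rw [← 𝒬.τEquiv.sum_comp]
      refine Finset.sum_congr rfl fun β _ => ?_
      change 𝒬.sign K (𝒬.τ β) * trForm a (u (𝒬.τ β) * toMat v (𝒬.τ (𝒬.τ β))) = _
      rw [𝒬.τ_τ, sign_τ, neg_mul]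
    simp only [map_sum, map_smul, map_add, smul_eq_mul, mul_add, Finset.sum_add_distrib] at h2
    rw [h3, ← Finset.sum_add_distrib] at h2
    rw [← h2]
    refine Finset.sum_congr rfl fun β _ => ?_
    simp only [trForm_apply, Matrix.sub_mul, Matrix.trace_sub]
    rw [Matrix.mul_assoc a, Matrix.mul_assoc, Matrix.trace_mul_comm (u (𝒬.τ β)), Matrix.mul_assoc]
    ring
  have hcomm : ∀ β, u (𝒬.τ β) * a - a * u (𝒬.τ β) = 0 := by
    intro β
    have huτ : u (𝒬.τ β) ∈ blk K ν (𝒬.s β) (𝒬.t β) := by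
      have := 𝒬.toMat_mem_blk ν (fun c => φ (X c)) (𝒬.τ β)
      rwa [𝒬.t_τ, 𝒬.s_τ] at this
    refine eq_zero_of_trForm_blk (i := 𝒬.t β) (j := 𝒬.s β)
      (sub_mem (mul_mem_blk_of_right haD huτ) (mul_mem_blk_of_left haD huτ)) fun b hb => ?_
    -- Testing with a direction v supported on the single arrow β isolates the commutator of a with
    -- u_{τβ}.
    obtain ⟨v, hv⟩ := 𝒬.exists_toMat_eq (ν := ν) (Pi.single β b : Q → Matrix I I K) fun β' => by
      by_cases h : β' = β
      · subst h; rwa [Pi.single_eq_same]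
      · rw [Pi.single_eq_of_ne h]; exact zero_mem _
    have h1 := hpair v
    rw [hv, Finset.sum_eq_single β (fun β' _ h => by
      rw [Pi.single_eq_of_ne h, map_zero, mul_zero]) (by simp), Pi.single_eq_same] at h1
    rw [trForm_comm]
    refine (mul_eq_zero.1 h1).resolve_left ?_
    rw [sign]
    split_ifs <;> simp
  refine ⟨a, mem_stab.2 ⟨haD, fun β => ?_⟩, fun c hc => ?_⟩
  · have := hcomm (𝒬.τ β)
    rw [𝒬.τ_τ] at this
    exact (sub_eq_zero.1 this).symm
  · have h1 : c = 0 := by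
      have := congrFun (congrFun hc p₀) p₀
      rw [ha, dif_neg (by simp)] at this
      rw [Matrix.algebraMap_matrix_apply, if_pos rfl] at this
      exact this.symm
    refine hl0 (funext fun γ => ?_)
    rw [← haγ, hc, h1, map_zero]
    rfl

variable [Fintype ι] [Infinite k]

/-- A degenerate Jacobian matrix yields a non-scalar stabilizer, tangent vectors yield derivations,
and the codimension bound applies over the residue field. -/
theorem jacobianBound_momentPoly (h2 : (2 : k) ≠ 0) (d : ι → ι → ℕ)
    (hd : ∀ i j, (Finset.univ.filter fun β => 𝒬.t β = i ∧ 𝒬.s β = j).card = d i j)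
    (hd2 : ∀ i j, (if i = j then 4 else 2) ≤ d i j) (p₀ : I) :
    JacobianBound (𝒬.momentPoly (ν := ν) k p₀) 2 ∧
    ((Fintype.card I = 2 → ∀ p q, p ≠ q → (if ν p = ν q then 5 else 3) ≤ d (ν p) (ν q)) →
      JacobianBound (𝒬.momentPoly (ν := ν) k p₀) 3) := by
  have key : ∀ (K : Type (max u (max u_3 u_2))) [Field K] (φ : MvPolynomial (𝒬.Coord ν) k →+* K),
      (∀ x : K, ∃ a b, φ b ≠ 0 ∧ x * φ b = φ a) → (∀ γ, φ (𝒬.momentPoly k p₀ γ) = 0) →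
      ∀ l : Eqn ν p₀ → K, l ≠ 0 → (∀ c : 𝒬.Coord ν, ∑ γ, l γ * φ (pderiv c (𝒬.momentPoly k p₀ γ)) = 0) →
      Module.finrank K (tangent φ (RingHom.ker φ)) + Fintype.card (Eqn ν p₀) + 3
        ≤ Fintype.card (𝒬.Coord ν) ∧
      ((Fintype.card I = 2 → ∀ p q, p ≠ q → (if ν p = ν q then 5 else 3) ≤ d (ν p) (ν q)) →
        Module.finrank K (tangent φ (RingHom.ker φ)) + Fintype.card (Eqn ν p₀) + 4
        ≤ Fintype.card (𝒬.Coord ν)) := by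
    intro K _ φ hfrac hφ l hl0 hl
    obtain ⟨a, ha, hns⟩ := 𝒬.exists_mem_stab_of_jacobian φ p₀ l hl0 hl
    have hKinf : Infinite K := Infinite.of_injective _ (φ.comp C).injective
    have hK2 : (2 : K) ≠ 0 := by
      have := (map_ne_zero (φ.comp C)).2 h2
      rwa [map_ofNat] at this
    have hx : ∀ p q, φ (𝒬.momentMat (toMat X) p q) = 𝒬.momentMat (toMat fun c => φ (X c)) p q := by
      intro p q
      have h1 := 𝒬.map_momentMat φ (toMat (X : 𝒬.Coord ν → MvPolynomial (𝒬.Coord ν) k))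
      simp only [map_toMat] at h1
      exact congrFun (congrFun h1 p) q
    have hμ : 𝒬.momentMat (toMat fun c => φ (X c) : Q → Matrix I I K) = 0 :=
      𝒬.momentMat_eq_zero hK2 p₀ _ fun γ => by rw [← hx]; exact hφ γ
    let L : (𝒬.Coord ν → K) →ₗ[K] (Q → Matrix I I K) :=
      { toFun := toMat
        map_add' := fun x y => funext fun β => 𝒬.toMat_add ν x y β
        map_smul' := fun c x => funext fun β => 𝒬.toMat_smul ν c x β }
    have hL : Function.Injective L := 𝒬.toMat_injective ν
    have hT := finrank_tangent_add_le (fun β => 𝒬.pos β = true) 𝒬.τ 𝒬.τ_τ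
      (fun β => by rw [𝒬.pos_τ]; simp) 𝒬.s 𝒬.t 𝒬.s_τ 𝒬.t_τ d hd hd2
      (toMat fun c : 𝒬.Coord ν => φ (X c)) (fun β => 𝒬.toMat_mem_blk ν _ β) hμ
      ((tangent φ (RingHom.ker φ)).map L) (by
        rintro _ ⟨v, -, rfl⟩ β
        exact 𝒬.toMat_mem_blk ν _ β) (by
        rintro _ ⟨v, hv, rfl⟩
        obtain ⟨D, hD⟩ := exists_derivation_of_mem_tangent φ (RingHom.ker φ) (fun g => Iff.rfl)
          hfrac v hv
        refine ⟨D, fun β => ?_⟩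
        rw [map_toMat]
        simp only [hD]
        rfl) a ha hns
    -- There are dim g - 1 equations, so the gains 2 and 3 over dim g become 3 and 4 over the number
    -- of equations, that is e + 1 for e = 2 and e = 3.
    rw [LinearEquiv.finrank_eq (Submodule.equivMapOfInjective L hL _).symm,
      ← card_coord 𝒬 K, ← card_eqn_add_one K p₀] at hT
    exact ⟨by omega, fun h => by have := hT.2 h; omega⟩
  refine ⟨fun K _ φ hfrac hφ l hl0 hl => ?_, fun h K _ φ hfrac hφ l hl0 hl => ?_⟩
  · have := (key K φ hfrac hφ l hl0 hl).1
    omega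
  · have := (key K φ hfrac hφ l hl0 hl).2 h
    omega

end Moment

end DoubledQuiver

end QuiverMoment

end

noncomputable section

namespace QuiverMoment

/-! ### Symplectic bases. -/

section Darboux

variable {U : Type*} [AddCommGroup U] [Module ℂ U]

/-- The vectors `e k` form a symplectic system: `e k` is paired with `e (τ k)` only. -/
structure IsDarboux (B : U →ₗ[ℂ] U →ₗ[ℂ] ℂ) {J : Type} [DecidableEq J] (τ : J → J) (ε : J → Bool)
    (e : J → U) : Prop where
  τ_τ : ∀ k, τ (τ k) = k
  ε_τ : ∀ k, ε (τ k) = !ε k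
  apply : ∀ k l, B (e k) (e l) = if l = τ k then (if ε k = true then 1 else -1) else 0

variable {B : U →ₗ[ℂ] U →ₗ[ℂ] ℂ} {J : Type} [DecidableEq J] [Fintype J] {τ : J → J} {ε : J → Bool}
  {e : J → U}

theorem IsDarboux.apply_sum (h : IsDarboux B τ ε e) (c : J → ℂ) (l : J) :
    B (e l) (∑ k, c k • e k) = c (τ l) * if ε l = true then 1 else -1 := by
  simp only [map_sum, map_smul, h.apply, smul_eq_mul]
  rw [Finset.sum_eq_single (τ l) (fun k _ hk => by rw [if_neg hk, mul_zero]) (by simp), if_pos rfl]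

theorem IsDarboux.linearIndependent (h : IsDarboux B τ ε e) : LinearIndependent ℂ e := by
  rw [Fintype.linearIndependent_iff]
  intro c hc k
  have h1 := h.apply_sum c (τ k)
  rw [hc, map_zero, h.τ_τ] at h1
  refine (mul_eq_zero.1 h1.symm).resolve_right ?_
  split_ifs <;> simp

theorem IsDarboux.exists_orthogonal (h : IsDarboux B τ ε e) (x : U) :
    ∃ z ∈ Submodule.span ℂ (Set.range e), ∀ l, B (e l) (x - z) = 0 := by
  refine ⟨∑ k, ((if ε (τ k) = true then 1 else -1) * B (e (τ k)) x) • e k,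
    sum_mem fun k _ => Submodule.smul_mem _ _ (Submodule.subset_span ⟨k, rfl⟩), fun l => ?_⟩
  rw [map_sub, h.apply_sum, h.τ_τ]
  split_ifs <;> simp

/-- Take a vector outside the span, make it orthogonal to the system, find a partner by
nondegeneracy, orthogonalize and rescale it. The new hyperbolic pair is indexed by `Bool`. -/
theorem IsDarboux.extend (h : IsDarboux B τ ε e) (hB : ∀ x y, B x y = - B y x)
    (hnd : B.SeparatingLeft) (hs : Submodule.span ℂ (Set.range e) ≠ ⊤) :
    ∃ (τ' : J ⊕ Bool → J ⊕ Bool) (ε' : J ⊕ Bool → Bool) (e' : J ⊕ Bool → U),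
      IsDarboux B τ' ε' e' := by
  have hBx : ∀ x, B x x = 0 := fun x => self_eq_neg.1 (hB x x)
  obtain ⟨x₀, hx₀⟩ : ∃ x, x ∉ Submodule.span ℂ (Set.range e) := by
    by_contra! hcon
    exact hs (eq_top_iff.2 fun x _ => hcon x)
  obtain ⟨z, hz, hzx⟩ := h.exists_orthogonal x₀
  obtain ⟨x, hx⟩ : ∃ x, x = x₀ - z := ⟨_, rfl⟩
  rw [← hx] at hzx
  have hx0 : x ≠ 0 := fun h0 => hx₀ (by rw [hx] at h0; rwa [sub_eq_zero.1 h0])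
  have hxe : ∀ l, B x (e l) = 0 := fun l => by rw [hB, hzx, neg_zero]
  obtain ⟨y₀, hy₀⟩ : ∃ y, B x y ≠ 0 := by
    by_contra! hcon
    exact hx0 (hnd x hcon)
  obtain ⟨z', hz', hzy⟩ := h.exists_orthogonal y₀
  have hxz : B x z' = 0 := by
    have : Submodule.span ℂ (Set.range e) ≤ LinearMap.ker (B x) :=
      Submodule.span_le.2 (by rintro _ ⟨l, rfl⟩; exact hxe l)
    exact this hz'
  obtain ⟨y, hy⟩ : ∃ y, y = (B x y₀)⁻¹ • (y₀ - z') := ⟨_, rfl⟩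
  have hxy : B x y = 1 := by
    rw [hy, map_smul, map_sub, hxz, sub_zero, smul_eq_mul, inv_mul_cancel₀ hy₀]
  have hey : ∀ l, B (e l) y = 0 := fun l => by rw [hy, map_smul, hzy, smul_zero]
  have hye : ∀ l, B y (e l) = 0 := fun l => by rw [hB, hey, neg_zero]
  have hyx : B y x = -1 := by rw [hB, hxy]
  refine ⟨Sum.map τ not, Sum.elim ε id, Sum.elim e (fun b => if b = true then x else y),
    ⟨?_, ?_, ?_⟩⟩
  · rintro (k | b)
    · simp [h.τ_τ]
    · simp
  · rintro (k | b)
    · simp [h.ε_τ]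
    · simp
  · rintro (k | b) (l | b')
    · simp only [Sum.elim_inl, Sum.map_inl, Sum.inl.injEq, h.apply]
      congr
    · cases b' <;> simp [hey, hzx]
    · cases b <;> simp [hxe, hye]
    · cases b <;> cases b' <;> simp [hBx, hxy, hyx]

variable [FiniteDimensional ℂ U]

theorem IsDarboux.exists_span_eq_top (hB : ∀ x y, B x y = - B y x) (hnd : B.SeparatingLeft) (n : ℕ) :
    ∀ (J : Type) [DecidableEq J] [Fintype J] (τ : J → J) (ε : J → Bool) (e : J → U),
      IsDarboux B τ ε e → Module.finrank ℂ U ≤ Fintype.card J + n →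
      ∃ (J : Type) (_ : DecidableEq J) (_ : Fintype J) (τ : J → J) (ε : J → Bool) (e : J → U),
        IsDarboux B τ ε e ∧ Submodule.span ℂ (Set.range e) = ⊤ := by
  induction n with
  | zero =>
    intro J _ _ τ ε e h hn
    exact ⟨J, inferInstance, inferInstance, τ, ε, e, h, h.linearIndependent.span_eq_top_of_card_eq_finrank'
      (le_antisymm h.linearIndependent.fintype_card_le_finrank hn)⟩
  | succ n ih =>
    intro J _ _ τ ε e h hn
    by_cases hs : Submodule.span ℂ (Set.range e) = ⊤
    · exact ⟨J, inferInstance, inferInstance, τ, ε, e, h, hs⟩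
    · obtain ⟨τ', ε', e', h'⟩ := h.extend hB hnd hs
      refine ih _ τ' ε' e' h' ?_
      rw [Fintype.card_sum, Fintype.card_bool]
      omega

theorem exists_darboux_basis (hB : ∀ x y, B x y = - B y x) (hnd : B.SeparatingLeft) :
    ∃ (b : Module.Basis (Fin (Module.finrank ℂ U)) ℂ U)
      (τ : Fin (Module.finrank ℂ U) → Fin (Module.finrank ℂ U))
      (ε : Fin (Module.finrank ℂ U) → Bool), IsDarboux B τ ε b := by
  obtain ⟨J, _, _, τ, ε, e, h, hs⟩ := IsDarboux.exists_span_eq_top hB hnd (Module.finrank ℂ U) Empty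
    (fun k => k) (fun _ => true) (fun k => k.elim) ⟨fun k => k.elim, fun k => k.elim,
      fun k => k.elim⟩ (by simp)
  let b := Module.Basis.mk h.linearIndependent hs.ge
  have hcard : Fintype.card J = Module.finrank ℂ U := (Module.finrank_eq_card_basis b).symm
  let σ : J ≃ Fin (Module.finrank ℂ U) := Fintype.equivFinOfCardEq hcard
  refine ⟨b.reindex σ, fun k => σ (τ (σ.symm k)), fun k => ε (σ.symm k), ⟨fun k => ?_, fun k => ?_,
    fun k l => ?_⟩⟩
  · simp [h.τ_τ]
  · simp [h.ε_τ]
  · simp only [Module.Basis.reindex_apply, b, Module.Basis.mk_apply, h.apply, Equiv.symm_apply_eq]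

end Darboux

/-! ### Compatible bases for all the pairings. -/

section Pairs

/-- The data for (i, j) and (j, i) must be chosen together; a well-ordering of the indices decides
which of the two is chosen first. -/
theorem exists_symm_family {ι : Type*} [DecidableEq ι] (X : ι → ι → Type*)
    (r : ∀ i j, X i j → X j i → Prop) (hr : ∀ i j x y, r i j x y → r j i y x)
    (hd : ∀ i, ∃ x, r i i x x) (ho : ∀ i j, ∃ x y, r i j x y) :
    ∃ x : ∀ i j, X i j, ∀ i j, r i j (x i j) (x j i) := by
  classical
  let _ : LinearOrder ι := linearOrderOfSTO WellOrderingRel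
  choose x₀ h₀ using hd
  choose x₁ x₂ h₁ using ho
  let x : ∀ i j, X i j := fun i j => if h : i = j then h ▸ x₀ i else
    if i < j then x₁ i j else x₂ j i
  have hlt : ∀ i j, i < j → r i j (x i j) (x j i) := fun i j hij => by
    have e1 : x i j = x₁ i j := by simp only [x]; rw [dif_neg hij.ne, if_pos hij]
    have e2 : x j i = x₂ i j := by simp only [x]; rw [dif_neg hij.ne', if_neg hij.asymm]
    rw [e1, e2]
    exact h₁ i j
  refine ⟨x, fun i j => ?_⟩
  rcases lt_trichotomy i j with h | h | h
  · exact hlt i j h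
  · subst h
    have e1 : x i i = x₀ i := by change dite _ _ _ = _; rw [dif_pos rfl]
    rw [e1]
    exact h₀ i
  · exact hr _ _ _ _ (hlt j i h)

theorem exists_dual_basis {U U' : Type*} [AddCommGroup U] [Module ℂ U] [FiniteDimensional ℂ U]
    [AddCommGroup U'] [Module ℂ U'] [FiniteDimensional ℂ U'] (B : U →ₗ[ℂ] U' →ₗ[ℂ] ℂ)
    (hB : B.Nondegenerate) {J : Type*} [Fintype J] [DecidableEq J] (b : Module.Basis J ℂ U) :
    ∃ b' : Module.Basis J ℂ U', ∀ k l, B (b k) (b' l) = if l = k then 1 else 0 := by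
  have h1 : Function.Injective B.flip := by
    rw [← LinearMap.ker_eq_bot, LinearMap.ker_eq_bot']
    intro y hy
    exact hB.2 y fun x => congrArg (fun f => f x) hy
  have h2 : Function.Injective B := by
    rw [← LinearMap.ker_eq_bot, LinearMap.ker_eq_bot']
    intro x hx
    exact hB.1 x fun y => congrArg (fun f => f y) hx
  have h3 : Module.finrank ℂ U' = Module.finrank ℂ (Module.Dual ℂ U) := by
    refine le_antisymm (LinearMap.finrank_le_finrank_of_injective h1) ?_
    rw [Subspace.dual_finrank_eq]
    refine (LinearMap.finrank_le_finrank_of_injective h2).trans ?_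
    exact Subspace.dual_finrank_eq.le
  let eB := LinearEquiv.ofInjectiveOfFinrankEq B.flip h1 h3
  refine ⟨b.dualBasis.map eB.symm, fun k l => ?_⟩
  have h4 : B.flip (eB.symm (b.dualBasis l)) = b.dualBasis l := eB.apply_symm_apply _
  rw [Module.Basis.map_apply, ← LinearMap.flip_apply B, h4, Module.Basis.dualBasis_apply_self]
  simp [eq_comm]

variable {ι : Type*} [DecidableEq ι] {V : ι → ι → Type*} [∀ i j, AddCommGroup (V i j)]
    [∀ i j, Module ℂ (V i j)] [∀ i j, FiniteDimensional ℂ (V i j)]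

theorem SkewPairing.exists_bases (ω : SkewPairing V) :
    ∃ (b : ∀ i j, Module.Basis (Fin (Module.finrank ℂ (V i j))) ℂ (V i j))
      (τ : ∀ i j, Fin (Module.finrank ℂ (V i j)) → Fin (Module.finrank ℂ (V j i)))
      (ε : ∀ i j, Fin (Module.finrank ℂ (V i j)) → Bool),
      ∀ i j, (∀ k, τ j i (τ i j k) = k) ∧ (∀ k, ε j i (τ i j k) = !ε i j k) ∧
        ∀ k l, ω.form i j (b i j k) (b j i l)
          = if l = τ i j k then (if ε i j k = true then 1 else -1) else 0 := by
  let X : ι → ι → Type _ := fun i j => Module.Basis (Fin (Module.finrank ℂ (V i j))) ℂ (V i j) ×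
    (Fin (Module.finrank ℂ (V i j)) → Fin (Module.finrank ℂ (V j i))) ×
    (Fin (Module.finrank ℂ (V i j)) → Bool)
  let r₀ : ∀ i j, X i j → X j i → Prop := fun i j x y => (∀ k, y.2.1 (x.2.1 k) = k) ∧
    (∀ k, y.2.2 (x.2.1 k) = !x.2.2 k) ∧ ∀ k l, ω.form i j (x.1 k) (y.1 l)
          = if l = x.2.1 k then (if x.2.2 k = true then 1 else -1) else 0
  have hr₀ : ∀ i j x y, r₀ i j x y → (∀ l, x.2.1 (y.2.1 l) = l) → r₀ j i y x := by
    intro i j x y h hl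
    refine ⟨hl, fun l => ?_, fun l k => ?_⟩
    · have := h.2.1 (y.2.1 l)
      rw [hl] at this
      rw [this, Bool.not_not]
    · rw [ω.skew, h.2.2]
      by_cases hk : k = y.2.1 l
      · subst hk
        have := h.2.1 (y.2.1 l)
        rw [hl] at this
        rw [hl, if_pos rfl, if_pos rfl, this]
        cases x.2.2 (y.2.1 l) <;> simp
      · rw [if_neg hk, if_neg fun h' => hk (by rw [h', h.1]), neg_zero]
  have hd : ∀ i, ∃ x, r₀ i i x x ∧ r₀ i i x x := fun i => by
    obtain ⟨b, τ, ε, h⟩ := exists_darboux_basis (ω.skew i i) (ω.nondegenerate i i).1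
    exact ⟨(b, τ, ε), ⟨h.τ_τ, h.ε_τ, h.apply⟩, ⟨h.τ_τ, h.ε_τ, h.apply⟩⟩
  -- Off the diagonal a pair of dual bases suffices, with sign + on one side and - on the other. On
  -- the diagonal a symplectic basis is needed.
  have ho : ∀ i j, ∃ x y, r₀ i j x y ∧ r₀ j i y x := fun i j => by
    obtain ⟨b', hb'⟩ := exists_dual_basis (ω.form i j) (ω.nondegenerate i j)
      (Module.finBasis ℂ (V i j))
    have hcard : Module.finrank ℂ (V i j) = Module.finrank ℂ (V j i) := by
      rw [Module.finrank_eq_card_basis b', Fintype.card_fin]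
    have h1 : r₀ i j (Module.finBasis ℂ (V i j), finCongr hcard, fun _ => true)
        (b'.reindex (finCongr hcard), finCongr hcard.symm, fun _ => false) := by
      refine ⟨fun k => rfl, fun k => rfl, fun k l => ?_⟩
      simp only [Module.Basis.reindex_apply, hb', if_true, Equiv.symm_apply_eq]
    exact ⟨_, _, h1, hr₀ _ _ _ _ h1 fun l => rfl⟩
  obtain ⟨x, hx⟩ := exists_symm_family X (fun i j x y => r₀ i j x y ∧ r₀ j i y x)
    (fun i j x y h => ⟨h.2, h.1⟩) hd ho
  exact ⟨fun i j => (x i j).1, fun i j => (x i j).2.1, fun i j => (x i j).2.2,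
    fun i j => (hx i j).1⟩

end Pairs

end QuiverMoment

end

noncomputable section

namespace QuiverMoment

/-! ### Polynomial functions in coordinates. -/

section PolyFun

variable {U : Type*} [AddCommGroup U] [Module ℂ U] {σ : Type*} (b : Module.Basis σ ℂ U)

theorem coe_dual_mem_polyFun (φ : Module.Dual ℂ U) : (φ : U → ℂ) ∈ polyFun U :=
  Algebra.subset_adjoin ⟨φ, rfl⟩

/-- The polynomial function given by a polynomial in the coordinates of a basis. -/
def toPolyFun : MvPolynomial σ ℂ →ₐ[ℂ] polyFun U :=
  MvPolynomial.aeval fun s => ⟨(b.coord s : U → ℂ), coe_dual_mem_polyFun _⟩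

theorem toPolyFun_apply (g : MvPolynomial σ ℂ) (x : U) :
    (toPolyFun b g : U → ℂ) x = MvPolynomial.eval (fun s => b.repr x s) g := by
  have h : ((Pi.evalAlgHom ℂ (fun _ : U => ℂ) x).comp (polyFun U).val).comp (toPolyFun b)
      = MvPolynomial.aeval fun s => b.repr x s := by
    apply MvPolynomial.algHom_ext
    intro s
    simp [toPolyFun]
  have h1 := congrArg (fun h => h g) h
  rw [← MvPolynomial.aeval_eq_eval]
  exact h1

theorem toPolyFun_bijective [Finite σ] : Function.Bijective (toPolyFun b) := by
  have := Fintype.ofFinite σ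
  constructor
  · intro g h hgh
    refine MvPolynomial.funext fun x => ?_
    have h1 := fun y => congrArg (fun f : polyFun U => (f : U → ℂ) y) hgh
    simp only [toPolyFun_apply] at h1
    have h2 := h1 (b.equivFun.symm x)
    have h3 : (fun s => b.repr (b.equivFun.symm x) s) = x := b.equivFun.apply_symm_apply x
    rwa [h3] at h2
  · rintro ⟨f, hf⟩
    have h1 : polyFun U ≤ ((polyFun U).val.comp (toPolyFun b)).range := by
      refine Algebra.adjoin_le ?_
      rintro _ ⟨φ, rfl⟩
      refine ⟨∑ s, φ (b s) • MvPolynomial.X s, ?_⟩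
      funext x
      change (toPolyFun b (∑ s, φ (b s) • MvPolynomial.X s) : U → ℂ) x = φ x
      have h2 : φ x = ∑ s, b.repr x s * φ (b s) := by
        conv_lhs => rw [← b.sum_repr x]
        simp only [map_sum, map_smul, smul_eq_mul]
      rw [toPolyFun_apply, h2]
      simp [mul_comm, MvPolynomial.smul_eval]
    obtain ⟨g, hg⟩ := h1 hf
    exact ⟨g, Subtype.ext hg⟩

end PolyFun

/-! ### The momentum map in coordinates. -/

section Coordinates

variable {ι : Type*} {W : ι → Type*} [∀ i, AddCommGroup (W i)]
  [∀ i, Module ℂ (W i)] [∀ i, FiniteDimensional ℂ (W i)]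
  {V : ι → ι → Type*} [∀ i j, AddCommGroup (V i j)] [∀ i j, Module ℂ (V i j)]
  {ω : SkewPairing V} {n : ι → ℕ} {d : ι → ι → ℕ}

/-- Bases of the `V i j` in which the pairings are given by a signed involution. -/
structure SkewPairing.Bases (ω : SkewPairing V) (d : ι → ι → ℕ) where
  basis : ∀ i j, Module.Basis (Fin (d i j)) ℂ (V i j)
  τ : ∀ i j, Fin (d i j) → Fin (d j i)
  ε : ∀ i j, Fin (d i j) → Bool
  τ_τ : ∀ i j k, τ j i (τ i j k) = k
  ε_τ : ∀ i j k, ε j i (τ i j k) = !ε i j k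
  form_apply : ∀ i j k l, ω.form i j (basis i j k) (basis j i l)
    = if l = τ i j k then (if ε i j k = true then 1 else -1) else 0

theorem SkewPairing.nonempty_bases [DecidableEq ι] [∀ i j, FiniteDimensional ℂ (V i j)]
    (ω : SkewPairing V) : Nonempty (ω.Bases fun i j => Module.finrank ℂ (V i j)) := by
  obtain ⟨b, τ, ε, h⟩ := ω.exists_bases
  exact ⟨b, τ, ε, fun i j => (h i j).1, fun i j => (h i j).2.1, fun i j => (h i j).2.2⟩

variable (𝒷 : ω.Bases d) (c : ∀ i, Module.Basis (Fin (n i)) ℂ (W i))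

/-- The quiver whose arrows are the elements of the bases. -/
def SkewPairing.Bases.quiver : DoubledQuiver ι (Σ i, Σ j, Fin (d i j)) where
  s β := β.1
  t β := β.2.1
  τ β := ⟨β.2.1, β.1, 𝒷.τ _ _ β.2.2⟩
  pos β := 𝒷.ε _ _ β.2.2
  τ_τ := fun ⟨i, j, k⟩ => by simp only [𝒷.τ_τ]
  pos_τ := fun ⟨i, j, k⟩ => by simp only [𝒷.ε_τ]
  s_τ := fun ⟨i, j, k⟩ => rfl
  t_τ := fun ⟨i, j, k⟩ => rfl

theorem SkewPairing.Bases.form_eq (i j : ι) (e : V i j) (e' : V j i) : ω.form i j e e' =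
    ∑ k : Fin (d i j), (if 𝒷.ε i j k = true then (1 : ℂ) else -1) * ((𝒷.basis i j).repr e k
      * (𝒷.basis j i).repr e' (𝒷.τ i j k)) := by
  conv_lhs => rw [← (𝒷.basis i j).sum_repr e, ← (𝒷.basis j i).sum_repr e']
  simp only [map_sum, map_smul, LinearMap.sum_apply, LinearMap.smul_apply, 𝒷.form_apply,
    smul_eq_mul]
  simp only [Finset.mul_sum]
  rw [Finset.sum_comm]
  refine Finset.sum_congr rfl fun k _ => ?_
  rw [Finset.sum_eq_single (𝒷.τ i j k) (fun l _ h => by rw [if_neg h, mul_zero, mul_zero])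
    (by simp), if_pos rfl]
  ring

/-- The basis of `Hom(W i, W j) ⊗ V i j` given by matrix units. -/
def SkewPairing.Bases.homBasis (i j : ι) :
    Module.Basis ((Fin (n j) × Fin (n i)) × Fin (d i j)) ℂ ((W i →ₗ[ℂ] W j) ⊗[ℂ] V i j) :=
  ((c i).linearMap (c j)).tensorProduct (𝒷.basis i j)

theorem SkewPairing.Bases.homBasis_repr_tmul (i j : ι) (A : W i →ₗ[ℂ] W j) (e : V i j)
    (p : Fin (n j)) (q : Fin (n i)) (k : Fin (d i j)) :
    (𝒷.homBasis c i j).repr (A ⊗ₜ e) ((p, q), k)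
      = LinearMap.toMatrix (c i) (c j) A p q * (𝒷.basis i j).repr e k := by
  rw [homBasis, Module.Basis.tensorProduct_repr_tmul_apply, smul_eq_mul, mul_comm]
  rfl

theorem SkewPairing.Bases.toMatrix_contract (i j : ι) (x : (W i →ₗ[ℂ] W j) ⊗[ℂ] V i j)
    (y : (W j →ₗ[ℂ] W i) ⊗[ℂ] V j i) (p r : Fin (n j)) :
    LinearMap.toMatrix (c j) (c j) (contract ω i j x y) p r
      = ∑ k : Fin (d i j), (if 𝒷.ε i j k = true then (1 : ℂ) else -1) * ∑ q : Fin (n i), (𝒷.homBasis c i j).repr x ((p, q), k)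
        * (𝒷.homBasis c j i).repr y ((q, r), 𝒷.τ i j k) := by
  induction x with
  | zero => simp
  | add x x' hx hx' =>
    simp only [map_add, LinearMap.add_apply, Matrix.add_apply, hx, hx', Finsupp.add_apply, add_mul,
      Finset.sum_add_distrib, mul_add]
  | tmul A e =>
    induction y with
    | zero => simp
    | add y y' hy hy' =>
      simp only [map_add, Matrix.add_apply, hy, hy', Finsupp.add_apply, mul_add,
        Finset.sum_add_distrib]
    | tmul A' e' =>
      simp only [contract_tmul, map_smul, Matrix.smul_apply, smul_eq_mul, homBasis_repr_tmul,
        𝒷.form_eq i j e e', Finset.sum_mul, LinearMap.toMatrix_comp (c j) (c i) (c j),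
        Matrix.mul_apply, Finset.mul_sum]
      rw [Finset.sum_comm]
      refine Finset.sum_congr rfl fun k _ => Finset.sum_congr rfl fun q _ => ?_
      ring

variable [Fintype ι] [DecidableEq ι]

/-- The basis of `U` given by matrix units. -/
def SkewPairing.Bases.repBasis :
    Module.Basis (𝒷.quiver.Coord (Sigma.fst : (Σ i, Fin (n i)) → ι)) ℂ (Rep W V) :=
  (Pi.basis fun i => Pi.basis fun j => 𝒷.homBasis c i j).reindex
    { toFun := fun s => ⟨⟨s.1, s.2.1, s.2.2.2⟩, ⟨⟨s.2.1, s.2.2.1.1⟩, rfl⟩, ⟨⟨s.1, s.2.2.1.2⟩, rfl⟩⟩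
      invFun := fun s => ⟨s.1.1, s.1.2.1, ((Fin.cast (congrArg n s.2.1.2) s.2.1.1.2,
        Fin.cast (congrArg n s.2.2.2) s.2.2.1.2), s.1.2.2)⟩
      left_inv := fun s => rfl
      right_inv := fun ⟨⟨i, j, k⟩, ⟨⟨j', p⟩, hp⟩, ⟨⟨i', q⟩, hq⟩⟩ => by
        obtain rfl : j' = j := hp
        obtain rfl : i' = i := hq
        rfl }

theorem SkewPairing.Bases.repBasis_repr (x : Rep W V) (i j : ι) (k : Fin (d i j)) (p : Fin (n j))
    (q : Fin (n i)) :
    (𝒷.repBasis c).repr x ⟨⟨i, j, k⟩, ⟨⟨j, p⟩, rfl⟩, ⟨⟨i, q⟩, rfl⟩⟩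
      = (𝒷.homBasis c i j).repr (x i j) ((p, q), k) := by
  rw [repBasis, Module.Basis.repr_reindex_apply]
  rfl

/-- The matrix of an element of the Lie algebra. -/
def blockMat : LieG W →ₗ[ℂ] Matrix (Σ i, Fin (n i)) (Σ i, Fin (n i)) ℂ where
  toFun Y := Matrix.blockDiagonal' fun j => LinearMap.toMatrix (c j) (c j) (Y j)
  map_add' Y Y' := by
    rw [← Matrix.blockDiagonal'_add]
    congr 1
    funext j
    simp
  map_smul' r Y := by
    rw [RingHom.id_apply, ← Matrix.blockDiagonal'_smul]
    congr 1
    funext j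
    simp

theorem blockMat_apply_eq (Y : LieG W) (j : ι) (p r : Fin (n j)) :
    blockMat c Y ⟨j, p⟩ ⟨j, r⟩ = LinearMap.toMatrix (c j) (c j) (Y j) p r :=
  Matrix.blockDiagonal'_apply_eq (fun j => LinearMap.toMatrix (c j) (c j) (Y j)) j p r

theorem blockMat_injective : Function.Injective (blockMat c) := by
  intro Y Y' h
  funext j
  apply (LinearMap.toMatrix (c j) (c j)).injective
  ext p r
  rw [← blockMat_apply_eq, h, blockMat_apply_eq]

theorem trace_blockMat (Y : LieG W) : (blockMat c Y).trace = totalTrace W Y := by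
  rw [totalTrace, LinearMap.sum_apply, Matrix.trace, Fintype.sum_sigma]
  refine Finset.sum_congr rfl fun j _ => ?_
  rw [LinearMap.comp_apply, LinearMap.trace_eq_matrix_trace ℂ (c j)]
  refine Finset.sum_congr rfl fun p _ => ?_
  exact blockMat_apply_eq c Y j p p

/-- In the adapted bases only the product of the β and τβ components survives in each contraction,
with the sign of β. The other arrows have the wrong source or target for the block considered. -/
theorem SkewPairing.Bases.blockMat_momentBilin (x : Rep W V) (j : ι) (p r : Fin (n j)) :
    blockMat c (momentBilin ω x x) ⟨j, p⟩ ⟨j, r⟩ = 𝒷.quiver.momentMat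
      (DoubledQuiver.toMat fun s => (𝒷.repBasis c).repr x s) ⟨j, p⟩ ⟨j, r⟩ := by
  have h1 : ∀ (i : ι) (k : Fin (d i j)) (q : Fin (n i)),
      (DoubledQuiver.toMat (fun s => (𝒷.repBasis c).repr x s) ⟨i, j, k⟩ :
        Matrix (Σ i, Fin (n i)) (Σ i, Fin (n i)) ℂ) ⟨j, p⟩ ⟨i, q⟩
      = (𝒷.homBasis c i j).repr (x i j) ((p, q), k) := fun i k q => by
    rw [← 𝒷.repBasis_repr c x]
    exact 𝒷.quiver.toMat_apply_coe (Sigma.fst : (Σ i, Fin (n i)) → ι) _ ⟨⟨i, j, k⟩, ⟨⟨j, p⟩, rfl⟩, ⟨⟨i, q⟩, rfl⟩⟩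
  have h2 : ∀ (i : ι) (k : Fin (d j i)) (q : Fin (n i)),
      (DoubledQuiver.toMat (fun s => (𝒷.repBasis c).repr x s) ⟨j, i, k⟩ :
        Matrix (Σ i, Fin (n i)) (Σ i, Fin (n i)) ℂ) ⟨i, q⟩ ⟨j, r⟩
      = (𝒷.homBasis c j i).repr (x j i) ((q, r), k) := fun i k q => by
    rw [← 𝒷.repBasis_repr c x]
    exact 𝒷.quiver.toMat_apply_coe (Sigma.fst : (Σ i, Fin (n i)) → ι) _ ⟨⟨j, i, k⟩, ⟨⟨i, q⟩, rfl⟩, ⟨⟨j, r⟩, rfl⟩⟩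
  rw [blockMat_apply_eq, momentBilin_apply, map_sum, Matrix.sum_apply, DoubledQuiver.momentMat,
    Matrix.sum_apply, Fintype.sum_sigma]
  refine Finset.sum_congr rfl fun i _ => ?_
  rw [𝒷.toMatrix_contract c, Fintype.sum_sigma, Finset.sum_eq_single j]
  · refine Finset.sum_congr rfl fun k _ => ?_
    rw [Matrix.smul_apply, Matrix.mul_apply, Fintype.sum_sigma, Finset.sum_eq_single i]
    · simp only [h1]
      rw [smul_eq_mul]
      refine congrArg₂ _ rfl (Finset.sum_congr rfl fun q _ => ?_)
      exact congrArg₂ _ rfl (h2 i (𝒷.τ i j k) q).symm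
    · intro i' _ hi'
      refine Finset.sum_eq_zero fun q _ => ?_
      rw [DoubledQuiver.toMat_apply, dif_neg (fun h => hi' h.2), zero_mul]
    · simp
  · intro j' _ hj'
    refine Finset.sum_eq_zero fun k _ => ?_
    rw [Matrix.smul_apply, Matrix.mul_apply, Finset.sum_eq_zero fun q _ => ?_, smul_zero]
    rw [DoubledQuiver.toMat_apply, dif_neg (fun h => hj' h.1.symm), zero_mul]
  · simp

end Coordinates

end QuiverMoment

end

noncomputable section

namespace QuiverMoment

/-! ### Presentation of the null-fibre by the momentum polynomials. -/

section NullFibre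

open DoubledQuiver

variable {ι : Type*} {W : ι → Type*} [∀ i, AddCommGroup (W i)]
  [∀ i, Module ℂ (W i)] [∀ i, FiniteDimensional ℂ (W i)]
  {V : ι → ι → Type*} [∀ i j, AddCommGroup (V i j)] [∀ i j, Module ℂ (V i j)]
  [∀ i j, FiniteDimensional ℂ (V i j)]
  {ω : SkewPairing V} {n : ι → ℕ} {d : ι → ι → ℕ} [Fintype ι] [DecidableEq ι]
  (𝒷 : ω.Bases d) (c : ∀ i, Module.Basis (Fin (n i)) ℂ (W i)) (p₀ : Σ i, Fin (n i))

/-- A component of the momentum map as a linear form on its target. -/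
def entry (r : (Σ i, Fin (n i)) × (Σ i, Fin (n i))) : Module.Dual ℂ (traceZero W) :=
  Matrix.entryLinearMap ℂ ℂ r.1 r.2 ∘ₗ blockMat c ∘ₗ (traceZero W).subtype

theorem entry_apply (r : (Σ i, Fin (n i)) × (Σ i, Fin (n i))) (Y : traceZero W) :
    entry c r Y = blockMat c (Y : LieG W) r.1 r.2 := rfl

/-- A trace-zero element whose listed entries vanish is concentrated at (p₀, p₀), hence zero.
Entries separating points span the dual. -/
theorem mem_span_range_entry (φ : Module.Dual ℂ (traceZero W)) :
    φ ∈ Submodule.span ℂ (Set.range fun γ : Eqn (Sigma.fst : (Σ i, Fin (n i)) → ι) p₀ =>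
      entry c γ.1) := by
  refine mem_span_of_iInf_ker_le_ker fun Y hY => ?_
  simp only [Submodule.mem_iInf, LinearMap.mem_ker, entry_apply] at hY
  have h0 : ∀ p r, (p, r) ≠ (p₀, p₀) → blockMat c (Y : LieG W) p r = 0 := by
    rintro ⟨j, p⟩ ⟨j', r⟩ hpr
    by_cases h : j = j'
    · exact hY ⟨(⟨j, p⟩, ⟨j', r⟩), h, hpr⟩
    · exact Matrix.blockDiagonal'_apply_ne
        (fun j => LinearMap.toMatrix (c j) (c j) ((Y : LieG W) j)) p r h
  have h1 : (blockMat c (Y : LieG W)).trace = 0 := by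
    rw [trace_blockMat]
    exact Y.2
  rw [Matrix.trace] at h1
  simp only [Matrix.diag_apply] at h1
  rw [Finset.sum_eq_single p₀
    (fun p _ hp => h0 p p fun h => hp (Prod.mk.inj h).1) fun h => absurd (Finset.mem_univ _) h] at h1
  have h2 : blockMat c (Y : LieG W) = blockMat c 0 := by
    rw [map_zero]
    ext p r
    by_cases h : (p, r) = (p₀, p₀)
    · obtain ⟨rfl, rfl⟩ := Prod.mk.inj h
      exact h1
    · exact h0 p r h
  have h3 : Y = 0 := Subtype.ext (blockMat_injective c h2)
  rw [h3]
  exact zero_mem _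

theorem toPolyFun_momentPoly (γ : Eqn (Sigma.fst : (Σ i, Fin (n i)) → ι) p₀) :
    toPolyFun (𝒷.repBasis c) (𝒷.quiver.momentPoly ℂ p₀ γ)
      = ⟨fun x => entry c γ.1 (moment ω x), moment_mem_polyFun ω _⟩ := by
  apply Subtype.ext
  funext x
  rw [toPolyFun_apply]
  obtain ⟨⟨⟨j, p⟩, ⟨j', r⟩⟩, h, hpr⟩ := γ
  obtain rfl : j = j' := h
  change _ = blockMat c (momentBilin ω x x) ⟨j, p⟩ ⟨j, r⟩
  rw [𝒷.blockMat_momentBilin c]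
  have h1 := 𝒷.quiver.map_momentMat (MvPolynomial.eval fun s => (𝒷.repBasis c).repr x s)
    (toMat MvPolynomial.X)
  have h2 := congrFun (congrFun h1 ⟨j, p⟩) ⟨j, r⟩
  simp only [map_toMat, MvPolynomial.eval_X] at h2
  exact h2

theorem nullIdeal_eq_map : nullIdeal W ω = (Ideal.span (Set.range
    (𝒷.quiver.momentPoly (ν := (Sigma.fst : (Σ i, Fin (n i)) → ι)) ℂ p₀))).map
      (toPolyFun (𝒷.repBasis c)).toRingHom := by
  rw [Ideal.map_span, ← Set.range_comp]
  apply le_antisymm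
  · refine Ideal.span_le.2 ?_
    rintro _ ⟨φ, rfl⟩
    obtain ⟨l, hl⟩ := (Submodule.mem_span_range_iff_exists_fun ℂ).1 (mem_span_range_entry c p₀ φ)
    have h1 : (⟨fun x => φ (moment ω x), moment_mem_polyFun ω φ⟩ : polyFun (Rep W V))
        = ∑ γ, l γ • toPolyFun (𝒷.repBasis c) (𝒷.quiver.momentPoly ℂ p₀ γ) := by
      apply Subtype.ext
      funext x
      rw [AddSubmonoidClass.coe_finsetSum, Finset.sum_apply]
      change φ (moment ω x) = _
      rw [← hl, LinearMap.sum_apply]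
      refine Finset.sum_congr rfl fun γ _ => ?_
      rw [toPolyFun_momentPoly]
      rfl
    change (⟨fun x => φ (moment ω x), moment_mem_polyFun ω φ⟩ : polyFun (Rep W V)) ∈ _
    rw [h1]
    refine sum_mem fun γ _ => ?_
    rw [Algebra.smul_def]
    exact Ideal.mul_mem_left _ _ (Ideal.subset_span ⟨γ, rfl⟩)
  · refine Ideal.span_le.2 ?_
    rintro _ ⟨γ, rfl⟩
    exact Ideal.subset_span ⟨entry c γ.1, (toPolyFun_momentPoly 𝒷 c p₀ γ).symm⟩

/-- The presentation of the coordinate ring of the null-fibre in coordinates. -/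
def toNullFibreRing : MvPolynomial (𝒷.quiver.Coord (Sigma.fst : (Σ i, Fin (n i)) → ι)) ℂ →+*
    NullFibreRing W ω :=
  (Ideal.Quotient.mk (nullIdeal W ω)).comp (toPolyFun (𝒷.repBasis c)).toRingHom

theorem toNullFibreRing_surjective : Function.Surjective (toNullFibreRing 𝒷 c) :=
  Ideal.Quotient.mk_surjective.comp (toPolyFun_bijective (𝒷.repBasis c)).2

theorem ker_toNullFibreRing : RingHom.ker (toNullFibreRing 𝒷 c) = Ideal.span (Set.range
    (𝒷.quiver.momentPoly (ν := (Sigma.fst : (Σ i, Fin (n i)) → ι)) ℂ p₀)) := by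
  rw [toNullFibreRing, ← RingHom.comap_ker, Ideal.mk_ker, nullIdeal_eq_map 𝒷 c p₀]
  exact Ideal.comap_map_of_bijective _ (toPolyFun_bijective (𝒷.repBasis c))

theorem constantCoeff_momentPoly (γ : Eqn (Sigma.fst : (Σ i, Fin (n i)) → ι) p₀) :
    MvPolynomial.constantCoeff (𝒷.quiver.momentPoly ℂ p₀ γ) = 0 := by
  rw [MvPolynomial.constantCoeff_eq]
  by_contra h
  have := 𝒷.quiver.isHomogeneous_momentPoly ℂ p₀ γ h
  simp at this

/-- The origin lies on the null-fibre: all the equations have zero constant term. -/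
theorem nontrivial_nullFibreRing (𝒷 : ω.Bases d)
    (c : ∀ i, Module.Basis (Fin (n i)) ℂ (W i)) (p₀ : Σ i, Fin (n i)) : Nontrivial (NullFibreRing W ω) := by
  rw [← not_subsingleton_iff_nontrivial]
  intro hs
  have h1 : (1 : MvPolynomial _ ℂ) ∈ RingHom.ker (toNullFibreRing 𝒷 c) := by
    rw [RingHom.mem_ker]
    exact Subsingleton.elim _ _
  rw [ker_toNullFibreRing 𝒷 c p₀] at h1
  have h2 : Ideal.span (Set.range
      (𝒷.quiver.momentPoly (ν := (Sigma.fst : (Σ i, Fin (n i)) → ι)) ℂ p₀))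
      ≤ RingHom.ker MvPolynomial.constantCoeff :=
    Ideal.span_le.2 (by rintro _ ⟨γ, rfl⟩; exact constantCoeff_momentPoly 𝒷 p₀ γ)
  have h3 := h2 h1
  rw [RingHom.mem_ker, map_one] at h3
  exact one_ne_zero h3

/-- The first index of `d` is the source of an arrow, while blocks are indexed by target first;
hence the transposition. -/
theorem SkewPairing.Bases.card_arrows (i j : ι) : (Finset.univ.filter fun β =>
    𝒷.quiver.t β = i ∧ 𝒷.quiver.s β = j).card = d j i := by
  rw [← Fintype.card_fin (d j i), ← Fintype.card_subtype]
  exact Fintype.card_congr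
    { toFun := fun β => Fin.cast (congrArg₂ d β.2.2 β.2.1) β.1.2.2
      invFun := fun k => ⟨⟨j, i, k⟩, rfl, rfl⟩
      left_inv := fun ⟨⟨i', j', k⟩, h1, h2⟩ => by
        obtain rfl : j' = i := h1
        obtain rfl : i' = j := h2
        rfl
      right_inv := fun k => rfl }

theorem card_fibre_fst (i : ι) :
    Fintype.card {p : Σ i, Fin (n i) // p.1 = i} = n i := by
  conv_rhs => rw [← Fintype.card_fin (n i)]
  exact Fintype.card_congr
    { toFun := fun p => Fin.cast (congrArg n p.2) p.1.2
      invFun := fun k => ⟨⟨i, k⟩, rfl⟩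
      left_inv := fun ⟨⟨i', k⟩, h⟩ => by
        obtain rfl : i' = i := h
        rfl
      right_inv := fun k => rfl }

theorem SkewPairing.Bases.card_coord :
    Fintype.card (𝒷.quiver.Coord (Sigma.fst : (Σ i, Fin (n i)) → ι))
      = ∑ i, ∑ j, d j i * (n i * n j) := by
  rw [DoubledQuiver.card_coord 𝒷.quiver ℂ]
  refine (sum_arrows _ _ _ 𝒷.card_arrows _).trans ?_
  simp only [ddim_eq, card_fibre_fst]

theorem card_eqn : Fintype.card (Eqn (Sigma.fst : (Σ i, Fin (n i)) → ι) p₀) + 1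
    = ∑ i, n i * n i := by
  rw [card_eqn_add_one ℂ, ← sum_ddim_self]
  simp only [ddim_eq, card_fibre_fst]

end NullFibre

end QuiverMoment

end

noncomputable section

namespace QuiverMoment

theorem exists_natCast_of_ringKrullDim_add (B : Type*) [CommRing B] [Nontrivial B] (c N : ℕ)
    (h : ringKrullDim B + c = N) : ∃ d : ℕ, ringKrullDim B = d ∧ d + c = N := by
  have h0 : 0 ≤ ringKrullDim B := ringKrullDim_nonneg_of_nontrivial
  generalize ringKrullDim B = x at h h0
  cases x with
  | bot => simp at h0
  | coe x =>
    cases x with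
    | top =>
      have : (⊤ : ℕ∞) + c = N := by exact_mod_cast h
      simp at this
    | coe d => exact ⟨d, rfl, by exact_mod_cast h⟩

theorem JacobianBound.exists_ringKrullDim {k σ Γ : Type*} [Field k] [Fintype σ] [DecidableEq σ]
    [Fintype Γ] {f : Γ → MvPolynomial σ k} {e : ℕ} {B : Type*} [CommRing B] [Nontrivial B]
    {π : MvPolynomial σ k →+* B} (hf : JacobianBound f e) (hπ : Function.Surjective π)
    (hker : RingHom.ker π = Ideal.span (Set.range f))
    (hf0 : ∀ γ, MvPolynomial.constantCoeff (f γ) = 0) :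
    ∃ d : ℕ, ringKrullDim B = d ∧ d + Fintype.card Γ = Fintype.card σ :=
  exists_natCast_of_ringKrullDim_add B _ _ (hf.ringKrullDim_add_card hπ hker hf0)

/-! ### Geometry of the null-fibre and the main theorem. -/

section NullFibre

open DoubledQuiver

variable {ι : Type*} {W : ι → Type*} [∀ i, AddCommGroup (W i)]
  [∀ i, Module ℂ (W i)] [∀ i, FiniteDimensional ℂ (W i)]
  {V : ι → ι → Type*} [∀ i j, AddCommGroup (V i j)] [∀ i j, Module ℂ (V i j)]
  [∀ i j, FiniteDimensional ℂ (V i j)]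
  {ω : SkewPairing V} {n : ι → ℕ} {d : ι → ι → ℕ} [Fintype ι] [DecidableEq ι]
  (𝒷 : ω.Bases d) (c : ∀ i, Module.Basis (Fin (n i)) ℂ (W i)) (p₀ : Σ i, Fin (n i))

theorem SkewPairing.Bases.jacobianBound (hd : ∀ i j, (if i = j then 4 else 2) ≤ d j i) :
    JacobianBound (𝒷.quiver.momentPoly (ν := (Sigma.fst : (Σ i, Fin (n i)) → ι)) ℂ p₀) 2 ∧
    ((Fintype.card (Σ i, Fin (n i)) = 2 → ∀ p q : Σ i, Fin (n i), p ≠ q →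
      (if p.1 = q.1 then 5 else 3) ≤ d q.1 p.1) →
    JacobianBound (𝒷.quiver.momentPoly (ν := (Sigma.fst : (Σ i, Fin (n i)) → ι)) ℂ p₀) 3) :=
  𝒷.quiver.jacobianBound_momentPoly ℂ two_ne_zero (fun i j => d j i) 𝒷.card_arrows hd p₀

variable {e : ℕ}

theorem isDomain_nullFibreRing (𝒷 : ω.Bases d) (c : ∀ i, Module.Basis (Fin (n i)) ℂ (W i))
    (p₀ : Σ i, Fin (n i)) (hJ : JacobianBound
      (𝒷.quiver.momentPoly (ν := (Sigma.fst : (Σ i, Fin (n i)) → ι)) ℂ p₀) e) (he : 1 ≤ e) :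
    IsDomain (NullFibreRing W ω) ∧ IsIntegrallyClosed (NullFibreRing W ω) := by
  have hnt := nontrivial_nullFibreRing 𝒷 c p₀
  exact hJ.isDomain_and_isIntegrallyClosed (B := NullFibreRing W ω)
    (π := toNullFibreRing 𝒷 c) he (toNullFibreRing_surjective 𝒷 c)
    (ker_toNullFibreRing 𝒷 c p₀) 2
    fun γ => 𝒷.quiver.isHomogeneous_momentPoly ℂ p₀ γ

theorem ringKrullDim_nullFibreRing (𝒷 : ω.Bases d) (c : ∀ i, Module.Basis (Fin (n i)) ℂ (W i))
    (p₀ : Σ i, Fin (n i)) (hJ : JacobianBound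
      (𝒷.quiver.momentPoly (ν := (Sigma.fst : (Σ i, Fin (n i)) → ι)) ℂ p₀) e) :
    ringKrullDim (NullFibreRing W ω)
        + Fintype.card (Eqn (Sigma.fst : (Σ i, Fin (n i)) → ι) p₀)
      = Fintype.card (𝒷.quiver.Coord (Sigma.fst : (Σ i, Fin (n i)) → ι)) :=
  hJ.ringKrullDim_add_card (B := NullFibreRing W ω) (π := toNullFibreRing 𝒷 c)
    (toNullFibreRing_surjective 𝒷 c) (ker_toNullFibreRing 𝒷 c p₀)
    fun γ => constantCoeff_momentPoly 𝒷 p₀ γ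

theorem isRegularInCodim_nullFibreRing (𝒷 : ω.Bases d)
    (c : ∀ i, Module.Basis (Fin (n i)) ℂ (W i)) (p₀ : Σ i, Fin (n i)) (hJ : JacobianBound
      (𝒷.quiver.momentPoly (ν := (Sigma.fst : (Σ i, Fin (n i)) → ι)) ℂ p₀) e) :
    IsRegularInCodim (NullFibreRing W ω) e :=
  hJ.isRegularInCodim (toNullFibreRing_surjective 𝒷 c) (ker_toNullFibreRing 𝒷 c p₀)

theorem isCompleteIntersection_nullIdeal (𝒷 : ω.Bases d)
    (c : ∀ i, Module.Basis (Fin (n i)) ℂ (W i)) (p₀ : Σ i, Fin (n i)) (hJ : JacobianBound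
      (𝒷.quiver.momentPoly (ν := (Sigma.fst : (Σ i, Fin (n i)) → ι)) ℂ p₀) e) :
    IsCompleteIntersection (Rep W V) (nullIdeal W ω) := by
  refine ⟨Fintype.card (Eqn (Sigma.fst : (Σ i, Fin (n i)) → ι) p₀),
    fun k => toPolyFun (𝒷.repBasis c) (𝒷.quiver.momentPoly ℂ p₀ ((Fintype.equivFin _).symm k)),
    ?_, ?_⟩
  · rw [nullIdeal_eq_map 𝒷 c p₀, Ideal.map_span, ← Set.range_comp]
    exact congrArg Ideal.span ((Fintype.equivFin _).symm.surjective.range_comp fun γ =>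
      toPolyFun (𝒷.repBasis c) (𝒷.quiver.momentPoly ℂ p₀ γ))
  · rw [Module.finrank_eq_card_basis (𝒷.repBasis c)]
    exact ringKrullDim_nullFibreRing 𝒷 c p₀ hJ

theorem exists_ringKrullDim_nullFibreRing (𝒷 : ω.Bases d)
    (c : ∀ i, Module.Basis (Fin (n i)) ℂ (W i)) (p₀ : Σ i, Fin (n i)) (hJ : JacobianBound
      (𝒷.quiver.momentPoly (ν := (Sigma.fst : (Σ i, Fin (n i)) → ι)) ℂ p₀) e) :
    ∃ m : ℕ, ringKrullDim (NullFibreRing W ω) = m ∧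
      m + ∑ i, n i * n i = ∑ i, ∑ j, d j i * (n i * n j) + 1 := by
  have hnt := nontrivial_nullFibreRing 𝒷 c p₀
  have h : ∃ m : ℕ, ringKrullDim (NullFibreRing W ω) = m ∧
      m + Fintype.card (Eqn (Sigma.fst : (Σ i, Fin (n i)) → ι) p₀)
        = Fintype.card (𝒷.quiver.Coord (Sigma.fst : (Σ i, Fin (n i)) → ι)) :=
    hJ.exists_ringKrullDim (B := NullFibreRing W ω) (π := toNullFibreRing 𝒷 c)
      (toNullFibreRing_surjective 𝒷 c) (ker_toNullFibreRing 𝒷 c p₀)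
      fun γ => constantCoeff_momentPoly 𝒷 p₀ γ
  obtain ⟨m, hm, hmc⟩ := h
  refine ⟨m, hm, ?_⟩
  rw [← card_eqn p₀, ← 𝒷.card_coord, ← hmc, add_assoc]

end NullFibre

theorem eq_zero_of_sum_eq_add {ι : Type*} [Fintype ι] [DecidableEq ι] (n : ι → ℕ) (i j l : ι)
    (hij : i ≠ j) (hli : l ≠ i) (hlj : l ≠ j) (h : ∑ i, n i ≤ n i + n j) : n l = 0 := by
  have h1 : ∑ m ∈ ({i, j, l} : Finset ι), n m ≤ ∑ m, n m :=
    Finset.sum_le_sum_of_subset (Finset.subset_univ _)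
  rw [Finset.sum_insert (by simp [hij, hli.symm]), Finset.sum_pair hlj.symm] at h1
  omega

theorem eq_single_of_sum_eq_two {ι : Type*} [Fintype ι] [DecidableEq ι] (n : ι → ℕ)
    (h : ∑ i, n i = 2) (p q : Σ i, Fin (n i)) (hpq : p ≠ q) :
    (p.1 = q.1 → ∀ l, n l = if l = p.1 then 2 else 0) ∧
    (p.1 ≠ q.1 → ∀ l, n l = if l = p.1 ∨ l = q.1 then 1 else 0) := by
  obtain ⟨i, k⟩ := p
  obtain ⟨j, k'⟩ := q
  have hi := k.isLt
  have hj := k'.isLt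
  constructor
  · rintro (rfl : i = j) l
    have hk : k.1 ≠ k'.1 := fun h => hpq (by rw [Fin.ext h])
    have h1 : ∀ l, l ≠ i → n i + n l ≤ 2 := fun l hl => by
      rw [← h, ← Finset.sum_pair hl.symm]
      exact Finset.sum_le_sum_of_subset (Finset.subset_univ _)
    have h2 : n i ≤ 2 := by
      rw [← h]
      exact Finset.single_le_sum (fun _ _ => Nat.zero_le _) (Finset.mem_univ i)
    split_ifs with hl
    · change l = i at hl
      subst hl
      omega
    · have := h1 l hl
      omega
  · intro hij l
    have hij' : i ≠ j := hij
    have h1 : n i + n j ≤ 2 := by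
      rw [← h, ← Finset.sum_pair hij']
      exact Finset.sum_le_sum_of_subset (Finset.subset_univ _)
    split_ifs with hl
    · rcases hl with hl | hl
      · change l = i at hl
        subst hl
        omega
      · change l = j at hl
        subst hl
        omega
    · push Not at hl
      exact eq_zero_of_sum_eq_add n i j l hij' hl.1 hl.2 (by omega)

end QuiverMoment

end

theorem mainTheorem3 {ι : Type*} [Fintype ι] [DecidableEq ι]
    (W : ι → Type*) [∀ i, AddCommGroup (W i)] [∀ i, Module ℂ (W i)]
    [∀ i, FiniteDimensional ℂ (W i)]
    (V : ι → ι → Type*) [∀ i j, AddCommGroup (V i j)] [∀ i j, Module ℂ (V i j)]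
    [∀ i j, FiniteDimensional ℂ (V i j)]
    (ω : QuiverMoment.SkewPairing V)
    (n : ι → ℤ) (hn : ∀ i, n i = Module.finrank ℂ (W i)) (hn0 : n ≠ 0)
    (D : Matrix ι ι ℤ) (hD : ∀ i j, D i j = Module.finrank ℂ (V i j))
    (a : ℤ) (ha : IsLeast (Set.range fun p : ι × ι => D p.1 p.2 - if p.1 = p.2 then 2 else 0) a)
    (ha2 : 2 ≤ a) :
    IrreducibleSpace (PrimeSpectrum (QuiverMoment.NullFibreRing W ω)) ∧
    QuiverMoment.IsNormalRing (QuiverMoment.NullFibreRing W ω) ∧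
    QuiverMoment.IsCompleteIntersection (QuiverMoment.Rep W V) (QuiverMoment.nullIdeal W ω) ∧
    (∃ d : ℕ, (d : ℤ) = n ⬝ᵥ (D - 1).mulVec n + 1 ∧
      ringKrullDim (QuiverMoment.NullFibreRing W ω) = (d : WithBot ℕ∞)) ∧
    ((¬ ∃ i j, i ≠ j ∧ n = Pi.single i 1 + Pi.single j 1 ∧ D i j = 2) →
      (¬ ∃ i, n = Pi.single i 2 ∧ D i i = 4) →
      QuiverMoment.IsRegularInCodim (QuiverMoment.NullFibreRing W ω) 3) := by 
  obtain ⟨𝒷⟩ := ω.nonempty_bases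
  have c : ∀ i, Module.Basis (Fin (Module.finrank ℂ (W i))) ℂ (W i) :=
    fun i => Module.finBasis ℂ (W i)
  obtain ⟨i₀, hi₀⟩ : ∃ i, Module.finrank ℂ (W i) ≠ 0 := by
    by_contra! hcon
    exact hn0 (funext fun i => by rw [hn, hcon]; rfl)
  have p₀ : Σ i, Fin (Module.finrank ℂ (W i)) := ⟨i₀, ⟨0, Nat.pos_of_ne_zero hi₀⟩⟩
  -- The hypothesis a ≥ 2 says that d_ij ≥ 2 + 2δ_ij.
  have hd2 : ∀ i j, (if i = j then 4 else 2) ≤ Module.finrank ℂ (V j i) := by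
    intro i j
    have h1 := ha2.trans (ha.2 ⟨(j, i), rfl⟩)
    simp only [hD, eq_comm (a := j)] at h1
    split_ifs at h1 ⊢ <;> omega
  obtain ⟨hJ2, hJ3⟩ := 𝒷.jacobianBound p₀ hd2
  obtain ⟨hdom, hic⟩ := QuiverMoment.isDomain_nullFibreRing 𝒷 c p₀ hJ2 one_le_two
  refine ⟨inferInstance, QuiverMoment.isNormalRing_of_isIntegrallyClosed,
    QuiverMoment.isCompleteIntersection_nullIdeal 𝒷 c p₀ hJ2, ?_, fun he₁ he₂ =>
    QuiverMoment.isRegularInCodim_nullFibreRing 𝒷 c p₀ (hJ3 fun hcard p q hpq => ?_)⟩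
  · obtain ⟨e, he, hec⟩ := QuiverMoment.exists_ringKrullDim_nullFibreRing 𝒷 c p₀ hJ2
    refine ⟨e, ?_, he⟩
    have h3 := congrArg (Nat.cast (R := ℤ)) hec
    push_cast at h3
    -- The quadratic form is unchanged when D is transposed, which matches the target-first count of
    -- coordinates.
    have h4 : n ⬝ᵥ (D - 1).mulVec n = (∑ i, ∑ j, D j i * (n i * n j)) - ∑ i, n i * n i := by
      rw [Matrix.sub_mulVec, Matrix.one_mulVec, dotProduct_sub]
      congr 1
      simp only [dotProduct, Matrix.mulVec, Finset.mul_sum]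
      rw [Finset.sum_comm]
      exact Finset.sum_congr rfl fun i _ => Finset.sum_congr rfl fun j _ => by ring
    rw [h4]
    simp only [hn, hD]
    linarith
  -- Only total dimension 2 needs attention: either one vertex of dimension 2 with d_ii ≥ 4, or two
  -- of dimension 1 with d_ij ≥ 2. Equality is exactly an excluded case, so the bound improves by
  -- one.
  · have hsum : ∑ i, Module.finrank ℂ (W i) = 2 := by
      rw [← hcard, Fintype.card_sigma]
      simp only [Fintype.card_fin]
    obtain ⟨hs, ho⟩ := QuiverMoment.eq_single_of_sum_eq_two _ hsum p q hpq
    have h5 := hd2 p.1 q.1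
    split_ifs at h5 ⊢ with h
    · refine lt_of_le_of_ne h5 fun h6 => he₂ ⟨p.1, funext fun l => ?_, ?_⟩
      · rw [hn, hs h l, Pi.single_apply]
        split_ifs <;> rfl
      · rw [← h] at h6
        rw [hD, ← h6]
        rfl
    · refine lt_of_le_of_ne h5 fun h6 => he₁ ⟨q.1, p.1, Ne.symm h, funext fun l => ?_, ?_⟩
      · rw [hn, ho h l, Pi.add_apply, Pi.single_apply, Pi.single_apply]
        by_cases h7 : l = p.1
        · have h8 : l ≠ q.1 := fun h8 => h (h7.symm.trans h8)
          simp [h7, h]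
        · simp [h7]
      · rw [hD, ← h6]
        rfl
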